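/- Let $K$ be a commutative ring and $\otimes=\otimes_K$. Let $A$, $B$ be associative unital $K$-algebras and $M$ an $A\otimes B^{o}$-module, with $A$, $B$ and $M$ projective as $K$-modules. For $m\ge 1$ let $T_m=\left[\begin{smallmatrix}A&M^m\\0&B\end{smallmatrix}\right]$ be the triangular matrix algebra of the bimodule $M^m$, and let $T=\left[\begin{smallmatrix}A&M\\0&B\end{smallmatrix}\right]=T_1$. Let $HH^*(-)$ denote Hochschild cohomology over $K$ of an algebra with coefficients in itself, and put $Ext^{-1}=0$. (1) For every $m\ge 1$ there is a split short exact sequence of graded $K$-modules $$0\longrightarrow Ext^{*-1}_{A\otimes B^{o}}(M,M)^{m^2-1}\longrightarrow HH^*T_m\overset{r^*}{\longrightarrow} HH^*T\longrightarrow 0 ,$$ where $r^*$ is induced by the map sending a cochain $f$ of $T_m$ to the cochain $\pi\circ f\circ(\iota,\dots,\iota)$ of $T$, with $\iota:T\to T_m$ and $\pi:T_m\to T$ given by the inclusion of, and the projection onto, the first summand of $M^m$. (2) Suppose moreover that $K$ is a field and that $A$, $B$, $M$ are finite-dimensional over $K$. Then all the spaces $Ext^i_{A\otimes B^{o}}(M,M)$,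 $HH^iT$ and $HH^iT_m$ ($m\ge 1$, $i\ge 0$) are finite-dimensional. With $\chi_S=\sum_{i\ge 0}t^i\dim_K HH^iS\in\mathbf Z[[t]]$ and $\Xi=\sum_{i\ge 0}t^i\dim_K Ext^i_{A\otimes B^{o}}(M,M)\in\mathbf Z[[t]]$, one has for every $m\ge1$ $$\chi_{T_m}=\chi_{T}+t\,(m^2-1)\,\Xi .$$ (3) If in addition $K$ has characteristic $p>0$, let $\chi'(m)\in(\mathbf Z/p\mathbf Z)[[t]]$ be the reduction modulo $p$ of $\chi_{T_m}$, for $m\ge 1$. Then $\chi'(m)$ depends only on the class of $m^2$ modulo $p$: if $m,m'\ge1$ and $m^2\equiv m'^2 \pmod p$, then $\chi'(m)=\chi'(m')$. In particular $\chi'(m+p)=\chi'(m)$ for all $m\ge1$, and $\chi'(p-1)=\chi'(1)=\chi'(p+1)$. -/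

import Mathlib

open CategoryTheory
open scoped TensorProduct

set_option linter.unusedSectionVars false

universe w u

noncomputable section

section Hochschild

/-- In a tuple `(t₀, …, tₙ)` with product of `tⱼ` and `tⱼ₊₁` formed, changing the entry `tᵢ` changes
only the entry of index `j.predAbove i`. -/
theorem contractNth_update {T : Type*} [Mul T] {n : ℕ} (j : Fin n) (t : Fin (n + 1) → T)
    (i : Fin (n + 1)) (x : T) :
    Fin.contractNth j.castSucc (· * ·) (Function.update t i x) =
      Function.update (Fin.contractNth j.castSucc (· * ·) t) (j.predAbove i)
        (if i = j.castSucc then x * t j.succ else if i = j.succ then t j.castSucc * x else x) := by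
  funext k
  have hc : ∀ a b : Fin (n + 1), a.val = b.val → t a = t b := fun a b h => by rw [Fin.ext h]
  have hp : (j.predAbove i).val = if j.val < i.val then i.val - 1 else i.val := by
    unfold Fin.predAbove
    by_cases h : j.castSucc < i
    · rw [dif_pos h, if_pos (by simpa [Fin.lt_def] using h)]; simp
    · rw [dif_neg h, if_neg (by simpa [Fin.lt_def] using h)]; simp
  generalize j.predAbove i = q at hp
  simp only [Fin.contractNth, Function.update_apply, Fin.ext_iff, Fin.val_castSucc, Fin.val_succ, hp]
  grind

theorem update_succ_tail {T : Type*} {n : ℕ} (t : Fin (n + 1) → T) (i : Fin n) (x : T) :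
    (fun k : Fin n => Function.update t i.succ x k.succ) =
      Function.update (fun k : Fin n => t k.succ) i x := by
  funext k; simp [Function.update_apply]

theorem update_castSucc_init {T : Type*} {n : ℕ} (t : Fin (n + 1) → T) (i : Fin n) (x : T) :
    (fun k : Fin n => Function.update t i.castSucc x k.castSucc) =
      Function.update (fun k : Fin n => t k.castSucc) i x := by
  funext k; simp [Function.update_apply]

variable (K : Type w) [CommRing K] (T : Type u) [Ring T] [Algebra K T]

/-- Hochschild cochains of degree `n` of `T` with coefficients in `T`: the `K`-multilinear maps
`Tⁿ → T`. -/
abbrev HochschildCochain (n : ℕ) : Type u := MultilinearMap K (fun _ : Fin n => T) T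

variable {K T}

/-- The value at `(t₀, …, tₙ)` of the Hochschild coboundary of `f`, namely
`t₀ f(t₁, …, tₙ) + ∑_{j < n} (-1)^{j+1} f(t₀, …, tⱼ tⱼ₊₁, …, tₙ) + (-1)^{n+1} f(t₀, …, tₙ₋₁) tₙ`. -/
def hochschildFormula {n : ℕ} (f : (Fin n → T) → T) (t : Fin (n + 1) → T) : T :=
  t 0 * f (fun k => t k.succ)
    + ∑ j : Fin n, (-1 : ℤ) ^ (j.val + 1) • f (Fin.contractNth j.castSucc (· * ·) t)
    + (-1 : ℤ) ^ (n + 1) • (f (fun k => t k.castSucc) * t (Fin.last n))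

variable (K T) in
/-- The Hochschild coboundary operator. -/
def hochschildD (n : ℕ) : HochschildCochain K T n →ₗ[K] HochschildCochain K T (n + 1) where
  toFun f :=
    { toFun := hochschildFormula f
      map_update_add' := by
        intro inst t i x y
        obtain rfl := Subsingleton.elim inst (instDecidableEqFin (n + 1))
        have e1 : Function.update t i (x + y) 0 * f (fun k => Function.update t i (x + y) k.succ) =
            Function.update t i x 0 * f (fun k => Function.update t i x k.succ) +
            Function.update t i y 0 * f (fun k => Function.update t i y k.succ) := by
          rcases Fin.eq_zero_or_eq_succ i with rfl | ⟨i, rfl⟩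
          · simp [add_mul]
          · simp only [update_succ_tail, f.map_update_add]
            simp [mul_add, (Fin.succ_ne_zero i).symm]
        have e2 : f (fun k => Function.update t i (x + y) k.castSucc) *
              Function.update t i (x + y) (Fin.last n) =
            f (fun k => Function.update t i x k.castSucc) * Function.update t i x (Fin.last n) +
            f (fun k => Function.update t i y k.castSucc) * Function.update t i y (Fin.last n) := by
          rcases Fin.eq_castSucc_or_eq_last i with ⟨i, rfl⟩ | rfl
          · simp only [update_castSucc_init, f.map_update_add]
            simp [add_mul, (Fin.castSucc_lt_last i).ne']
          · simp [mul_add, (Fin.castSucc_lt_last _).ne]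
        have e3 : ∀ j : Fin n, f (Fin.contractNth j.castSucc (· * ·) (Function.update t i (x + y))) =
            f (Fin.contractNth j.castSucc (· * ·) (Function.update t i x)) +
            f (Fin.contractNth j.castSucc (· * ·) (Function.update t i y)) := by
          intro j
          rw [contractNth_update, contractNth_update, contractNth_update, ← f.map_update_add]
          congr 2
          split_ifs <;> simp [add_mul, mul_add]
        simp only [hochschildFormula, e1, e2, e3, smul_add, Finset.sum_add_distrib]
        abel
      map_update_smul' := by
        intro inst t i c x
        obtain rfl := Subsingleton.elim inst (instDecidableEqFin (n + 1))
        have e1 : Function.update t i (c • x) 0 * f (fun k => Function.update t i (c • x) k.succ) =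
            c • (Function.update t i x 0 * f (fun k => Function.update t i x k.succ)) := by
          rcases Fin.eq_zero_or_eq_succ i with rfl | ⟨i, rfl⟩
          · simp
          · simp only [update_succ_tail, f.map_update_smul]
            simp [(Fin.succ_ne_zero i).symm]
        have e2 : f (fun k => Function.update t i (c • x) k.castSucc) *
              Function.update t i (c • x) (Fin.last n) =
            c • (f (fun k => Function.update t i x k.castSucc) *
              Function.update t i x (Fin.last n)) := by
          rcases Fin.eq_castSucc_or_eq_last i with ⟨i, rfl⟩ | rfl
          · simp only [update_castSucc_init, f.map_update_smul]
            simp [(Fin.castSucc_lt_last i).ne']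
          · simp [(Fin.castSucc_lt_last _).ne]
        have e3 : ∀ j : Fin n, f (Fin.contractNth j.castSucc (· * ·) (Function.update t i (c • x))) =
            c • f (Fin.contractNth j.castSucc (· * ·) (Function.update t i x)) := by
          intro j
          rw [contractNth_update, contractNth_update, ← f.map_update_smul]
          congr 2
          split_ifs <;> simp
        simp only [hochschildFormula, e1, e2, e3, smul_add, Finset.smul_sum, smul_comm c] }
  map_add' f g := by
    ext t
    simp only [hochschildFormula, MultilinearMap.coe_mk, add_apply, mul_add, add_mul,
      smul_add, Finset.sum_add_distrib]
    abel
  map_smul' c f := by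
    ext t
    simp only [hochschildFormula, MultilinearMap.coe_mk, smul_apply, RingHom.id_apply,
      smul_add, Finset.smul_sum, smul_comm c, mul_smul_comm, smul_mul_assoc]

@[simp]
theorem hochschildD_apply {n : ℕ} (f : HochschildCochain K T n) (t : Fin (n + 1) → T) :
    hochschildD K T n f t = hochschildFormula f t := rfl

/-- A double alternating sum of terms with the simplicial symmetry vanishes. -/
theorem sum_sum_alternating_eq_zero {G : Type*} [AddCommGroup G] (N : ℕ)
    (F : ℕ → ℕ → G) (h : ∀ i j, i ≤ j → j < N → F i (j + 1) = F j i) :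
    ∑ j ∈ Finset.range (N + 1), ∑ i ∈ Finset.range N, (-1 : ℤ) ^ (i + j) • F i j = 0 := by
  rw [← Finset.sum_product']
  refine Finset.sum_involution
    (fun x _ => if x.2 < x.1 then (x.2, x.1 - 1) else (x.2 + 1, x.1)) ?_ ?_ ?_ ?_
  · rintro ⟨j, i⟩ hx
    simp only [Finset.mem_product, Finset.mem_range] at hx
    dsimp only
    split_ifs with hij
    · obtain ⟨j, rfl⟩ : ∃ j', j = j' + 1 := ⟨j - 1, by omega⟩
      simp only [Nat.add_sub_cancel]
      rw [h i j (by omega) (by omega), ← add_assoc, pow_succ, add_comm j i]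
      simp
    · dsimp only
      rw [h j i (by omega) (by omega), ← add_assoc, pow_succ, add_comm j i]
      simp
  · rintro ⟨j, i⟩ hx _ he
    dsimp only at he
    split_ifs at he with hij <;> simp only [Prod.mk.injEq] at he <;> omega
  · rintro ⟨j, i⟩ hx
    simp only [Finset.mem_product, Finset.mem_range] at hx ⊢
    split_ifs <;> dsimp only <;> omega
  · rintro ⟨j, i⟩ hx
    dsimp only
    by_cases h : i < j
    · rw [if_pos h, if_neg (by dsimp only; omega)]
      simp only [Prod.mk.injEq, and_true]; omega
    · rw [if_neg h, if_pos (by dsimp only; omega)]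
      simp

/-- The cochain `f` extended to the bimodule map `t₀ ⊗ ⋯ ⊗ tₙ₊₁ ↦ t₀ f(t₁, …, tₙ) tₙ₊₁` on the bar
construction. -/
def barExtend {n : ℕ} (f : (Fin n → T) → T) (t : Fin (n + 2) → T) : T :=
  t 0 * f (fun k => t k.succ.castSucc) * t (Fin.last (n + 1))

theorem contractNth_contractNth {n : ℕ} (t : Fin (n + 3) → T) (i j : ℕ) (hij : i ≤ j)
    (hj : j < n + 1) :
    Fin.contractNth (⟨i, by omega⟩ : Fin (n + 2)) (· * ·)
        (Fin.contractNth (⟨j + 1, by omega⟩ : Fin (n + 3)) (· * ·) t) =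
      Fin.contractNth (⟨j, by omega⟩ : Fin (n + 2)) (· * ·)
        (Fin.contractNth (⟨i, by omega⟩ : Fin (n + 3)) (· * ·) t) := by
  have hc : ∀ a b : Fin (n + 3), a.val = b.val → t a = t b := fun a b h => by rw [Fin.ext h]
  funext k
  simp only [Fin.contractNth, Fin.val_castSucc, Fin.val_succ]
  have := mul_assoc (t k.castSucc.castSucc) (t k.succ.castSucc) (t k.succ.succ)
  grind

theorem barExtend_hochschildFormula {n : ℕ} (f : (Fin n → T) → T) (t : Fin (n + 3) → T) :
    barExtend (hochschildFormula f) t =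
      ∑ j : Fin (n + 2), (-1 : ℤ) ^ (j.val) •
        barExtend f (Fin.contractNth j.castSucc (· * ·) t) := by
  have hc : ∀ a b : Fin (n + 3), a.val = b.val → t a = t b := fun a b h => by rw [Fin.ext h]
  rw [Fin.sum_univ_succ, Fin.sum_univ_castSucc]
  simp only [barExtend, hochschildFormula, mul_add, add_mul, Finset.mul_sum, Finset.sum_mul,
    mul_smul_comm, smul_mul_assoc, ← add_assoc]
  congr 1
  · congr 1
    · simp only [Fin.val_zero, pow_zero, one_smul, ← mul_assoc]
      congr 2
    · refine Finset.sum_congr rfl fun j _ => ?_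
      congr 3
      · congr 1
        funext k
        simp only [Fin.contractNth, Fin.val_castSucc, Fin.val_succ]
        grind
      · simp only [Fin.contractNth, Fin.val_castSucc, Fin.val_succ, Fin.val_last]
        grind
  · simp only [Fin.val_succ, Fin.val_last]
    congr 1
    rw [mul_assoc, mul_assoc, mul_assoc]
    congr 1
    congr 1
    · congr 1
      funext k
      simp only [Fin.contractNth, Fin.val_castSucc, Fin.val_succ]
      grind
    · simp only [Fin.contractNth, Fin.val_castSucc, Fin.val_succ, Fin.val_last]
      grind

theorem hochschildFormula_hochschildFormula {n : ℕ} (f : (Fin n → T) → T) (t : Fin (n + 2) → T) :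
    hochschildFormula (hochschildFormula f) t = 0 := by
  have key : ∀ s : Fin (n + 4) → T,
      barExtend (hochschildFormula (hochschildFormula f)) s = 0 := by
    intro s
    rw [barExtend_hochschildFormula]
    simp only [barExtend_hochschildFormula, Finset.smul_sum, smul_smul]
    let F : ℕ → ℕ → T := fun i j => if h : i < n + 2 ∧ j < n + 3 then
      barExtend f (Fin.contractNth (⟨i, by omega⟩ : Fin (n + 3)) (· * ·)
        (Fin.contractNth (⟨j, by omega⟩ : Fin (n + 4)) (· * ·) s)) else 0
    have := sum_sum_alternating_eq_zero (n + 2) F (by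
      intro i j hij hj
      simp only [F]
      rw [dif_pos ⟨by omega, by omega⟩, dif_pos ⟨by omega, by omega⟩,
        contractNth_contractNth s i j hij (by omega)])
    rw [Finset.sum_range] at this
    rw [← this]
    refine Finset.sum_congr rfl fun j _ => ?_
    rw [Finset.sum_range]
    refine Finset.sum_congr rfl fun i _ => ?_
    simp only [F]
    rw [dif_pos ⟨i.2, j.2⟩, ← pow_add, add_comm]
    rfl
  have h := key (Fin.cons 1 (Fin.snoc t 1))
  simpa [barExtend, ← Fin.succ_last, -Fin.succ_last, ← Fin.succ_castSucc] using h

variable (K T) in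
theorem hochschildD_comp (n : ℕ) : hochschildD K T (n + 1) ∘ₗ hochschildD K T n = 0 := by
  ext f t
  exact hochschildFormula_hochschildFormula f t

variable (K T) in
/-- The Hochschild cochain complex of `T` with coefficients in `T`. -/
def hochschildComplex : CochainComplex (ModuleCat.{u} K) ℕ :=
  CochainComplex.of (fun n => ModuleCat.of K (HochschildCochain K T n))
    (fun n => ModuleCat.ofHom (hochschildD K T n))
    (fun n => by rw [← ModuleCat.ofHom_comp, hochschildD_comp]; rfl)

variable (K T) in
theorem hochschildComplex_d (n : ℕ) :
    (hochschildComplex K T).d n (n + 1) = ModuleCat.ofHom (hochschildD K T n) := by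
  simp [hochschildComplex]

variable (K T) in
/-- The Hochschild cohomology `HHⁿ T = Hⁿ(T, T)`. -/
abbrev HochschildCohomology (n : ℕ) : ModuleCat.{u} K := (hochschildComplex K T).homology n

variable (K T) in
/-- The Hilbert–Poincaré series `∑ₙ tⁿ dim_K HHⁿ T`. -/
def hilbertPoincareSeries : PowerSeries ℤ :=
  PowerSeries.mk fun n => (Module.finrank K (HochschildCohomology K T n) : ℤ)

end Hochschild

section Triangular

/-- The underlying module of the triangular algebra of an `A ⊗ Bᵐᵒᵖ`-module `M`: the element
`(a, x, b)` is the upper triangular matrix with rows `(a, x)` and `(0, b)`. The parameter `K` is the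
ground ring, over which the tensor product is formed. -/
@[nolint unusedArguments]
def TriangularAlgebra (_K : Type w) (A B M : Type u) : Type u := A × M × B

namespace TriangularAlgebra

variable {K : Type w} {A B M N : Type u}

/-- The triangular matrix with diagonal entries `a`, `b` and upper right entry `x`. -/
def mk (a : A) (x : M) (b : B) : TriangularAlgebra K A B M := (a, x, b)

/-- The upper left entry. -/
def topLeft (t : TriangularAlgebra K A B M) : A := t.1

/-- The upper right entry. -/
def topRight (t : TriangularAlgebra K A B M) : M := t.2.1

/-- The lower right entry. -/
def botRight (t : TriangularAlgebra K A B M) : B := t.2.2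

@[simp] theorem topLeft_mk (a : A) (x : M) (b : B) :
    (mk a x b : TriangularAlgebra K A B M).topLeft = a := rfl

@[simp] theorem topRight_mk (a : A) (x : M) (b : B) :
    (mk a x b : TriangularAlgebra K A B M).topRight = x := rfl

@[simp] theorem botRight_mk (a : A) (x : M) (b : B) :
    (mk a x b : TriangularAlgebra K A B M).botRight = b := rfl

@[ext]
theorem ext {s t : TriangularAlgebra K A B M} (h₁ : s.topLeft = t.topLeft)
    (h₂ : s.topRight = t.topRight) (h₃ : s.botRight = t.botRight) : s = t :=
  Prod.ext h₁ (Prod.ext h₂ h₃)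

variable [CommRing K] [Ring A] [Algebra K A] [Ring B] [Algebra K B]
  [AddCommGroup M] [Module K M] [Module (A ⊗[K] Bᵐᵒᵖ) M]
  [AddCommGroup N] [Module K N] [Module (A ⊗[K] Bᵐᵒᵖ) N]

instance : AddCommGroup (TriangularAlgebra K A B M) := inferInstanceAs (AddCommGroup (A × M × B))

instance : Module K (TriangularAlgebra K A B M) := inferInstanceAs (Module K (A × M × B))

/-- Matrix multiplication: `a ∈ A` acts on `M` on the left as `a ⊗ 1`, and `b ∈ B` acts on `M` on
the right as `1 ⊗ bᵒᵖ`. -/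
instance : Mul (TriangularAlgebra K A B M) where
  mul s t := mk (s.topLeft * t.topLeft)
    ((s.topLeft ⊗ₜ[K] (1 : Bᵐᵒᵖ)) • t.topRight
      + ((1 : A) ⊗ₜ[K] MulOpposite.op t.botRight) • s.topRight)
    (s.botRight * t.botRight)

instance : One (TriangularAlgebra K A B M) where
  one := mk 1 0 1

@[simp] theorem topLeft_zero : (0 : TriangularAlgebra K A B M).topLeft = 0 := rfl
@[simp] theorem topRight_zero : (0 : TriangularAlgebra K A B M).topRight = 0 := rfl
@[simp] theorem botRight_zero : (0 : TriangularAlgebra K A B M).botRight = 0 := rfl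
@[simp] theorem topLeft_one : (1 : TriangularAlgebra K A B M).topLeft = 1 := rfl
@[simp] theorem topRight_one : (1 : TriangularAlgebra K A B M).topRight = 0 := rfl
@[simp] theorem botRight_one : (1 : TriangularAlgebra K A B M).botRight = 1 := rfl

section

variable (s t : TriangularAlgebra K A B M) (c : K)

@[simp] theorem topLeft_add : (s + t).topLeft = s.topLeft + t.topLeft := rfl
@[simp] theorem topRight_add : (s + t).topRight = s.topRight + t.topRight := rfl
@[simp] theorem botRight_add : (s + t).botRight = s.botRight + t.botRight := rfl
@[simp] theorem topLeft_smul : (c • s).topLeft = c • s.topLeft := rfl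
@[simp] theorem topRight_smul : (c • s).topRight = c • s.topRight := rfl
@[simp] theorem botRight_smul : (c • s).botRight = c • s.botRight := rfl
@[simp] theorem topLeft_mul : (s * t).topLeft = s.topLeft * t.topLeft := rfl
@[simp] theorem topRight_mul : (s * t).topRight =
    (s.topLeft ⊗ₜ[K] (1 : Bᵐᵒᵖ)) • t.topRight
      + ((1 : A) ⊗ₜ[K] MulOpposite.op t.botRight) • s.topRight := rfl
@[simp] theorem botRight_mul : (s * t).botRight = s.botRight * t.botRight := rfl

end

instance : Ring (TriangularAlgebra K A B M) where
  left_distrib r s t := by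
    ext
    · simp [mul_add]
    · simp only [topRight_mul, topRight_add, botRight_add, MulOpposite.op_add, TensorProduct.tmul_add,
        smul_add, add_smul]
      abel
    · simp [mul_add]
  right_distrib r s t := by
    ext
    · simp [add_mul]
    · simp only [topRight_mul, topRight_add, topLeft_add, TensorProduct.add_tmul, smul_add, add_smul]
      abel
    · simp [add_mul]
  zero_mul t := by
    ext
    · simp
    · simp only [topRight_mul, topLeft_zero, topRight_zero, TensorProduct.zero_tmul, smul_zero,
        add_zero]
      exact zero_smul (A ⊗[K] Bᵐᵒᵖ) t.topRight
    · simp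
  mul_zero t := by
    ext
    · simp
    · simp only [topRight_mul, botRight_zero, topRight_zero, MulOpposite.op_zero,
        TensorProduct.tmul_zero, smul_zero, zero_add]
      exact zero_smul (A ⊗[K] Bᵐᵒᵖ) t.topRight
    · simp
  one_mul t := by ext <;> simp [← Algebra.TensorProduct.one_def]
  mul_one t := by ext <;> simp [← Algebra.TensorProduct.one_def]
  mul_assoc r s t := by
    ext
    · simp [mul_assoc]
    · simp [smul_smul, add_assoc]
    · simp [mul_assoc]
  neg_add_cancel t := neg_add_cancel t
  zsmul := (· • ·)
  zsmul_zero' := SubNegMonoid.zsmul_zero'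
  zsmul_succ' := SubNegMonoid.zsmul_succ'
  zsmul_neg' := SubNegMonoid.zsmul_neg'
  sub_eq_add_neg := sub_eq_add_neg

variable [IsScalarTower K (A ⊗[K] Bᵐᵒᵖ) M] [IsScalarTower K (A ⊗[K] Bᵐᵒᵖ) N]

instance : Algebra K (TriangularAlgebra K A B M) :=
  Algebra.ofModule
    (fun c s t => by
      have h : (c • s.topLeft) ⊗ₜ[K] (1 : Bᵐᵒᵖ) = c • (s.topLeft ⊗ₜ[K] (1 : Bᵐᵒᵖ)) := rfl
      ext
      · simp
      · simp only [topRight_mul, topRight_smul, topLeft_smul, smul_add]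
        rw [h, smul_assoc, smul_algebra_smul_comm]
      · simp)
    (fun c s t => by
      have h : (1 : A) ⊗ₜ[K] MulOpposite.op (c • t.botRight) =
          c • ((1 : A) ⊗ₜ[K] MulOpposite.op t.botRight) := by
        rw [MulOpposite.op_smul, TensorProduct.tmul_smul]
      ext
      · simp
      · simp only [topRight_mul, topRight_smul, botRight_smul, smul_add]
        rw [h, smul_assoc, smul_algebra_smul_comm]
      · simp)

/-- The map `(a, x, b) ↦ (a, φ(x), b)` of triangular algebras induced by a module map `φ`. -/
def mapRight (φ : M →ₗ[A ⊗[K] Bᵐᵒᵖ] N) :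
    TriangularAlgebra K A B M →ₗ[K] TriangularAlgebra K A B N where
  toFun t := mk t.topLeft (φ t.topRight) t.botRight
  map_add' s t := by ext <;> simp
  map_smul' c t := by
    ext
    · simp
    · simp only [topRight_mk, topRight_smul, RingHom.id_apply]
      exact (φ.restrictScalars K).map_smul c t.topRight
    · simp

@[simp] theorem topLeft_mapRight (φ : M →ₗ[A ⊗[K] Bᵐᵒᵖ] N) (t : TriangularAlgebra K A B M) :
    (mapRight φ t).topLeft = t.topLeft := rfl

@[simp] theorem topRight_mapRight (φ : M →ₗ[A ⊗[K] Bᵐᵒᵖ] N) (t : TriangularAlgebra K A B M) :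
    (mapRight φ t).topRight = φ t.topRight := rfl

@[simp] theorem botRight_mapRight (φ : M →ₗ[A ⊗[K] Bᵐᵒᵖ] N) (t : TriangularAlgebra K A B M) :
    (mapRight φ t).botRight = t.botRight := rfl

theorem mapRight_mul (φ : M →ₗ[A ⊗[K] Bᵐᵒᵖ] N) (s t : TriangularAlgebra K A B M) :
    mapRight φ (s * t) = mapRight φ s * mapRight φ t := by
  ext <;> simp

/-- For a direct summand `N` of `M`, with inclusion `ι` and projection `π`, the cochain map sending
a cochain `f` of the triangular algebra of `M` to the cochain `π ∘ f ∘ (ι, …, ι)` of the triangular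
algebra of `N`. -/
def cochainRestrict (ι : N →ₗ[A ⊗[K] Bᵐᵒᵖ] M) (π : M →ₗ[A ⊗[K] Bᵐᵒᵖ] N)
    (h : π ∘ₗ ι = LinearMap.id) :
    hochschildComplex K (TriangularAlgebra K A B M) ⟶
      hochschildComplex K (TriangularAlgebra K A B N) :=
  CochainComplex.ofHom
    (fun n => ModuleCat.ofHom
      { toFun := fun f : HochschildCochain K (TriangularAlgebra K A B M) n =>
          (mapRight π).compMultilinearMap (f.compLinearMap fun _ => mapRight ι)
        map_add' := fun f g => by ext <;> simp
        map_smul' := fun c f => by ext t <;> simp })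
    (fun n => by
      have hπ : ∀ x, π (ι x) = x := fun x => LinearMap.congr_fun h x
      have hc : ∀ t : TriangularAlgebra K A B N, mapRight π (mapRight ι t) = t := fun t => by
        ext <;> simp [hπ]
      rw [hochschildComplex_d, hochschildComplex_d]
      ext f
      change HochschildCochain K (TriangularAlgebra K A B M) n at f
      refine MultilinearMap.ext fun t => ?_
      change hochschildFormula (fun s => mapRight π (f fun k => mapRight ι (s k))) t =
        mapRight π (hochschildFormula f fun k => mapRight ι (t k))
      simp only [hochschildFormula, map_add, map_sum, map_zsmul, mapRight_mul, hc]
      congr 2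
      refine Finset.sum_congr rfl fun j _ => ?_
      congr 3
      exact Fin.comp_contractNth _ _ (mapRight_mul ι) _ _)

end TriangularAlgebra
end Triangular

section Ext

variable (K : Type w) [CommRing K] (R : Type u) [Ring R] [Algebra K R]

/-- `Extⁿ_R(X, Y)` as a `K`-module, for modules `X` and `Y` over a `K`-algebra `R`. -/
def extModule (X Y : Type u) [AddCommGroup X] [Module R X] [AddCommGroup Y] [Module R Y] (n : ℕ) :
    ModuleCat.{u} K :=
  letI : Linear K (ModuleCat.{u} R) := ModuleCat.Algebra.instLinear
  ((Ext K (ModuleCat.{u} R) n).obj (Opposite.op (ModuleCat.of R X))).obj (ModuleCat.of R Y)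

/-- `Extⁿ⁻¹_R(X, Y)`, which is zero for `n = 0`. -/
def extModulePred (X Y : Type u) [AddCommGroup X] [Module R X] [AddCommGroup Y] [Module R Y] :
    ℕ → ModuleCat.{u} K
  | 0 => ModuleCat.of K PUnit
  | n + 1 => extModule K R X Y n

/-- The series `∑ₙ tⁿ dim_K Extⁿ_R(X, Y)`. -/
def extSeries (X Y : Type u) [AddCommGroup X] [Module R X] [AddCommGroup Y] [Module R Y] :
    PowerSeries ℤ :=
  PowerSeries.mk fun n => (Module.finrank K (extModule K R X Y n) : ℤ)

end Ext

section Kronecker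

variable (K : Type w) [CommRing K] (A B M : Type u) [Ring A] [Algebra K A] [Ring B] [Algebra K B]
  [AddCommGroup M] [Module K M] [Module (A ⊗[K] Bᵐᵒᵖ) M] [IsScalarTower K (A ⊗[K] Bᵐᵒᵖ) M]

/-- The general Kronecker algebra of `M`: the triangular algebra of the bimodule `Mᵐ`. -/
abbrev KroneckerAlgebra (m : ℕ) : Type u := TriangularAlgebra K A B (Fin m → M)

/-- For `m ≥ 1`, the map from the cohomology of the Kronecker algebra of `Mᵐ` to the cohomology of
the triangular algebra of `M` that is induced by restricting cochains to, and projecting their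
values onto, the first summand of `Mᵐ`. -/
def kroneckerRestrict (m : ℕ) (hm : 1 ≤ m) (n : ℕ) :
    HochschildCohomology K (KroneckerAlgebra K A B M m) n →ₗ[K]
      HochschildCohomology K (TriangularAlgebra K A B M) n :=
  (HomologicalComplex.homologyMap
    (TriangularAlgebra.cochainRestrict
      (LinearMap.single (A ⊗[K] Bᵐᵒᵖ) (fun _ : Fin m => M) ⟨0, hm⟩)
      (LinearMap.proj ⟨0, hm⟩)
      (LinearMap.proj_comp_single_same _ _ _)) n).hom

end Kronecker

end

/-! Grade the triangular algebra T of M by weight: diagonal entries have weight 0, entries in M have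
weight 1. Up to homotopy only the weight-preserving cochains matter, namely those with diagonal
arguments and diagonal values, and those with exactly one argument in M and value in M. This holds
over every ground ring. Let σ = `diag`, τ = `off`, e = diag(1, 0), e' = diag(0, 1). Then Φ(t) =
[[σt, τt], [0, σt]] is a multiplicative map from T to the 2 × 2 matrices over T, and the row u = (e,
e') and the column v = (e, e')ᵗ satisfy t u = u Φ(t), v t = Φ(t) v and u v = 1. The usual homotopy ∑
± u f(Φt₁, …, Φtᵢ, v, tᵢ₊₁, …, tₙ) therefore joins f to u f(Φ, …, Φ) v. This cochain is the
weight-preserving part `project` of f (`coboundary_projectHomotopy`).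

Write R = A ⊗ Bᵒ. The cochains with exactly one argument in M and values in an R-module N form a
complex whose cohomology in degree n + 1 is Extⁿ(M, N) (`nonempty_extModule_equiv`). In each
positive degree these cochains are represented, as a functor of N, by a projective R-module
(`nonempty_weightOneRep`), and by Yoneda the coboundary becomes a differential between the
representing modules, with an augmentation to M. Exactness of this complex can be tested by mapping
it to coinduced modules Hom_K(R, J). There the cocycles are made into coboundaries by hand, by
absorbing a first argument from A, or a last argument from B, into the variable in R
(`exists_bimoduleD_eq`).

A cochain with exactly one argument in M is linear in that argument, so such cochains for Mᵐ with
values in Mᵐ are m × m matrices of such cochains for M (`sum_transport_eq`). A weight-preserving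
cochain of T lifts to the algebra of Mᵐ by putting its part with values in M at every diagonal place
(`powerLift`). It must be every place, because the coboundary of the diagonal part involves all
copies of M. The lift is a section of the restriction up to homotopy. What is left over consists of
the matrices whose entry at the chosen diagonal place is zero, that is, of m² - 1 copies of the
complex computing Ext. This gives the split exact sequence, and counting dimensions gives the series
and their reductions. -/

noncomputable section

/-! ### Multilinear cochains, handled recursively through the first argument -/

section Cochains

/-- Multilinear cochains of degree `n` on `T` with values in `X`. -/
abbrev Cochain (K : Type*) [CommRing K] (T : Type*) [AddCommGroup T] [Module K T] (X : Type*)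
    [AddCommGroup X] [Module K X] (n : ℕ) :=
  MultilinearMap K (fun _ : Fin n => T) X

namespace Cochain

section Linear

variable {K : Type*} [CommRing K] {T T' T'' : Type*} [AddCommGroup T] [Module K T]
  [AddCommGroup T'] [Module K T'] [AddCommGroup T''] [Module K T'']
  {X Y Z : Type*} [AddCommGroup X] [Module K X] [AddCommGroup Y] [Module K Y]
  [AddCommGroup Z] [Module K Z] {n m : ℕ}

/-- A cochain of degree `n + 1` as a linear map from its first argument to cochains of degree `n`. -/
def head : Cochain K T X (n + 1) ≃ₗ[K] (T →ₗ[K] Cochain K T X n) :=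
  multilinearCurryLeftEquiv K (fun _ : Fin (n + 1) => T) X

/-- Cochains of degree zero are elements. -/
def point : X ≃ₗ[K] Cochain K T X 0 :=
  MultilinearMap.constLinearEquivOfIsEmpty (R := K) (S := K) (M₁ := fun _ : Fin 0 => T) (M₂ := X)

theorem head_apply (f : Cochain K T X (n + 1)) (t : T) (v : Fin n → T) :
    head f t v = f (Fin.cons t v) := rfl

theorem apply_eq_head (f : Cochain K T X (n + 1)) (v : Fin (n + 1) → T) :
    f v = head f (v 0) (Fin.tail v) := by
  rw [head_apply, Fin.cons_self_tail]

@[simp] theorem point_apply (x : X) (v : Fin 0 → T) : point (K := K) (T := T) x v = x := rfl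

theorem point_symm_apply (f : Cochain K T X 0) : point.symm f = f 0 := rfl

theorem ext_head {f g : Cochain K T X (n + 1)} (h : ∀ t, head f t = head g t) : f = g :=
  head.injective (LinearMap.ext h)

theorem ext_point {f g : Cochain K T X 0} (h : point.symm f = point.symm g) : f = g :=
  point.symm.injective h

/-- Apply a map `φ` to the first argument, and an operator `Ψ` to the remaining ones. -/
def headMap (φ : T →ₗ[K] T') (Ψ : Cochain K T' X n →ₗ[K] Cochain K T Y m) :
    Cochain K T' X (n + 1) →ₗ[K] Cochain K T Y (m + 1) :=
  head.symm.toLinearMap ∘ₗ LinearMap.compRight K Ψ ∘ₗ LinearMap.lcomp K _ φ ∘ₗ head.toLinearMap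

@[simp] theorem head_headMap (φ : T →ₗ[K] T') (Ψ : Cochain K T' X n →ₗ[K] Cochain K T Y m)
    (f : Cochain K T' X (n + 1)) (t : T) :
    head (headMap φ Ψ f) t = Ψ (head f (φ t)) := by
  simp [headMap]

/-- Substitute `u` for the first argument. -/
def insertHead (u : T) : Cochain K T X (n + 1) →ₗ[K] Cochain K T X n :=
  LinearMap.applyₗ u ∘ₗ head.toLinearMap

@[simp] theorem insertHead_apply (u : T) (f : Cochain K T X (n + 1)) :
    insertHead u f = head f u := rfl

/-- Apply a linear map to all arguments. -/
def pre (φ : T →ₗ[K] T') : Cochain K T' X n →ₗ[K] Cochain K T X n :=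
  MultilinearMap.compLinearMapₗ fun _ => φ

/-- Apply a linear map to the value. -/
def post (ψ : X →ₗ[K] Y) : Cochain K T X n →ₗ[K] Cochain K T Y n where
  toFun f := ψ.compMultilinearMap f
  map_add' f g := by ext; simp
  map_smul' c f := by ext; simp

@[simp] theorem pre_apply (φ : T →ₗ[K] T') (f : Cochain K T' X n) (v : Fin n → T) :
    pre φ f v = f fun k => φ (v k) := rfl

@[simp] theorem post_apply (ψ : X →ₗ[K] Y) (f : Cochain K T X n) (v : Fin n → T) :
    post ψ f v = ψ (f v) := rfl

theorem head_pre (φ : T →ₗ[K] T') (f : Cochain K T' X (n + 1)) (t : T) :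
    head (pre φ f) t = pre φ (head f (φ t)) := by
  ext v
  simp only [head_apply, pre_apply]
  congr 1
  funext k
  refine Fin.cases ?_ (fun i => ?_) k <;> simp

theorem head_post (ψ : X →ₗ[K] Y) (f : Cochain K T X (n + 1)) (t : T) :
    head (post ψ f) t = post ψ (head f t) := rfl

theorem point_symm_pre (φ : T →ₗ[K] T') (f : Cochain K T' X 0) :
    point.symm (pre φ f) = point.symm f := by
  simp only [point_symm_apply, pre_apply]; congr 1; exact Subsingleton.elim _ _

theorem point_symm_post (ψ : X →ₗ[K] Y) (f : Cochain K T X 0) :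
    point.symm (post ψ f) = ψ (point.symm f) := rfl

theorem post_post (ψ : X →ₗ[K] Y) (ψ' : Y →ₗ[K] Z) (f : Cochain K T X n) :
    post ψ' (post ψ f) = post (ψ' ∘ₗ ψ) f := rfl

theorem pre_pre (φ : T →ₗ[K] T') (φ' : T' →ₗ[K] T'') (f : Cochain K T'' X n) :
    pre φ (pre φ' f) = pre (φ' ∘ₗ φ) f := rfl

theorem pre_post (φ : T →ₗ[K] T') (ψ : X →ₗ[K] Y) (f : Cochain K T' X n) :
    pre φ (post ψ f) = post ψ (pre φ f) := rfl

theorem post_add_left (ψ ψ' : X →ₗ[K] Y) (f : Cochain K T X n) :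
    post (ψ + ψ') f = post ψ f + post ψ' f := rfl

@[simp] theorem post_zero_left (f : Cochain K T X n) : post (0 : X →ₗ[K] Y) f = 0 := rfl

@[simp] theorem post_id (f : Cochain K T X n) : post LinearMap.id f = f := rfl

variable (σ τ : T →ₗ[K] T) (e e' : T)

/-- The part of a cochain where exactly one argument is projected by `τ` and the others are
projected by `σ`. -/
def single : ∀ n, Cochain K T X n →ₗ[K] Cochain K T X n
  | 0 => 0
  | n + 1 => headMap τ (pre σ) + headMap σ (single n)

/-- The operator `f ↦ ∑ᵢ ± f(σt₁, …, σtᵢ, e', tᵢ₊₁, …, tₙ)`. -/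
def insertOne : ∀ n, Cochain K T X (n + 1) →ₗ[K] Cochain K T X n
  | 0 => insertHead e'
  | n + 1 => insertHead e' - headMap σ (insertOne n)

/-- The operator of degree `-1` that inserts `e` among the arguments, with `σ` applied to all the
arguments in front, or inserts `e'`, with `τ` applied to one of the arguments in front and `σ` to
the others. -/
def insertTwo : ∀ n, Cochain K T X (n + 1) →ₗ[K] Cochain K T X n
  | 0 => insertHead e
  | n + 1 => insertHead e - headMap σ (insertTwo n) - headMap τ (insertOne σ e' n)

@[simp] theorem single_zero (f : Cochain K T X 0) : single σ τ 0 f = 0 := rfl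

theorem head_single (f : Cochain K T X (n + 1)) (t : T) :
    head (single σ τ (n + 1) f) t = pre σ (head f (τ t)) + single σ τ n (head f (σ t)) := by
  simp [single]

theorem insertOne_zero (f : Cochain K T X 1) : insertOne σ e' 0 f = head f e' := rfl

theorem head_insertOne (f : Cochain K T X (n + 2)) (t : T) :
    head (insertOne σ e' (n + 1) f) t = head (head f e') t - insertOne σ e' n (head f (σ t)) := by
  simp [insertOne]

theorem insertTwo_zero (f : Cochain K T X 1) : insertTwo σ τ e e' 0 f = head f e := rfl

theorem head_insertTwo (f : Cochain K T X (n + 2)) (t : T) :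
    head (insertTwo σ τ e e' (n + 1) f) t =
      head (head f e) t - insertTwo σ τ e e' n (head f (σ t)) - insertOne σ e' n (head f (τ t)) := by
  simp [insertTwo]

theorem single_post (ψ : X →ₗ[K] Y) (f : Cochain K T X n) :
    single σ τ n (post ψ f) = post ψ (single σ τ n f) := by
  induction n with
  | zero => simp
  | succ n ih =>
    refine ext_head fun t => ?_
    rw [head_single, head_post, head_post, head_post, head_single, ih, map_add, pre_post]

theorem insertOne_post (ψ : X →ₗ[K] Y) (f : Cochain K T X (n + 1)) :
    insertOne σ e' n (post ψ f) = post ψ (insertOne σ e' n f) := by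
  induction n with
  | zero => rfl
  | succ n ih =>
    refine ext_head fun t => ?_
    rw [head_insertOne, head_post, head_post, head_post, head_post, head_insertOne, ih, map_sub]

theorem insertTwo_post (ψ : X →ₗ[K] Y) (f : Cochain K T X (n + 1)) :
    insertTwo σ τ e e' n (post ψ f) = post ψ (insertTwo σ τ e e' n f) := by
  induction n with
  | zero => rfl
  | succ n ih =>
    refine ext_head fun t => ?_
    rw [head_insertTwo, head_post, head_post, head_post, head_post, head_post, head_insertTwo, ih,
      insertOne_post, map_sub, map_sub]

theorem single_pre {σ' τ' : T' →ₗ[K] T'} (φ : T →ₗ[K] T') (hσ : φ ∘ₗ σ = σ' ∘ₗ φ)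
    (hτ : φ ∘ₗ τ = τ' ∘ₗ φ) (f : Cochain K T' X n) :
    single σ τ n (pre φ f) = pre φ (single σ' τ' n f) := by
  induction n with
  | zero => simp
  | succ n ih =>
    refine ext_head fun t => ?_
    have hσt : φ (σ t) = σ' (φ t) := LinearMap.congr_fun hσ t
    have hτt : φ (τ t) = τ' (φ t) := LinearMap.congr_fun hτ t
    rw [head_single, head_pre, head_pre, head_pre, head_single, ih, map_add, pre_pre, pre_pre, hσ,
      hσt, hτt]

variable {σ τ}

/-- The maps σ and τ are orthogonal idempotents, so of the terms of the double expansion only those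
survive that choose the same place for τ twice. -/
theorem single_single (hσσ : σ ∘ₗ σ = σ) (hστ : σ ∘ₗ τ = 0) (hτσ : τ ∘ₗ σ = 0) (hττ : τ ∘ₗ τ = τ)
    (f : Cochain K T X n) : single σ τ n (single σ τ n f) = single σ τ n f := by
  induction n with
  | zero => simp
  | succ n ih =>
    refine ext_head fun t => ?_
    have h1 : σ (σ t) = σ t := LinearMap.congr_fun hσσ t
    have h2 : σ (τ t) = 0 := LinearMap.congr_fun hστ t
    have h3 : τ (σ t) = 0 := LinearMap.congr_fun hτσ t
    have h4 : τ (τ t) = τ t := LinearMap.congr_fun hττ t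
    rw [head_single, head_single, head_single, h1, h2, h3, h4]
    simp [pre_pre, hσσ, ih, head_single]

end Linear

/-! ### The Hochschild coboundary and the insertion homotopies -/

section Algebra

variable {K : Type*} [CommRing K] {T T' : Type*} [Ring T] [Algebra K T] [Ring T'] [Algebra K T']
  {X Y : Type*} [AddCommGroup X] [Module K X] [AddCommGroup Y] [Module K Y] {n : ℕ}

/-- Multiply the first argument by `a` on the left. -/
def mulHead (a : T) : Cochain K T X (n + 1) →ₗ[K] Cochain K T X (n + 1) :=
  headMap (LinearMap.mulLeft K a) LinearMap.id

@[simp] theorem head_mulHead (a b : T) (f : Cochain K T X (n + 1)) :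
    head (mulHead a f) b = head f (a * b) := by
  simp [mulHead]

/-- Multiply the first two arguments. -/
def contractHead : Cochain K T X (n + 1) →ₗ[K] Cochain K T X (n + 2) where
  toFun f := head.symm
    { toFun := fun a => mulHead a f
      map_add' := fun a b => ext_head fun t => by simp [add_mul]
      map_smul' := fun c a => ext_head fun t => by simp }
  map_add' f g := ext_head fun a => by simp
  map_smul' c f := ext_head fun a => by simp

@[simp] theorem head_contractHead (a : T) (f : Cochain K T X (n + 1)) :
    head (contractHead f) a = mulHead a f := by
  simp [contractHead]

/-- The part of the Hochschild coboundary that does not involve the left action, up to sign, for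
coefficients with right action `ρ`. -/
def rightD (ρ : X →ₗ[K] T →ₗ[K] X) : ∀ n, Cochain K T X n →ₗ[K] Cochain K T X (n + 1)
  | 0 => head.symm.toLinearMap ∘ₗ LinearMap.compRight K point.toLinearMap ∘ₗ ρ ∘ₗ
      point.symm.toLinearMap
  | n + 1 => contractHead - headMap LinearMap.id (rightD ρ n)

theorem head_rightD_zero (ρ : X →ₗ[K] T →ₗ[K] X) (f : Cochain K T X 0) (t : T) :
    head (rightD ρ 0 f) t = point (ρ (point.symm f) t) := by
  simp [rightD]

theorem head_rightD (ρ : X →ₗ[K] T →ₗ[K] X) (f : Cochain K T X (n + 1)) (t : T) :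
    head (rightD ρ (n + 1) f) t = mulHead t f - rightD ρ n (head f t) := by
  simp [rightD]

/-- The left action on the value of a cochain. -/
def leftMul (l : T →ₗ[K] X →ₗ[K] X) : Cochain K T X n →ₗ[K] Cochain K T X (n + 1) where
  toFun f := head.symm
    { toFun := fun t => post (l t) f
      map_add' := fun a b => by ext; simp
      map_smul' := fun a b => by ext; simp }
  map_add' f g := ext_head fun a => by simp
  map_smul' c f := ext_head fun a => by simp

@[simp] theorem head_leftMul (l : T →ₗ[K] X →ₗ[K] X) (f : Cochain K T X n) (t : T) :
    head (leftMul l f) t = post (l t) f := by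
  simp [leftMul]

/-- The Hochschild coboundary for coefficients in `X`, with left action `l` and right action `ρ`. -/
def coboundary (l : T →ₗ[K] X →ₗ[K] X) (ρ : X →ₗ[K] T →ₗ[K] X) (n : ℕ) :
    Cochain K T X n →ₗ[K] Cochain K T X (n + 1) :=
  leftMul l - rightD ρ n

theorem head_coboundary (l : T →ₗ[K] X →ₗ[K] X) (ρ : X →ₗ[K] T →ₗ[K] X) (f : Cochain K T X n)
    (t : T) : head (coboundary l ρ n f) t = post (l t) f - head (rightD ρ n f) t := by
  simp [coboundary]

theorem rightD_post {ρ : X →ₗ[K] T →ₗ[K] X} {ρ' : Y →ₗ[K] T →ₗ[K] Y} (ψ : X →ₗ[K] Y)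
    (hψ : ∀ x t, ψ (ρ x t) = ρ' (ψ x) t) (f : Cochain K T X n) :
    rightD ρ' n (post ψ f) = post ψ (rightD ρ n f) := by
  induction n with
  | zero =>
    refine ext_head fun t => ?_
    rw [head_rightD_zero, head_post, head_rightD_zero, point_symm_post, ← hψ]
    rfl
  | succ n ih =>
    refine ext_head fun t => ?_
    rw [head_rightD, head_post, head_post, head_rightD, ih, map_sub]
    rfl

theorem mulHead_pre (φ : T →ₗ[K] T') (hφ : ∀ s t, φ (s * t) = φ s * φ t) (t : T)
    (f : Cochain K T' X (n + 1)) : mulHead t (pre φ f) = pre φ (mulHead (φ t) f) :=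
  ext_head fun s => by simp [head_pre, hφ]

theorem rightD_pre {ρ : X →ₗ[K] T →ₗ[K] X} {ρ' : X →ₗ[K] T' →ₗ[K] X} (φ : T →ₗ[K] T')
    (hφ : ∀ s t, φ (s * t) = φ s * φ t) (hρ : ∀ x t, ρ x t = ρ' x (φ t)) (f : Cochain K T' X n) :
    rightD ρ n (pre φ f) = pre φ (rightD ρ' n f) := by
  induction n with
  | zero =>
    refine ext_head fun t => ?_
    rw [head_rightD_zero, head_pre, head_rightD_zero, point_symm_pre, hρ]
    rfl
  | succ n ih =>
    refine ext_head fun t => ?_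
    rw [head_rightD, head_pre, head_pre, head_rightD, ih, map_sub, mulHead_pre φ hφ]

theorem coboundary_post {l : T →ₗ[K] X →ₗ[K] X} {ρ : X →ₗ[K] T →ₗ[K] X}
    {l' : T →ₗ[K] Y →ₗ[K] Y} {ρ' : Y →ₗ[K] T →ₗ[K] Y} (ψ : X →ₗ[K] Y)
    (hl : ∀ t x, ψ (l t x) = l' t (ψ x)) (hρ : ∀ x t, ψ (ρ x t) = ρ' (ψ x) t)
    (f : Cochain K T X n) :
    coboundary l' ρ' n (post ψ f) = post ψ (coboundary l ρ n f) := by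
  refine ext_head fun t => ?_
  rw [head_coboundary, head_post, head_coboundary, rightD_post ψ hρ, map_sub, head_post, post_post,
    post_post]
  have h : l' t ∘ₗ ψ = ψ ∘ₗ l t := LinearMap.ext fun x => (hl t x).symm
  rw [h]

theorem coboundary_pre {l : T →ₗ[K] X →ₗ[K] X} {ρ : X →ₗ[K] T →ₗ[K] X}
    {l' : T' →ₗ[K] X →ₗ[K] X} {ρ' : X →ₗ[K] T' →ₗ[K] X} (φ : T →ₗ[K] T')
    (hφ : ∀ s t, φ (s * t) = φ s * φ t) (hl : ∀ t x, l t x = l' (φ t) x)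
    (hρ : ∀ x t, ρ x t = ρ' x (φ t)) (f : Cochain K T' X n) :
    coboundary l ρ n (pre φ f) = pre φ (coboundary l' ρ' n f) := by
  refine ext_head fun t => ?_
  rw [head_coboundary, head_pre, head_coboundary, rightD_pre φ hφ hρ, map_sub, head_pre, pre_post]
  rw [LinearMap.ext (hl t)]

theorem mulHead_mulHead (a b : T) (f : Cochain K T X (n + 1)) :
    mulHead b (mulHead a f) = mulHead (a * b) f :=
  ext_head fun t => by simp [mul_assoc]

theorem rightD_mulHead (ρ : X →ₗ[K] T →ₗ[K] X) (a t : T) (f : Cochain K T X (n + 1)) :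
    head (rightD ρ (n + 1) (mulHead a f)) t = mulHead (a * t) f - rightD ρ n (head f (a * t)) := by
  rw [head_rightD, mulHead_mulHead, head_mulHead]

/-- After two arguments are split off, the terms with `mulHead` cancel by associativity and the same
expression for a cochain of lower degree remains. In degree zero it is associativity of the right
action. -/
theorem rightD_rightD (ρ : X →ₗ[K] T →ₗ[K] X) (hρ : ∀ x s t, ρ (ρ x s) t = ρ x (s * t))
    (f : Cochain K T X n) : rightD ρ (n + 1) (rightD ρ n f) = 0 := by
  induction n with
  | zero =>
    refine ext_head fun a => ext_head fun b => ext_point ?_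
    rw [head_rightD, map_sub, LinearMap.sub_apply, head_mulHead, head_rightD_zero,
      head_rightD_zero, head_rightD_zero]
    simp [hρ]
  | succ n ih =>
    refine ext_head fun a => ext_head fun b => ?_
    rw [head_rightD (n := n + 1), head_rightD, map_sub (rightD ρ (n + 1)), ih, sub_zero, map_sub,
      LinearMap.sub_apply, head_mulHead, rightD_mulHead, head_rightD]
    simp

theorem coboundary_coboundary (l : T →ₗ[K] X →ₗ[K] X) (ρ : X →ₗ[K] T →ₗ[K] X)
    (hl : ∀ s t x, l s (l t x) = l (s * t) x) (hρ : ∀ x s t, ρ (ρ x s) t = ρ x (s * t))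
    (hlρ : ∀ s x t, l s (ρ x t) = ρ (l s x) t) (f : Cochain K T X n) :
    coboundary l ρ (n + 1) (coboundary l ρ n f) = 0 := by
  refine ext_head fun a => ext_head fun b => ?_
  have h1 : post (l a) (post (l b) f) = post (l (a * b)) f := by
    rw [post_post, ← LinearMap.ext (f := l a ∘ₗ l b) (hl a b)]
  have h2 : head (rightD ρ (n + 1) (leftMul l f)) a =
      mulHead a (leftMul l f) - rightD ρ n (post (l a) f) := by
    rw [head_rightD, head_leftMul]
  have h3 : rightD ρ n (post (l a) f) = post (l a) (rightD ρ n f) := rightD_post _ (hlρ a) f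
  rw [head_coboundary, map_sub, LinearMap.sub_apply, head_post, head_coboundary, map_sub, h1]
  rw [coboundary, LinearMap.sub_apply, map_sub, rightD_rightD ρ hρ, sub_zero, h2, map_sub,
    LinearMap.sub_apply, head_mulHead, head_leftMul, h3, head_post]
  simp

variable {ρ : X →ₗ[K] T →ₗ[K] X} {σ τ : T →ₗ[K] T} {e e' : T}

/-- `insertOne` is a homotopy from `f ↦ f ∘ σ · e'` to zero, up to the left action. -/
theorem rightD_insertOne (hσ : ∀ s t, σ (s * t) = σ s * σ t) (he' : ∀ t, σ t * e' = e' * t)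
    (f : Cochain K T X (n + 1)) :
    rightD ρ n (insertOne σ e' n f) + insertOne σ e' (n + 1) (rightD ρ (n + 1) f) =
      post (ρ.flip e') (pre σ f) := by
  induction n with
  | zero =>
    refine ext_head fun t => ext_point ?_
    rw [map_add, LinearMap.add_apply, head_rightD_zero, head_insertOne, insertOne_zero,
      insertOne_zero, head_rightD, head_rightD, map_sub, map_sub, LinearMap.sub_apply,
      LinearMap.sub_apply, head_mulHead, head_mulHead, head_rightD_zero, head_rightD_zero, he',
      head_post, head_pre, point_symm_post]
    simp [point_symm_pre]
  | succ n ih =>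
    refine ext_head fun t => ?_
    have h := ih (head f (σ t))
    rw [map_add, LinearMap.add_apply, head_rightD, head_insertOne, head_insertOne, head_rightD,
      head_rightD, head_post, head_pre, ← h]
    simp only [map_sub, LinearMap.sub_apply, head_rightD, head_mulHead]
    -- This is what remains beyond the induction hypothesis at σt. One more argument has to be split
    -- off before multiplicativity of σ and the relation e't = σ(t)e' apply.
    have h2 : mulHead t (insertOne σ e' (n + 1) f) + head f (e' * t) - mulHead t (head f e')
        - insertOne σ e' (n + 1) (mulHead (σ t) f) = 0 := by
      refine ext_head fun s => ?_
      simp only [map_add, map_sub, LinearMap.add_apply, LinearMap.sub_apply, head_insertOne,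
        head_mulHead, hσ, he', map_zero, LinearMap.zero_apply]
      abel
    rw [← sub_eq_zero, ← h2]
    abel

/-- With Φ = [[σ, τ], [0, σ]] and v = (e, e')ᵗ, the hypotheses say that Φ is multiplicative and that
v t = Φ(t) v. `insertTwo` and `insertOne` are the two entries of the column ∑ ± f(Φt₁, …, Φtᵢ, v,
tᵢ₊₁, …), and `single` is the upper right entry of f(Φ, …, Φ). The sum telescopes to f(Φ, …, Φ) v,
whose upper entry stands on the right; the lower one is `rightD_insertOne`. -/
theorem rightD_insertTwo (hσ : ∀ s t, σ (s * t) = σ s * σ t)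
    (hτ : ∀ s t, τ (s * t) = σ s * τ t + τ s * σ t) (he' : ∀ t, σ t * e' = e' * t)
    (he : ∀ t, σ t * e + τ t * e' = e * t)
    (f : Cochain K T X (n + 1)) :
    rightD ρ n (insertTwo σ τ e e' n f) + insertTwo σ τ e e' (n + 1) (rightD ρ (n + 1) f) =
      post (ρ.flip e') (single σ τ (n + 1) f) + post (ρ.flip e) (pre σ f) := by
  induction n with
  | zero =>
    refine ext_head fun t => ext_point ?_
    rw [map_add, LinearMap.add_apply, head_rightD_zero, head_insertTwo, insertTwo_zero,
      insertTwo_zero, insertOne_zero, head_rightD, head_rightD, head_rightD, map_sub, map_sub,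
      map_sub, LinearMap.sub_apply, LinearMap.sub_apply, LinearMap.sub_apply, head_mulHead,
      head_mulHead, head_mulHead, head_rightD_zero, head_rightD_zero, head_rightD_zero, ← he,
      map_add (head f), map_add head, LinearMap.add_apply, head_post, head_post, head_pre,
      head_single]
    simp [point_symm_pre, point_symm_post]
    abel
  | succ n ih =>
    refine ext_head fun t => ?_
    have h := ih (head f (σ t))
    have h' := rightD_insertOne (ρ := ρ) hσ he' (head f (τ t))
    have h2 : mulHead t (insertTwo σ τ e e' (n + 1) f) + head f (e * t) - mulHead t (head f e)
        - insertTwo σ τ e e' (n + 1) (mulHead (σ t) f) - insertOne σ e' (n + 1) (mulHead (τ t) f)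
          = 0 := by
      refine ext_head fun s => ?_
      simp only [map_add, map_sub, LinearMap.add_apply, LinearMap.sub_apply, head_insertTwo,
        head_insertOne, head_mulHead, hσ, hτ, ← he, map_zero, LinearMap.zero_apply]
      abel
    rw [map_add, map_add, LinearMap.add_apply, LinearMap.add_apply, head_rightD, head_insertTwo,
      head_insertTwo, head_rightD, head_rightD, head_rightD, head_post, head_post, head_pre,
      head_single, map_add (post _)]
    simp only [map_sub, LinearMap.sub_apply, head_rightD, head_mulHead]
    have h3 : ∀ a b c d a' b' c' : Cochain K T X (n + 1), a + b = c + d → a' + b' = c' →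
        a + b + (a' + b') = c' + c + d := by
      intro a b c d a' b' c' h h'
      rw [h, h']; abel
    rw [← h3 _ _ _ _ _ _ _ h h', ← sub_eq_zero, ← h2]
    abel

theorem single_leftMul {l : T →ₗ[K] X →ₗ[K] X} (hσ : ∀ t, l (σ t) = l t) (hτ : ∀ t, l (τ t) = 0)
    (f : Cochain K T X n) : single σ τ (n + 1) (leftMul l f) = leftMul l (single σ τ n f) := by
  refine ext_head fun t => ?_
  rw [head_single, head_leftMul, head_leftMul, head_leftMul, hσ, hτ, single_post]
  simp

/-- `single` commutes with the coboundary when the coefficients are annihilated by the image of `τ`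
and `e'` acts as a right identity. -/
theorem single_coboundary {l : T →ₗ[K] X →ₗ[K] X} (hσ : ∀ s t, σ (s * t) = σ s * σ t)
    (hτ : ∀ s t, τ (s * t) = σ s * τ t + τ s * σ t) (he' : ∀ t, σ t * e' = e' * t)
    (he : ∀ t, σ t * e + τ t * e' = e * t) (hlσ : ∀ t, l (σ t) = l t) (hlτ : ∀ t, l (τ t) = 0)
    (hρ : ∀ x s t, ρ (ρ x s) t = ρ x (s * t)) (hρτ : ∀ x t, ρ x (τ t) = 0)
    (hρe' : ∀ x, ρ x e' = x) (hρe : ∀ x, ρ x e = 0) (f : Cochain K T X n) :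
    single σ τ (n + 1) (coboundary l ρ n f) = coboundary l ρ n (single σ τ n f) := by
  have key : single σ τ (n + 1) (rightD ρ n f) = rightD ρ n (single σ τ n f) := by
    cases n with
    | zero =>
      refine ext_head fun t => ?_
      rw [head_single, head_rightD_zero, hρτ]
      simp
    | succ n =>
      have h1 : ρ.flip e' = LinearMap.id := LinearMap.ext hρe'
      have h2 : ρ.flip e = 0 := LinearMap.ext hρe
      -- As e' acts as the identity and e as zero, `single` equals the anticommutator of `rightD`
      -- and `insertTwo`. Such an anticommutator commutes with `rightD`, which has square zero.
      have h := rightD_insertTwo (ρ := ρ) hσ hτ he' he f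
      have h' := rightD_insertTwo (ρ := ρ) hσ hτ he' he (rightD ρ _ f)
      rw [h1, h2, post_id, post_zero_left, add_zero] at h h'
      rw [← h, ← h', map_add, rightD_rightD ρ hρ, rightD_rightD ρ hρ, map_zero, add_zero, zero_add]
  rw [coboundary, LinearMap.sub_apply, map_sub, single_leftMul hlσ hlτ, key]
  rfl

/-- The formula for the Hochschild coboundary in terms of the recursive one. -/
theorem hochschildD_eq_coboundary (n : ℕ) :
    hochschildD K T n = coboundary (LinearMap.mul K T) (LinearMap.mul K T) n := by
  have key : ∀ (n : ℕ) (f : Cochain K T T n) (t : Fin (n + 1) → T),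
      rightD (LinearMap.mul K T) n f t =
        -(∑ j : Fin n, (-1 : ℤ) ^ (j.val + 1) • f (Fin.contractNth j.castSucc (· * ·) t)
          + (-1 : ℤ) ^ (n + 1) • (f (fun k => t k.castSucc) * t (Fin.last n))) := by
    intro n
    induction n with
    | zero =>
      intro f t
      rw [apply_eq_head, head_rightD_zero]
      simp only [point_apply, point_symm_apply, LinearMap.mul_apply']
      simp
      congr 2
      exact Subsingleton.elim _ _
    | succ n ih =>
      intro f t
      rw [apply_eq_head, head_rightD, Fin.sum_univ_succ]
      have h1 : mulHead (t 0) f (Fin.tail t) =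
          f (Fin.contractNth (Fin.castSucc 0) (· * ·) t) := by
        rw [apply_eq_head, head_mulHead, head_apply]
        congr 1
        funext k
        refine Fin.cases ?_ (fun i => ?_) k
        · simp [Fin.contractNth, Fin.tail]
        · simp [Fin.contractNth, Fin.tail]
      have h2 : ∀ j : Fin n, head f (t 0) (Fin.contractNth j.castSucc (· * ·) (Fin.tail t)) =
          f (Fin.contractNth j.succ.castSucc (· * ·) t) := by
        intro j
        rw [head_apply]
        congr 1
        funext k
        refine Fin.cases ?_ (fun i => ?_) k
        · simp [Fin.contractNth]
        · simp [Fin.contractNth, Fin.tail]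
      have h3 : head f (t 0) (fun k => Fin.tail t k.castSucc) = f (fun k => t k.castSucc) := by
        rw [head_apply]
        congr 1
        funext k
        refine Fin.cases ?_ (fun i => ?_) k
        · simp
        · simp [Fin.tail]
      have h4 : Fin.tail t (Fin.last n) = t (Fin.last (n + 1)) := by simp [Fin.tail]
      rw [sub_apply, ih, h1, h3, h4]
      simp only [h2, Fin.val_zero, Fin.val_succ, pow_succ _ (_ + 1)]
      simp
      abel
  refine LinearMap.ext fun f => MultilinearMap.ext fun t => ?_
  rw [coboundary, LinearMap.sub_apply, sub_apply, key]
  simp only [hochschildD_apply, hochschildFormula, sub_neg_eq_add, ← add_assoc]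
  rfl

end Algebra

end Cochain

end Cochains

end

/-! ### The homotopy onto the weight-preserving cochains -/

noncomputable section

namespace Cochain

section Projection

variable {K : Type*} [CommRing K] {T : Type*} [Ring T] [Algebra K T] {n : ℕ}

/-- The projection of the cochains of `T` with coefficients in `T` that keeps the components
`σ f(σt₁, …, σtₙ)` and `τ f(σt₁, …, τtᵢ, …, σtₙ)`. -/
def project (σ τ : T →ₗ[K] T) (n : ℕ) : Cochain K T T n →ₗ[K] Cochain K T T n :=
  post σ ∘ₗ pre σ + post τ ∘ₗ single σ τ n

theorem project_apply (σ τ : T →ₗ[K] T) (f : Cochain K T T n) :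
    project σ τ n f = post σ (pre σ f) + post τ (single σ τ n f) := rfl

/-- The homotopy between `project` and the identity. -/
def projectHomotopy (σ τ : T →ₗ[K] T) (e e' : T) (n : ℕ) :
    Cochain K T T (n + 1) →ₗ[K] Cochain K T T n :=
  post (LinearMap.mulLeft K e) ∘ₗ insertTwo σ τ e e' n +
    post (LinearMap.mulLeft K e') ∘ₗ insertOne σ e' n

/-- Data on an algebra `T` saying that it is triangular with respect to the idempotents `e`, `e'`:
`σ` is the projection onto the diagonal part and `τ` is the projection onto the part
above the diagonal. -/
structure IsTriangular (σ τ : T →ₗ[K] T) (e e' : T) : Prop where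
  diag_mul : ∀ s t, σ (s * t) = σ s * σ t
  off_mul : ∀ s t, τ (s * t) = σ s * τ t + τ s * σ t
  diag_mul_right : ∀ t, σ t * e' = e' * t
  mul_left : ∀ t, σ t * e + τ t * e' = e * t
  mul_left' : ∀ t, t * e = e * σ t
  mul_right : ∀ t, t * e' = e * τ t + e' * σ t
  diag_eq : ∀ t, σ t = e * t * e + e' * t * e'
  off_eq : ∀ t, τ t = e * t * e'
  add_eq_one : e + e' = 1
  idem : e * e = e
  idem' : e' * e' = e'

variable {σ τ : T →ₗ[K] T} {e e' : T}

theorem coboundary_projectHomotopy_zero (f : Cochain K T T 0) (hT : IsTriangular σ τ e e') :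
    projectHomotopy σ τ e e' 0
      (coboundary (LinearMap.mul K T) (LinearMap.mul K T) 0 f) = f - project σ τ 0 f := by
  refine ext_point ?_
  simp only [projectHomotopy, LinearMap.add_apply, LinearMap.comp_apply, insertTwo_zero,
    insertOne_zero, head_coboundary, head_rightD_zero, project_apply, single_zero, map_zero,
    add_zero, map_add, map_sub, point_symm_post, LinearEquiv.symm_apply_apply, point_symm_pre,
    LinearMap.mul_apply', LinearMap.mulLeft_apply, hT.diag_eq]
  generalize point.symm f = x
  rw [← mul_assoc, ← mul_assoc, ← mul_assoc, ← mul_assoc, hT.idem, hT.idem']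
  have : x = e * x + e' * x := by rw [← add_mul, hT.add_eq_one, one_mul]
  nth_rewrite 5 [this]
  abel

/-- The row u = (e, e') satisfies t u = u Φ(t), the column v satisfies v t = Φ(t) v, and u v = 1.
Hence the terms of ∑ ± u f(Φt₁, …, Φtᵢ, v, tᵢ₊₁, …) telescope under the coboundary, leaving u v f =
f at one end and u f(Φ, …, Φ) v = `project` f at the other. -/
theorem coboundary_projectHomotopy (f : Cochain K T T (n + 1)) (hT : IsTriangular σ τ e e') :
    coboundary (LinearMap.mul K T) (LinearMap.mul K T) n (projectHomotopy σ τ e e' n f) +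
      projectHomotopy σ τ e e' (n + 1)
        (coboundary (LinearMap.mul K T) (LinearMap.mul K T) (n + 1) f) =
      f - project σ τ (n + 1) f := by
  set μ := LinearMap.mul K T with hμ
  have hleft : ∀ (a : T) {k : ℕ} (g : Cochain K T T k),
      rightD μ k (post (LinearMap.mulLeft K a) g) = post (LinearMap.mulLeft K a) (rightD μ k g) :=
    fun a k g => rightD_post _ (fun x t => (mul_assoc a x t).symm) g
  have E1 := rightD_insertTwo (ρ := μ) hT.diag_mul hT.off_mul hT.diag_mul_right hT.mul_left f
  have E2 := rightD_insertOne (ρ := μ) hT.diag_mul hT.diag_mul_right f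
  have L2 : ∀ t, head (insertOne σ e' (n + 1) (leftMul μ f)) t =
      post (μ e') (head f t) - post (μ (σ t)) (insertOne σ e' n f) := by
    intro t
    rw [head_insertOne, head_leftMul, head_leftMul, insertOne_post, head_post]
  have L1 : ∀ t, head (insertTwo σ τ e e' (n + 1) (leftMul μ f)) t =
      post (μ e) (head f t) - post (μ (σ t)) (insertTwo σ τ e e' n f)
        - post (μ (τ t)) (insertOne σ e' n f) := by
    intro t
    rw [head_insertTwo, head_leftMul, head_leftMul, head_leftMul, insertOne_post, insertTwo_post,
      head_post]
  -- The left actions cancel by t u = u Φ(t), except in the term where v is inserted in front, and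
  -- there u v = 1.
  have key : leftMul μ (projectHomotopy σ τ e e' n f) +
      projectHomotopy σ τ e e' (n + 1) (leftMul μ f) = f := by
    refine ext_head fun t => ?_
    simp only [projectHomotopy, LinearMap.add_apply, LinearMap.comp_apply, map_add, head_leftMul,
      head_post, L1, L2, map_sub]
    ext v
    simp only [add_apply, sub_apply, post_apply, LinearMap.mulLeft_apply, hμ, LinearMap.mul_apply',
      ← mul_assoc, hT.idem, hT.idem', hT.mul_left', hT.mul_right, add_mul]
    generalize head f t v = x
    have : x = e * x + e' * x := by rw [← add_mul, hT.add_eq_one, one_mul]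
    nth_rewrite 3 [this]
    abel
  -- The other end of the telescope: u f(Φ, …, Φ) v expands to e f(σ)e + e' f(σ)e' + e (`single` f)
  -- e'.
  have key2 : rightD μ n (projectHomotopy σ τ e e' n f) +
      projectHomotopy σ τ e e' (n + 1) (rightD μ (n + 1) f) = project σ τ (n + 1) f := by
    simp only [projectHomotopy, LinearMap.add_apply, LinearMap.comp_apply, map_add, hleft]
    rw [add_add_add_comm, ← map_add, ← map_add, E1, E2, project_apply]
    ext v
    simp only [add_apply, post_apply, map_add, LinearMap.mulLeft_apply, hμ, LinearMap.flip_apply,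
      LinearMap.mul_apply', hT.off_eq, hT.diag_eq, ← mul_assoc]
    abel
  rw [coboundary, coboundary, LinearMap.sub_apply, LinearMap.sub_apply, map_sub,
    sub_add_sub_comm, key, key2]

/-- The projection is the identity minus dh + hd, and this commutes with d because d² = 0. In degree
zero the term dh is absent. -/
theorem project_coboundary (f : Cochain K T T n) (hT : IsTriangular σ τ e e') :
    project σ τ (n + 1) (coboundary (LinearMap.mul K T) (LinearMap.mul K T) n f) =
      coboundary (LinearMap.mul K T) (LinearMap.mul K T) n (project σ τ n f) := by
  have hdd : ∀ {k : ℕ} (g : Cochain K T T k), coboundary (LinearMap.mul K T) (LinearMap.mul K T)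
      (k + 1) (coboundary (LinearMap.mul K T) (LinearMap.mul K T) k g) = 0 := fun g =>
    coboundary_coboundary _ _ (fun s t x => (mul_assoc s t x).symm) (fun x s t => mul_assoc x s t)
      (fun s x t => (mul_assoc s x t).symm) g
  have h := coboundary_projectHomotopy (coboundary (LinearMap.mul K T) (LinearMap.mul K T) n f) hT
  rw [hdd, map_zero, add_zero, eq_sub_iff_add_eq, ← eq_sub_iff_add_eq'] at h
  rw [h]
  cases n with
  | zero =>
    rw [coboundary_projectHomotopy_zero f hT, map_sub]
    abel
  | succ n =>
    have h' := congrArg (coboundary (LinearMap.mul K T) (LinearMap.mul K T) (n + 1))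
      (coboundary_projectHomotopy f hT)
    rw [map_add, hdd, zero_add, map_sub] at h'
    rw [h']
    abel

end Projection

-- Cochains with exactly one argument in the bimodule

end Cochain

namespace TriangularAlgebra

open Cochain

variable {K : Type w} {A B M N : Type u} [CommRing K] [Ring A] [Algebra K A] [Ring B] [Algebra K B]
  [AddCommGroup M] [Module K M] [Module (A ⊗[K] Bᵐᵒᵖ) M] [IsScalarTower K (A ⊗[K] Bᵐᵒᵖ) M]
  [AddCommGroup N] [Module K N] [Module (A ⊗[K] Bᵐᵒᵖ) N] [IsScalarTower K (A ⊗[K] Bᵐᵒᵖ) N]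

/-- The upper left entry as a linear map. -/
def topLeftₗ : TriangularAlgebra K A B M →ₗ[K] A where
  toFun := topLeft
  map_add' _ _ := rfl
  map_smul' _ _ := rfl

/-- The upper right entry as a linear map. -/
def topRightₗ : TriangularAlgebra K A B M →ₗ[K] M where
  toFun := topRight
  map_add' _ _ := rfl
  map_smul' _ _ := rfl

/-- The lower right entry as a linear map. -/
def botRightₗ : TriangularAlgebra K A B M →ₗ[K] B where
  toFun := botRight
  map_add' _ _ := rfl
  map_smul' _ _ := rfl

/-- The inclusion of the upper left corner. -/
def inTopLeft : A →ₗ[K] TriangularAlgebra K A B M where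
  toFun a := mk a 0 0
  map_add' _ _ := by ext <;> simp
  map_smul' _ _ := by ext <;> simp

/-- The inclusion of the upper right corner. -/
def inTopRight : M →ₗ[K] TriangularAlgebra K A B M where
  toFun x := mk 0 x 0
  map_add' _ _ := by ext <;> simp
  map_smul' _ _ := by ext <;> simp

/-- The inclusion of the lower right corner. -/
def inBotRight : B →ₗ[K] TriangularAlgebra K A B M where
  toFun b := mk 0 0 b
  map_add' _ _ := by ext <;> simp
  map_smul' _ _ := by ext <;> simp

/-- The projection onto the diagonal. -/
def diag : TriangularAlgebra K A B M →ₗ[K] TriangularAlgebra K A B M where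
  toFun t := mk t.topLeft 0 t.botRight
  map_add' _ _ := by ext <;> simp
  map_smul' _ _ := by ext <;> simp

/-- The projection onto the part above the diagonal. -/
def off : TriangularAlgebra K A B M →ₗ[K] TriangularAlgebra K A B M := inTopRight ∘ₗ topRightₗ

variable (t : TriangularAlgebra K A B M) (a : A) (x : M) (b : B)

@[simp] theorem topLeftₗ_apply : topLeftₗ t = t.topLeft := rfl
@[simp] theorem topRightₗ_apply : topRightₗ t = t.topRight := rfl
@[simp] theorem botRightₗ_apply : botRightₗ t = t.botRight := rfl
@[simp] theorem inTopLeft_apply :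
    (inTopLeft a : TriangularAlgebra K A B M) = mk a 0 0 := rfl
@[simp] theorem inTopRight_apply :
    (inTopRight x : TriangularAlgebra K A B M) = mk 0 x 0 := rfl
@[simp] theorem inBotRight_apply :
    (inBotRight b : TriangularAlgebra K A B M) = mk 0 0 b := rfl
@[simp] theorem diag_apply : diag t = mk t.topLeft 0 t.botRight := rfl
@[simp] theorem off_apply : off t = mk 0 t.topRight 0 := rfl

@[simp] theorem zero_smul_bimodule : (0 : A ⊗[K] Bᵐᵒᵖ) • x = 0 :=
  zero_smul (A ⊗[K] Bᵐᵒᵖ) x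

@[simp] theorem one_tmul_one_smul : ((1 : A) ⊗ₜ[K] (1 : Bᵐᵒᵖ)) • x = x := by
  rw [← Algebra.TensorProduct.one_def, one_smul]

theorem isTriangular : IsTriangular (K := K) (T := TriangularAlgebra K A B M) diag off
    (mk 1 0 0) (mk 0 0 1) where
  diag_mul s t := by ext <;> simp
  off_mul s t := by ext <;> simp
  diag_mul_right t := by ext <;> simp
  mul_left t := by ext <;> simp
  mul_left' t := by ext <;> simp
  mul_right t := by ext <;> simp
  diag_eq t := by ext <;> simp
  off_eq t := by ext <;> simp
  add_eq_one := by ext <;> simp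
  idem := by ext <;> simp
  idem' := by ext <;> simp

theorem diag_comp_diag : (diag : TriangularAlgebra K A B M →ₗ[K] _) ∘ₗ diag = diag := rfl

theorem diag_comp_off : (diag : TriangularAlgebra K A B M →ₗ[K] _) ∘ₗ off = 0 := rfl

theorem off_comp_diag : (off : TriangularAlgebra K A B M →ₗ[K] _) ∘ₗ diag = 0 := rfl

theorem off_comp_off : (off : TriangularAlgebra K A B M →ₗ[K] _) ∘ₗ off = off := rfl

theorem diag_add_off : diag t + off t = t := by ext <;> simp

variable (A B M N) in
/-- The left action of the triangular algebra on a bimodule, through the upper left entry. -/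
def leftAct : TriangularAlgebra K A B M →ₗ[K] N →ₗ[K] N :=
  (Algebra.lsmul K K N).toLinearMap ∘ₗ
    (Algebra.TensorProduct.includeLeft : A →ₐ[K] A ⊗[K] Bᵐᵒᵖ).toLinearMap ∘ₗ topLeftₗ

variable (A B M N) in
/-- The right action of the triangular algebra on a bimodule, through the lower right entry. -/
def rightAct : N →ₗ[K] TriangularAlgebra K A B M →ₗ[K] N :=
  ((Algebra.lsmul K K N).toLinearMap ∘ₗ
    (Algebra.TensorProduct.includeRight : Bᵐᵒᵖ →ₐ[K] A ⊗[K] Bᵐᵒᵖ).toLinearMap ∘ₗ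
      (MulOpposite.opLinearEquiv K).toLinearMap ∘ₗ botRightₗ).flip

@[simp] theorem leftAct_apply (y : N) :
    leftAct A B M N t y = (t.topLeft ⊗ₜ[K] (1 : Bᵐᵒᵖ)) • y := rfl

@[simp] theorem rightAct_apply (y : N) :
    rightAct A B M N y t = ((1 : A) ⊗ₜ[K] MulOpposite.op t.botRight) • y := rfl

variable (K A B M N) in
/-- The Hochschild coboundary of the triangular algebra with coefficients in a bimodule. -/
abbrev bimoduleD (n : ℕ) : Cochain K (TriangularAlgebra K A B M) N n →ₗ[K]
    Cochain K (TriangularAlgebra K A B M) N (n + 1) :=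
  coboundary (leftAct A B M N) (rightAct A B M N) n

theorem bimoduleD_bimoduleD {n : ℕ} (f : Cochain K (TriangularAlgebra K A B M) N n) :
    bimoduleD K A B M N (n + 1) (bimoduleD K A B M N n f) = 0 :=
  coboundary_coboundary _ _ (fun s t x => by simp [smul_smul]) (fun s t x => by simp [smul_smul])
    (fun s t x => by simp [smul_smul]) f

/-- T acts on N as on its upper right corner: M acts by zero on both sides, and on the right e acts
as zero and e' as the identity. These are the conditions under which `single` is a chain map. -/
theorem single_bimoduleD {n : ℕ} (f : Cochain K (TriangularAlgebra K A B M) N n) :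
    single diag off (n + 1) (bimoduleD K A B M N n f) =
      bimoduleD K A B M N n (single diag off n f) :=
  single_coboundary isTriangular.diag_mul isTriangular.off_mul isTriangular.diag_mul_right
    isTriangular.mul_left (fun _ => rfl) (fun t => by ext; simp) (fun s t x => by simp [smul_smul])
    (fun s t => by simp) (fun x => by simp) (fun x => by simp) f

/-- The Hochschild coboundary with coefficients in a bimodule is natural in the bimodule. -/
theorem bimoduleD_post {N' : Type u} [AddCommGroup N'] [Module K N'] [Module (A ⊗[K] Bᵐᵒᵖ) N']
    [IsScalarTower K (A ⊗[K] Bᵐᵒᵖ) N'] (φ : N →ₗ[A ⊗[K] Bᵐᵒᵖ] N') {n : ℕ}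
    (f : Cochain K (TriangularAlgebra K A B M) N n) :
    bimoduleD K A B M N' n (post (φ.restrictScalars K) f) =
      post (φ.restrictScalars K) (bimoduleD K A B M N n f) :=
  coboundary_post _ (fun t x => by simp) (fun t x => by simp) f

variable (K A B M N) in
/-- The cochains of the triangular algebra of `M` with exactly one argument in `M`. -/
def weightOne (n : ℕ) : Submodule K (Cochain K (TriangularAlgebra K A B M) N n) :=
  LinearMap.eqLocus (single diag off n) LinearMap.id

theorem mem_weightOne {n : ℕ} {f : Cochain K (TriangularAlgebra K A B M) N n} :
    f ∈ weightOne K A B M N n ↔ single diag off n f = f := Iff.rfl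

theorem single_mem_weightOne {n : ℕ} (f : Cochain K (TriangularAlgebra K A B M) N n) :
    single diag off n f ∈ weightOne K A B M N n :=
  single_single diag_comp_diag diag_comp_off off_comp_diag off_comp_off f

theorem bimoduleD_mem_weightOne {n : ℕ} {f : Cochain K (TriangularAlgebra K A B M) N n}
    (hf : f ∈ weightOne K A B M N n) : bimoduleD K A B M N n f ∈ weightOne K A B M N (n + 1) := by
  rw [mem_weightOne, single_bimoduleD, hf]
  rfl

theorem post_mem_weightOne {N' : Type*} [AddCommGroup N'] [Module K N'] {n : ℕ}
    (ψ : N →ₗ[K] N') {f : Cochain K (TriangularAlgebra K A B M) N n}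
    (hf : f ∈ weightOne K A B M N n) : single diag off n (post ψ f) = post ψ f := by
  rw [single_post, hf]
  rfl

/-- Without arguments none can lie in M. This is the source of the convention Ext⁻¹ = 0. -/
theorem eq_zero_of_mem_weightOne_zero {f : Cochain K (TriangularAlgebra K A B M) N 0}
    (hf : f ∈ weightOne K A B M N 0) : f = 0 := hf.symm

end TriangularAlgebra

end

/-! ### Projective modules representing these cochains -/

noncomputable section

namespace Cochain

variable {K : Type w} [CommRing K] {T : Type u} [AddCommGroup T] [Module K T]

/-- There is a universal multilinear map on `T ^ (n + 1)`, with values in a projective module if `T`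
is projective. -/
theorem exists_universal [Module.Projective K T] (n : ℕ) :
    ∃ (X : Type u) (_ : AddCommGroup X) (_ : Module K X) (υ : Cochain K T X (n + 1)),
      Module.Projective K X ∧ ∀ (J : Type u) [AddCommGroup J] [Module K J]
        (f : Cochain K T J (n + 1)), ∃! φ : X →ₗ[K] J, post φ υ = f := by
  induction n with
  -- The induction starts in degree one. In degree zero the representing module would be K, which
  -- lives in another universe, and there are no nonzero cochains with one argument in M anyway.
  | zero =>
    refine ⟨T, inferInstance, inferInstance, head.symm point.toLinearMap, inferInstance,
      fun J _ _ f => ⟨point.symm.toLinearMap ∘ₗ head f, ?_, ?_⟩⟩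
    · refine ext_head fun t => ?_
      rw [head_post, LinearEquiv.apply_symm_apply]
      exact ext_point (by simp [point_symm_post])
    · intro φ h
      ext t
      have := congrArg (fun g => point.symm (head g t)) h
      simpa [head_post, point_symm_post] using this
  | succ n ih =>
    obtain ⟨X, _, _, υ, _, h⟩ := ih
    have hu : ∀ {J : Type u} [AddCommGroup J] [Module K J] {φ ψ : X →ₗ[K] J},
        post φ υ = post ψ υ → φ = ψ := fun {J} _ _ φ ψ e => (h J _).unique e rfl
    refine ⟨T ⊗[K] X, inferInstance, inferInstance,
      head.symm
        { toFun := fun t => post (TensorProduct.mk K T X t) υ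
          map_add' := fun s t => by rw [map_add, post_add_left]
          map_smul' := fun c t => by rw [map_smul]; rfl },
      inferInstance, fun J _ _ f => ?_⟩
    choose φ hφ _ using fun t => h J (head f t)
    have hφ' : ∀ t, post (φ t) υ = head f t := hφ
    refine ⟨TensorProduct.lift
      { toFun := φ
        map_add' := fun s t => hu (by rw [post_add_left, hφ', hφ', hφ', map_add])
        map_smul' := fun c t => hu (by
          rw [hφ', map_smul, ← hφ']; rfl) }, ?_, ?_⟩
    · refine ext_head fun t => ?_
      rw [head_post, LinearEquiv.apply_symm_apply, ← hφ']
      rfl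
    · intro ψ hψ
      refine TensorProduct.ext (LinearMap.ext fun t => hu ?_)
      have := congrArg (fun g => head g t) hψ
      rw [head_post, LinearEquiv.apply_symm_apply, ← hφ'] at this
      exact this

theorem exists_baseChange_lift {R X : Type u} [Ring R] [Algebra K R] [AddCommGroup X] [Module K X]
    {N : Type u} [AddCommGroup N] [Module K N] [Module R N] [IsScalarTower K R N] (φ : X →ₗ[K] N) :
    ∃! ψ : R ⊗[K] X →ₗ[R] N, ∀ x, ψ (1 ⊗ₜ x) = φ x := by
  refine ⟨TensorProduct.AlgebraTensorModule.lift
    { toFun := fun r => (Algebra.lsmul K K N r) ∘ₗ φ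
      map_add' := fun r s => by ext; simp
      map_smul' := fun r s => by ext; simp }, fun x => by simp, fun ψ h => ?_⟩
  refine TensorProduct.AlgebraTensorModule.ext fun r x => ?_
  have : r ⊗ₜ[K] x = r • ((1 : R) ⊗ₜ[K] x) := by rw [TensorProduct.smul_tmul', smul_eq_mul, mul_one]
  rw [this, map_smul, h]
  simp

/-- There is a universal multilinear map on `T ^ (n + 1)` with values in modules over an algebra. -/
theorem exists_universal_module (R : Type u) [Ring R] [Algebra K R] [Module.Projective K T]
    (n : ℕ) :
    ∃ (F : Type u) (_ : AddCommGroup F) (_ : Module K F) (_ : Module R F) (_ : IsScalarTower K R F)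
      (υ : Cochain K T F (n + 1)),
      Module.Projective R F ∧ ∀ (N : Type u) [AddCommGroup N] [Module K N] [Module R N]
        [IsScalarTower K R N] (f : Cochain K T N (n + 1)),
        ∃! φ : F →ₗ[R] N, post (φ.restrictScalars K) υ = f := by
  obtain ⟨X, _, _, υ, _, hX⟩ := exists_universal (K := K) (T := T) n
  refine ⟨R ⊗[K] X, inferInstance, inferInstance, inferInstance, inferInstance,
    post (TensorProduct.mk K R X 1) υ, inferInstance, fun N _ _ _ _ f => ?_⟩
  obtain ⟨φ, hφ, hφu⟩ := hX N f
  obtain ⟨ψ, hψ, hψu⟩ := exists_baseChange_lift (R := R) φ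
  refine ⟨ψ, ?_, fun χ hχ => hψu χ fun x => ?_⟩
  · rw [← hφ]
    exact congrArg (fun χ => post χ υ)
      (LinearMap.ext (f := ψ.restrictScalars K ∘ₗ TensorProduct.mk K R X 1) (g := φ) hψ)
  · exact LinearMap.congr_fun (hφu (χ.restrictScalars K ∘ₗ TensorProduct.mk K R X 1) hχ) x

end Cochain

namespace TriangularAlgebra

open Cochain

variable (K : Type w) (A B M : Type u) [CommRing K] [Ring A] [Algebra K A] [Ring B] [Algebra K B]
  [AddCommGroup M] [Module K M] [Module (A ⊗[K] Bᵐᵒᵖ) M] [IsScalarTower K (A ⊗[K] Bᵐᵒᵖ) M]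

/-- A projective module that represents the functor of cochains of degree `n + 1` with exactly one
argument in `M`. -/
structure WeightOneRep (n : ℕ) where
  /-- The representing module. -/
  carrier : Type u
  [addCommGroup : AddCommGroup carrier]
  [moduleBase : Module K carrier]
  [module : Module (A ⊗[K] Bᵐᵒᵖ) carrier]
  [isScalarTower : IsScalarTower K (A ⊗[K] Bᵐᵒᵖ) carrier]
  projective : Module.Projective (A ⊗[K] Bᵐᵒᵖ) carrier
  /-- The universal cochain. -/
  universal : Cochain K (TriangularAlgebra K A B M) carrier (n + 1)
  universal_mem : universal ∈ weightOne K A B M carrier (n + 1)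
  existsUnique : ∀ (N : Type u) [AddCommGroup N] [Module K N] [Module (A ⊗[K] Bᵐᵒᵖ) N]
    [IsScalarTower K (A ⊗[K] Bᵐᵒᵖ) N] (f : Cochain K (TriangularAlgebra K A B M) N (n + 1)),
    f ∈ weightOne K A B M N (n + 1) →
      ∃! φ : carrier →ₗ[A ⊗[K] Bᵐᵒᵖ] N, post (φ.restrictScalars K) universal = f

attribute [instance] WeightOneRep.addCommGroup WeightOneRep.moduleBase WeightOneRep.module
  WeightOneRep.isScalarTower

instance [Module.Projective K A] [Module.Projective K B] [Module.Projective K M] :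
    Module.Projective K (TriangularAlgebra K A B M) :=
  inferInstanceAs (Module.Projective K (A × M × B))

/-- All cochains of degree n + 1 are represented by a projective module F. The operator `single` is
idempotent and natural in the coefficients, so by Yoneda it comes from an idempotent q of F. The
range of q is a direct summand, hence projective, and represents the fixed points of `single`. -/
theorem nonempty_weightOneRep [Module.Projective K A] [Module.Projective K B]
    [Module.Projective K M] (n : ℕ) : Nonempty (WeightOneRep K A B M n) := by
  let R := A ⊗[K] Bᵐᵒᵖ
  obtain ⟨F, _, _, _, _, υF, _, hF⟩ :=
    exists_universal_module (K := K) (T := TriangularAlgebra K A B M) R n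
  have hFu : ∀ {N : Type u} [AddCommGroup N] [Module K N] [Module R N] [IsScalarTower K R N]
      {φ ψ : F →ₗ[R] N}, post (φ.restrictScalars K) υF = post (ψ.restrictScalars K) υF → φ = ψ :=
    fun {N} _ _ _ _ φ ψ e => (hF N _).unique e rfl
  obtain ⟨q, hq : post (q.restrictScalars K) υF = single diag off (n + 1) υF, -⟩ :=
    hF F (single diag off (n + 1) υF)
  have hs : single diag off (n + 1) (single diag off (n + 1) υF) = single diag off (n + 1) υF :=
    single_mem_weightOne υF
  have hpp : ∀ {N N' : Type u} [AddCommGroup N] [Module K N] [Module R N] [IsScalarTower K R N]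
      [AddCommGroup N'] [Module K N'] [Module R N'] [IsScalarTower K R N'] (φ : F →ₗ[R] N)
      (ψ : N →ₗ[R] N'), post (ψ.restrictScalars K) (post (φ.restrictScalars K) υF) =
        post ((ψ ∘ₗ φ).restrictScalars K) υF := fun φ ψ => rfl
  -- Idempotence of q is tested on the universal cochain, where it becomes idempotence of `single`.
  have hqq : q ∘ₗ q = q := hFu (by
    rw [← hpp q q, hq, ← single_post, hq, hs])
  have hqr : (LinearMap.range q).subtype ∘ₗ q.rangeRestrict = q := rfl
  refine ⟨{
    carrier := LinearMap.range q
    projective := ?_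
    universal := post (q.rangeRestrict.restrictScalars K) υF
    universal_mem := ?_
    existsUnique := ?_ }⟩
  · refine Module.Projective.of_split (LinearMap.range q).subtype q.rangeRestrict ?_
    ext ⟨_, y, rfl⟩
    exact congrArg Subtype.val (Subtype.ext (LinearMap.congr_fun hqq y) :
      q.rangeRestrict (q y) = q.rangeRestrict y)
  · have hinj : ∀ f g : Cochain K (TriangularAlgebra K A B M) (LinearMap.range q) (n + 1),
        post ((LinearMap.range q).subtype.restrictScalars K) f =
          post ((LinearMap.range q).subtype.restrictScalars K) g → f = g := fun f g e =>
      MultilinearMap.ext fun v => Subtype.ext (congrArg (fun h => h v) e)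
    refine hinj _ _ ?_
    rw [← single_post, LinearMap.id_apply, hpp q.rangeRestrict, hqr, hq, hs]
  · intro N _ _ _ _ f hf
    obtain ⟨φ, hφ, -⟩ := hF N f
    have hφ' : post (φ.restrictScalars K) υF = f := hφ
    refine ⟨φ ∘ₗ (LinearMap.range q).subtype, ?_, fun ψ hψ => ?_⟩
    · change post (φ.restrictScalars K) (post (q.restrictScalars K) υF) = f
      rw [hq, ← single_post, hφ']
      exact hf
    · have : ψ ∘ₗ q.rangeRestrict = φ ∘ₗ q := hFu (by
        refine Eq.trans hψ ?_
        rw [← hpp q φ, hq, ← single_post, hφ']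
        exact hf.symm)
      ext ⟨_, y, rfl⟩
      exact (LinearMap.congr_fun this y)

end TriangularAlgebra

end

/-! ### Exactness for coinduced coefficients -/

noncomputable section

/-- The module over a `K`-algebra `R` coinduced from a `K`-module `J`. -/
def Coinduced (K : Type w) (R J : Type u) [CommRing K] [Ring R] [Algebra K R] [AddCommGroup J]
    [Module K J] : Type u :=
  R →ₗ[K] J

namespace Coinduced

variable {K : Type w} {R J : Type u} [CommRing K] [Ring R] [Algebra K R] [AddCommGroup J]
  [Module K J]

instance : AddCommGroup (Coinduced K R J) := inferInstanceAs (AddCommGroup (R →ₗ[K] J))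

instance : Module K (Coinduced K R J) := inferInstanceAs (Module K (R →ₗ[K] J))

/-- Elements of the coinduced module as linear maps. -/
def toHom : Coinduced K R J ≃ₗ[K] (R →ₗ[K] J) := LinearEquiv.refl K _

theorem ext {g h : Coinduced K R J} (e : ∀ r, toHom g r = toHom h r) : g = h :=
  toHom.injective (LinearMap.ext e)

instance : Module R (Coinduced K R J) where
  smul r g := toHom.symm (toHom g ∘ₗ LinearMap.mulRight K r)
  one_smul g := ext fun r => congrArg (toHom g) (mul_one r)
  mul_smul r s g := ext fun x => congrArg (toHom g) (mul_assoc x r s).symm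
  smul_zero _ := rfl
  smul_add _ _ _ := rfl
  add_smul r s g := ext fun x => (congrArg (toHom g) (mul_add x r s)).trans (map_add _ _ _)
  zero_smul g := ext fun x => (congrArg (toHom g) (mul_zero x)).trans (map_zero _)

@[simp] theorem toHom_smul (r : R) (g : Coinduced K R J) (x : R) :
    toHom (r • g) x = toHom g (x * r) := rfl

instance : IsScalarTower K R (Coinduced K R J) where
  smul_assoc c r g := ext fun x => by simp

/-- The coinduction of a linear map. -/
def ofHom {P : Type*} [AddCommGroup P] [Module K P] [Module R P] [IsScalarTower K R P]
    (q : P →ₗ[K] J) : P →ₗ[R] Coinduced K R J where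
  toFun p := toHom.symm (q ∘ₗ LinearMap.flip (Algebra.lsmul K K P).toLinearMap p)
  map_add' p p' := ext fun r => by simp
  map_smul' r p := ext fun x => by simp

end Coinduced

namespace Cochain

variable {K : Type*} [CommRing K] {T : Type*} [AddCommGroup T] [Module K T]
  {X : Type*} [AddCommGroup X] [Module K X] {n : ℕ}

/-- A cochain as a multilinear map in all arguments but the first. -/
def flipHead (f : Cochain K T X (n + 1)) : Cochain K T (T →ₗ[K] X) n where
  toFun v :=
    { toFun := fun t => head f t v
      map_add' := fun s t => by simp
      map_smul' := fun c t => by simp }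
  map_update_add' v i x y := by ext t; exact (head f t).map_update_add v i x y
  map_update_smul' v i c x := by ext t; exact (head f t).map_update_smul v i c x

/-- A cochain as a multilinear map in all arguments but the last. -/
def flipLast : Cochain K T X (n + 1) →ₗ[K] Cochain K T (T →ₗ[K] X) n :=
  (multilinearCurryRightEquiv K (fun _ : Fin (n + 1) => T) X).toLinearMap

theorem flipLast_apply (f : Cochain K T X (n + 1)) (v : Fin n → T) (t : T) :
    flipLast f v t = f (Fin.snoc v t) := rfl

theorem head_flipLast (f : Cochain K T X (n + 2)) (t : T) :
    head (flipLast f) t = flipLast (head f t) := by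
  ext v s
  rw [flipLast_apply, head_apply, flipLast_apply, head_apply, Fin.cons_snoc_eq_snoc_cons]

theorem point_symm_flipLast (f : Cochain K T X 1) (t : T) :
    point.symm (flipLast f) t = point.symm (head f t) := by
  rw [point_symm_apply, flipLast_apply, point_symm_apply, head_apply]
  congr 1
  funext k
  obtain rfl : k = 0 := Subsingleton.elim (α := Fin 1) _ _
  rfl

end Cochain

namespace TriangularAlgebra

open Cochain

variable {K : Type w} {A B M J : Type u} [CommRing K] [Ring A] [Algebra K A] [Ring B] [Algebra K B]
  [AddCommGroup M] [Module K M] [Module (A ⊗[K] Bᵐᵒᵖ) M] [IsScalarTower K (A ⊗[K] Bᵐᵒᵖ) M]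
  [AddCommGroup J] [Module K J] {n : ℕ}

theorem coinduced_ext {g h : Coinduced K (A ⊗[K] Bᵐᵒᵖ) J}
    (e : ∀ a b, g.toHom (a ⊗ₜ b) = h.toHom (a ⊗ₜ b)) : g = h :=
  Coinduced.toHom.injective (TensorProduct.ext' e)

variable (K B J) in
/-- The linear maps on the opposite of the lower right corner. -/
def RightHom : Type u := Bᵐᵒᵖ →ₗ[K] J

instance : AddCommGroup (RightHom K B J) := inferInstanceAs (AddCommGroup (Bᵐᵒᵖ →ₗ[K] J))

instance : Module K (RightHom K B J) := inferInstanceAs (Module K (Bᵐᵒᵖ →ₗ[K] J))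

/-- Elements of `RightHom` as linear maps. -/
def RightHom.toHom : RightHom K B J ≃ₗ[K] (Bᵐᵒᵖ →ₗ[K] J) := LinearEquiv.refl K _

theorem RightHom.ext {g h : RightHom K B J} (e : ∀ b, g.toHom b = h.toHom b) : g = h :=
  RightHom.toHom.injective (LinearMap.ext e)

/-- Evaluation in the first tensor factor. -/
def evalLeft (a : A) : Coinduced K (A ⊗[K] Bᵐᵒᵖ) J →ₗ[K] RightHom K B J :=
  RightHom.toHom.symm.toLinearMap ∘ₗ LinearMap.lcomp K J (TensorProduct.mk K A Bᵐᵒᵖ a) ∘ₗ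
    Coinduced.toHom.toLinearMap

@[simp] theorem toHom_evalLeft (a : A) (g : Coinduced K (A ⊗[K] Bᵐᵒᵖ) J) (b : Bᵐᵒᵖ) :
    (evalLeft a g).toHom b = g.toHom (a ⊗ₜ b) := rfl

theorem cochain_coinduced_ext {f g : Cochain K (TriangularAlgebra K A B M)
    (Coinduced K (A ⊗[K] Bᵐᵒᵖ) J) n} (e : ∀ a : A, post (evalLeft a) f = post (evalLeft a) g) :
    f = g :=
  MultilinearMap.ext fun v => coinduced_ext fun a b =>
    LinearMap.congr_fun (congrArg (fun h => (h v).toHom) (e a)) b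

variable (A B M J) in
/-- The right action of the triangular algebra on maps on its lower right corner. -/
def rightActHom : RightHom K B J →ₗ[K] TriangularAlgebra K A B M →ₗ[K] RightHom K B J where
  toFun g :=
    { toFun := fun t => RightHom.toHom.symm
        (g.toHom ∘ₗ LinearMap.mulRight K (MulOpposite.op t.botRight))
      map_add' := fun s t => RightHom.ext fun b => by simp [mul_add]
      map_smul' := fun c t => RightHom.ext fun b => by simp }
  map_add' g h := rfl
  map_smul' c g := rfl

theorem evalLeft_rightAct (a : A) (g : Coinduced K (A ⊗[K] Bᵐᵒᵖ) J)
    (t : TriangularAlgebra K A B M) :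
    evalLeft a (rightAct A B M _ g t) = rightActHom A B M J (evalLeft a g) t := by
  refine RightHom.ext fun b => ?_
  change g.toHom ((a ⊗ₜ[K] b) * (1 ⊗ₜ[K] MulOpposite.op t.botRight)) =
    g.toHom (a ⊗ₜ[K] (b * MulOpposite.op t.botRight))
  rw [Algebra.TensorProduct.tmul_mul_tmul, mul_one]

/-- The map `θ ↦ (a ⊗ b ↦ θ(a)(1 ⊗ b))`. -/
def evalTopLeft : (TriangularAlgebra K A B M →ₗ[K] Coinduced K (A ⊗[K] Bᵐᵒᵖ) J) →ₗ[K]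
    Coinduced K (A ⊗[K] Bᵐᵒᵖ) J where
  toFun θ := Coinduced.toHom.symm (TensorProduct.lift
    (RightHom.toHom.toLinearMap ∘ₗ evalLeft 1 ∘ₗ θ ∘ₗ inTopLeft))
  map_add' θ η := coinduced_ext fun a b => by simp
  map_smul' c θ := coinduced_ext fun a b => by simp

/-- The map `θ ↦ (a ⊗ b ↦ θ(b)(a ⊗ 1))`. -/
def evalBotRight : (TriangularAlgebra K A B M →ₗ[K] Coinduced K (A ⊗[K] Bᵐᵒᵖ) J) →ₗ[K]
    Coinduced K (A ⊗[K] Bᵐᵒᵖ) J where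
  toFun θ := Coinduced.toHom.symm (TensorProduct.lift (LinearMap.flip
    (LinearMap.lcomp K J ((TensorProduct.mk K A Bᵐᵒᵖ).flip 1) ∘ₗ Coinduced.toHom.toLinearMap ∘ₗ
      θ ∘ₗ inBotRight ∘ₗ (MulOpposite.opLinearEquiv K).symm.toLinearMap)))
  map_add' θ η := coinduced_ext fun a b => by simp
  map_smul' c θ := coinduced_ext fun a b => by simp

theorem toHom_evalBotRight (θ : TriangularAlgebra K A B M →ₗ[K] Coinduced K (A ⊗[K] Bᵐᵒᵖ) J)
    (a : A) (b : Bᵐᵒᵖ) :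
    (evalBotRight θ).toHom (a ⊗ₜ b) = (θ (mk 0 0 b.unop)).toHom (a ⊗ₜ 1) := rfl

/-- The left homotopy `g(w)(a ⊗ b) = f(a, w)(1 ⊗ b)` on cochains in a coinduced module. -/
def leftHomotopy (f : Cochain K (TriangularAlgebra K A B M) (Coinduced K (A ⊗[K] Bᵐᵒᵖ) J) (n + 1)) :
    Cochain K (TriangularAlgebra K A B M) (Coinduced K (A ⊗[K] Bᵐᵒᵖ) J) n :=
  post evalTopLeft (flipHead f)

theorem post_evalLeft_leftHomotopy
    (f : Cochain K (TriangularAlgebra K A B M) (Coinduced K (A ⊗[K] Bᵐᵒᵖ) J) (n + 1)) (a : A) :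
    post (evalLeft a) (leftHomotopy f) = post (evalLeft 1) (head f (mk a 0 0)) := rfl

/-- The right homotopy `g(w)(a ⊗ b) = f(w, b)(a ⊗ 1)` on cochains in a coinduced module. -/
def rightHomotopy : Cochain K (TriangularAlgebra K A B M) (Coinduced K (A ⊗[K] Bᵐᵒᵖ) J) (n + 1) →ₗ[K]
    Cochain K (TriangularAlgebra K A B M) (Coinduced K (A ⊗[K] Bᵐᵒᵖ) J) n :=
  post evalBotRight ∘ₗ flipLast

theorem head_rightHomotopy
    (f : Cochain K (TriangularAlgebra K A B M) (Coinduced K (A ⊗[K] Bᵐᵒᵖ) J) (n + 2))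
    (t : TriangularAlgebra K A B M) : head (rightHomotopy f) t = rightHomotopy (head f t) := by
  rw [rightHomotopy, LinearMap.comp_apply, head_post, head_flipLast]
  rfl

theorem mulHead_rightHomotopy
    (f : Cochain K (TriangularAlgebra K A B M) (Coinduced K (A ⊗[K] Bᵐᵒᵖ) J) (n + 2))
    (t : TriangularAlgebra K A B M) :
    mulHead t (rightHomotopy f) = rightHomotopy (mulHead t f) :=
  ext_head fun s => by rw [head_mulHead, head_rightHomotopy, head_rightHomotopy, head_mulHead]

theorem toHom_rightHomotopy_apply
    (f : Cochain K (TriangularAlgebra K A B M) (Coinduced K (A ⊗[K] Bᵐᵒᵖ) J) (n + 1))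
    (v : Fin n → TriangularAlgebra K A B M) (a : A) (b : Bᵐᵒᵖ) :
    (rightHomotopy f v).toHom (a ⊗ₜ b) = (f (Fin.snoc v (mk 0 0 b.unop))).toHom (a ⊗ₜ 1) := rfl

theorem pre_diag_rightHomotopy
    (f : Cochain K (TriangularAlgebra K A B M) (Coinduced K (A ⊗[K] Bᵐᵒᵖ) J) (n + 1)) :
    pre diag (rightHomotopy f) = rightHomotopy (pre diag f) := by
  refine MultilinearMap.ext fun v => coinduced_ext fun a b => ?_
  rw [pre_apply, toHom_rightHomotopy_apply, toHom_rightHomotopy_apply, pre_apply]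
  congr 3
  funext k
  refine Fin.lastCases ?_ (fun i => ?_) k <;> simp

theorem leftMul_rightHomotopy
    (f : Cochain K (TriangularAlgebra K A B M) (Coinduced K (A ⊗[K] Bᵐᵒᵖ) J) (n + 1))
    (t : TriangularAlgebra K A B M) :
    rightHomotopy (post (leftAct A B M _ t) f) = post (leftAct A B M _ t) (rightHomotopy f) := by
  refine MultilinearMap.ext fun v => coinduced_ext fun a b => ?_
  rw [toHom_rightHomotopy_apply, post_apply, post_apply, leftAct_apply, leftAct_apply,
    Coinduced.toHom_smul, Coinduced.toHom_smul, Algebra.TensorProduct.tmul_mul_tmul,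
    Algebra.TensorProduct.tmul_mul_tmul, mul_one, mul_one, toHom_rightHomotopy_apply]

/-- Appending b as a last argument commutes with all contractions of the others. Letting the last t
act on the right in the first term gives the same as contracting it with b in the second, so these
cancel too. What survives is f(w) acted on by b and evaluated at a ⊗ 1, which is f(w) evaluated at a
⊗ b. -/
theorem rightD_rightHomotopy
    (f : Cochain K (TriangularAlgebra K A B M) (Coinduced K (A ⊗[K] Bᵐᵒᵖ) J) (n + 1))
    (hf : pre diag f = f) :
    rightD (rightAct A B M _) n (rightHomotopy f) -
      rightHomotopy (rightD (rightAct A B M _) (n + 1) f) = (-1 : ℤ) ^ n • f := by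
  induction n with
  | zero =>
    refine ext_head fun t => ext_point (coinduced_ext fun a b => ?_)
    have h : ∀ s, head f s = head f (diag s) := fun s => by
      conv_lhs => rw [← hf]
      rw [head_pre]
      exact ext_point (point_symm_pre _ _)
    have h1 : ∀ g : Cochain K (TriangularAlgebra K A B M) (Coinduced K (A ⊗[K] Bᵐᵒᵖ) J) 1,
        (point.symm (rightHomotopy g)).toHom (a ⊗ₜ b) =
          (point.symm (head g (mk 0 0 b.unop))).toHom (a ⊗ₜ 1) := fun g => by
      rw [rightHomotopy, LinearMap.comp_apply, point_symm_post, toHom_evalBotRight,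
        point_symm_flipLast]
    have h1' : (point.symm (rightHomotopy f)).toHom (a ⊗ₜ (b * MulOpposite.op t.botRight)) =
          (point.symm (head f (mk 0 0 (t.botRight * b.unop)))).toHom (a ⊗ₜ 1) := by
      rw [rightHomotopy, LinearMap.comp_apply, point_symm_post, toHom_evalBotRight,
        point_symm_flipLast]
      rfl
    rw [map_sub, LinearMap.sub_apply, head_rightD_zero, head_rightHomotopy, head_rightD]
    simp only [map_sub, LinearMap.sub_apply, LinearEquiv.symm_apply_apply, h1, head_mulHead,
      head_rightD_zero, rightAct_apply, Coinduced.toHom_smul,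
      Algebra.TensorProduct.tmul_mul_tmul, mul_one, h1', one_mul]
    -- The product of t with b also has an upper right entry, which f ignores since it only sees
    -- diagonal arguments.
    rw [h (t * _)]
    simp [diag]
  | succ n ih =>
    refine ext_head fun t => ?_
    have h : ∀ s, head f s = pre diag (head f (diag s)) := fun s => by
      conv_lhs => rw [← hf]
      rw [head_pre]
    have h2 : pre diag (head f t) = head f t := by
      rw [h t, pre_pre, diag_comp_diag]
    rw [map_sub, LinearMap.sub_apply, head_rightD, head_rightHomotopy, head_rightHomotopy,
      head_rightD, mulHead_rightHomotopy, map_sub, sub_sub_sub_cancel_left, ← neg_sub, ih _ h2,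
      map_zsmul, LinearMap.smul_apply, pow_succ]
    simp

theorem single_head_diag {N : Type*} [AddCommGroup N] [Module K N]
    {f : Cochain K (TriangularAlgebra K A B M) N (n + 1)} (hf : single diag off (n + 1) f = f)
    (t : TriangularAlgebra K A B M) :
    single diag off n (head f (diag t)) = head f (diag t) := by
  conv_rhs => rw [← hf]
  rw [head_single]
  have : off (diag t) = 0 := LinearMap.congr_fun off_comp_diag t
  have h' : diag (diag t) = diag t := LinearMap.congr_fun diag_comp_diag t
  rw [this, h']
  simp

theorem pre_diag_head_off {N : Type*} [AddCommGroup N] [Module K N]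
    {f : Cochain K (TriangularAlgebra K A B M) N (n + 1)} (hf : single diag off (n + 1) f = f)
    (t : TriangularAlgebra K A B M) :
    pre diag (head f (off t)) = head f (off t) := by
  conv_rhs => rw [← hf]
  rw [head_single]
  have : diag (off t) = 0 := LinearMap.congr_fun diag_comp_off t
  have h' : off (off t) = off t := LinearMap.congr_fun off_comp_off t
  rw [this, h']
  simp

/-- The argument absorbed from f is diagonal, so the one in M is among those that remain. -/
theorem leftHomotopy_mem_weightOne
    {f : Cochain K (TriangularAlgebra K A B M) (Coinduced K (A ⊗[K] Bᵐᵒᵖ) J) (n + 1)}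
    (hf : f ∈ weightOne K A B M _ (n + 1)) : leftHomotopy f ∈ weightOne K A B M _ n := by
  refine cochain_coinduced_ext fun a => ?_
  rw [← single_post, LinearMap.id_apply, post_evalLeft_leftHomotopy, single_post]
  exact congrArg _ (single_head_diag hf (mk a 0 0))

theorem evalLeft_comp_leftAct (a : A) (t : TriangularAlgebra K A B M) :
    (evalLeft a : Coinduced K (A ⊗[K] Bᵐᵒᵖ) J →ₗ[K] _) ∘ₗ leftAct A B M _ t =
      evalLeft (a * t.topLeft) :=
  LinearMap.ext fun g => RightHom.ext fun b => by simp

/-- This is the cocycle identity with first arguments a and s, evaluated at 1 ⊗ b: the left action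
of a turns evaluation at 1 into evaluation at a. -/
theorem post_evalLeft_head
    {f : Cochain K (TriangularAlgebra K A B M) (Coinduced K (A ⊗[K] Bᵐᵒᵖ) J) (n + 2)}
    (hf : bimoduleD K A B M _ (n + 2) f = 0) (a : A) (s : TriangularAlgebra K A B M) :
    post (evalLeft a) (head f s) = post (evalLeft 1) (head f (mk a 0 0 * s)) -
      post (evalLeft 1) (head (rightD (rightAct A B M _) (n + 1) (head f (mk a 0 0))) s) := by
  have h : head (head (bimoduleD K A B M _ (n + 2) f) (mk a 0 0)) s =
      post (leftAct A B M _ (mk a 0 0)) (head f s) - (head f (mk a 0 0 * s) -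
        head (rightD (rightAct A B M _) (n + 1) (head f (mk a 0 0))) s) := by
    rw [head_coboundary, map_sub, LinearMap.sub_apply, head_rightD (n := n + 1), map_sub head,
      LinearMap.sub_apply, head_mulHead, head_post]
  rw [hf] at h
  have h' := congrArg (post (evalLeft (1 : A))) h
  rw [map_sub, map_sub, post_post, evalLeft_comp_leftAct, topLeft_mk, one_mul] at h'
  rw [← sub_eq_zero, ← h']
  simp

theorem rightD_evalLeft
    (f : Cochain K (TriangularAlgebra K A B M) (Coinduced K (A ⊗[K] Bᵐᵒᵖ) J) n) (a : A) :
    rightD (rightActHom A B M J) n (post (evalLeft a) f) =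
      post (evalLeft a) (rightD (rightAct A B M (Coinduced K (A ⊗[K] Bᵐᵒᵖ) J)) n f) := by
  have h : ∀ x t, evalLeft a (rightAct A B M (Coinduced K (A ⊗[K] Bᵐᵒᵖ) J) x t) =
    rightActHom A B M J (evalLeft a x) t := fun x t => evalLeft_rightAct a x t
  have h' := rightD_post (ρ := rightAct A B M (Coinduced K (A ⊗[K] Bᵐᵒᵖ) J))
    (ρ' := rightActHom A B M J) (n := n) (evalLeft a)
  have h'' := h' h
  exact h'' f

/-- Compared with `post_evalLeft_head`, only the full product of a and s is replaced by its upper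
left corner. For diagonal s the two agree, so subtracting this coboundary kills the cocycle there.
-/
theorem post_evalLeft_head_leftHomotopy
    (f : Cochain K (TriangularAlgebra K A B M) (Coinduced K (A ⊗[K] Bᵐᵒᵖ) J) (n + 2))
    (a : A) (s : TriangularAlgebra K A B M) :
    post (evalLeft a) (head (bimoduleD K A B M _ (n + 1) (leftHomotopy f)) s) =
      post (evalLeft 1) (head f (mk (a * s.topLeft) 0 0)) -
      post (evalLeft 1) (head (rightD (rightAct A B M _) (n + 1) (head f (mk a 0 0))) s) := by
  have h : post (evalLeft a) (rightD (rightAct A B M _) (n + 1) (leftHomotopy f)) =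
      post (evalLeft 1) (rightD (rightAct A B M _) (n + 1) (head f (mk a 0 0))) := by
    rw [← rightD_evalLeft, ← rightD_evalLeft, post_evalLeft_leftHomotopy]
  rw [head_coboundary, map_sub, post_post, evalLeft_comp_leftAct, post_evalLeft_leftHomotopy,
    ← head_post (evalLeft a) (rightD _ _ _), h, head_post]

/-- A cocycle in a coinduced module is cohomologous to one that vanishes if the first argument is
diagonal. -/
theorem head_diag_sub_leftHomotopy
    {f : Cochain K (TriangularAlgebra K A B M) (Coinduced K (A ⊗[K] Bᵐᵒᵖ) J) (n + 2)}
    (hf : bimoduleD K A B M _ (n + 2) f = 0) (t : TriangularAlgebra K A B M) :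
    head (f - bimoduleD K A B M _ (n + 1) (leftHomotopy f)) (diag t) = 0 := by
  refine cochain_coinduced_ext fun a => ?_
  have : (mk a 0 0 : TriangularAlgebra K A B M) * diag t = mk (a * t.topLeft) 0 0 := by
    ext <;> simp
  rw [map_sub, LinearMap.sub_apply, map_sub, post_evalLeft_head hf,
    post_evalLeft_head_leftHomotopy, this, map_zero]
  exact sub_self _

/-- Once k vanishes on diagonal first arguments, its first argument is the one in M and all later
ones are diagonal, so `rightD_rightHomotopy` applies to them. -/
theorem bimoduleD_rightHomotopy
    {k : Cochain K (TriangularAlgebra K A B M) (Coinduced K (A ⊗[K] Bᵐᵒᵖ) J) (n + 2)}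
    (hk : bimoduleD K A B M _ (n + 2) k = 0) (hk1 : k ∈ weightOne K A B M _ (n + 2))
    (hk2 : ∀ t, head k (diag t) = 0) :
    bimoduleD K A B M _ (n + 1) (rightHomotopy k) = (-1 : ℤ) ^ n • k := by
  refine ext_head fun t => ?_
  -- For a diagonal first argument only the left action and the first contraction are left. Both
  -- commute with the homotopy, so the cocycle identity gives zero.
  have h1 : head (bimoduleD K A B M _ (n + 1) (rightHomotopy k)) (diag t) = 0 := by
    have := congrArg (fun g => rightHomotopy (head g (diag t))) hk
    rw [head_coboundary, head_rightD, hk2, map_zero, sub_zero, map_sub, leftMul_rightHomotopy,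
      ← mulHead_rightHomotopy] at this
    rw [head_coboundary, head_rightD, head_rightHomotopy, hk2, map_zero, map_zero, sub_zero, this]
    simp
  -- For a first argument in M the left action vanishes, and the cocycle identity trades the first
  -- contraction for `rightD` of the cochain in the remaining arguments.
  have h2 : head (bimoduleD K A B M _ (n + 1) (rightHomotopy k)) (off t) =
      (-1 : ℤ) ^ n • head k (off t) := by
    have e : leftAct A B M (Coinduced K (A ⊗[K] Bᵐᵒᵖ) J) (off t) = 0 := by
      ext g; simp
    have := congrArg (fun g => rightHomotopy (head g (off t))) hk
    rw [head_coboundary, head_rightD, e, post_zero_left, zero_sub, map_neg, map_sub,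
      ← mulHead_rightHomotopy] at this
    rw [head_coboundary, head_rightD, head_rightHomotopy, e, post_zero_left, zero_sub,
      ← rightD_rightHomotopy _ (pre_diag_head_off hk1 t)]
    simp only [map_zero, LinearMap.zero_apply, neg_eq_zero, sub_eq_zero] at this
    rw [this]
    abel
  rw [← diag_add_off t, map_add, h1, h2, map_add, map_zsmul, LinearMap.smul_apply,
    LinearMap.smul_apply, hk2, zero_add, smul_zero, zero_add]

/-- The argument in M is the first one, while the homotopy absorbs the last. In degree at least two
these are different arguments. -/
theorem rightHomotopy_mem_weightOne
    {k : Cochain K (TriangularAlgebra K A B M) (Coinduced K (A ⊗[K] Bᵐᵒᵖ) J) (n + 2)}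
    (hk1 : k ∈ weightOne K A B M _ (n + 2)) (hk2 : ∀ t, head k (diag t) = 0) :
    rightHomotopy k ∈ weightOne K A B M _ (n + 1) := by
  refine ext_head fun t => ?_
  have h : head k t = head k (off t) := by
    conv_lhs => rw [← diag_add_off t, map_add, hk2, zero_add]
  rw [head_single, head_rightHomotopy, head_rightHomotopy, hk2, map_zero, map_zero, add_zero,
    pre_diag_rightHomotopy, pre_diag_head_off hk1, LinearMap.id_apply, head_rightHomotopy, h]

/-- The complex of cochains with exactly one argument in `M` and values in a coinduced module is
exact in positive degrees. -/
theorem exists_bimoduleD_eq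
    {f : Cochain K (TriangularAlgebra K A B M) (Coinduced K (A ⊗[K] Bᵐᵒᵖ) J) (n + 2)}
    (hf : f ∈ weightOne K A B M _ (n + 2)) (hd : bimoduleD K A B M _ (n + 2) f = 0) :
    ∃ g ∈ weightOne K A B M (Coinduced K (A ⊗[K] Bᵐᵒᵖ) J) (n + 1),
      bimoduleD K A B M _ (n + 1) g = f := by
  have hg := leftHomotopy_mem_weightOne hf
  have hk1 := sub_mem hf (bimoduleD_mem_weightOne hg)
  have hk2 := head_diag_sub_leftHomotopy hd
  have hk : bimoduleD K A B M _ (n + 2) (f - bimoduleD K A B M _ (n + 1) (leftHomotopy f)) = 0 := by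
    rw [map_sub, hd, bimoduleD_bimoduleD, sub_zero]
  -- The left homotopy reduces f to a cocycle vanishing on diagonal first arguments, and the right
  -- homotopy is a primitive of that one up to the sign (-1)ⁿ.
  refine ⟨leftHomotopy f + (-1 : ℤ) ^ n • rightHomotopy
    (f - bimoduleD K A B M _ (n + 1) (leftHomotopy f)),
    add_mem hg (zsmul_mem (rightHomotopy_mem_weightOne hk1 hk2) _), ?_⟩
  rw [map_add, map_zsmul, bimoduleD_rightHomotopy hk hk1 hk2, smul_smul, ← mul_pow]
  simp

/-- A cocycle of degree one with its argument in `M` and values in a coinduced module is given by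
a linear map on `M`. -/
theorem exists_linearMap_of_bimoduleD_eq_zero
    {f : Cochain K (TriangularAlgebra K A B M) (Coinduced K (A ⊗[K] Bᵐᵒᵖ) J) 1}
    (hd : bimoduleD K A B M _ 1 f = 0) :
    ∃ φ : M →ₗ[K] J, ∀ x r, (point.symm (head f (mk 0 x 0))).toHom r = φ (r • x) := by
  have h : ∀ s t, leftAct A B M _ s (point.symm (head f t)) - point.symm (head f (s * t)) +
      rightAct A B M _ (point.symm (head f s)) t = 0 := by
    intro s t
    have := congrArg (fun g => point.symm (head (head g s) t)) hd
    simp only [head_coboundary, head_rightD, map_sub, LinearMap.sub_apply, head_mulHead, head_post,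
      head_rightD_zero, point_symm_post, LinearEquiv.symm_apply_apply, map_zero,
      LinearMap.zero_apply] at this
    rw [← this]
    abel
  -- The linear map is x ↦ f(x)(1). The cocycle identity on the pairs (a, x) and (ax, b) moves a and
  -- b from the variable in R to the argument in M.
  refine ⟨LinearMap.applyₗ 1 ∘ₗ Coinduced.toHom.toLinearMap ∘ₗ point.symm.toLinearMap ∘ₗ head f ∘ₗ
    inTopRight, fun x r => ?_⟩
  induction r with
  | zero => rw [zero_smul_bimodule, map_zero, map_zero]
  | add r s hr hs => rw [map_add, hr, hs, add_smul, map_add]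
  | tmul a b =>
    have h1 := h (mk a 0 0) (mk 0 x 0)
    have h2 := h (mk 0 ((a ⊗ₜ[K] (1 : Bᵐᵒᵖ)) • x) 0) (mk 0 0 b.unop)
    have e1 : (mk a 0 0 : TriangularAlgebra K A B M) * mk 0 x 0 =
        mk 0 ((a ⊗ₜ[K] (1 : Bᵐᵒᵖ)) • x) 0 := by
      ext <;> simp
    have e2 : (mk 0 ((a ⊗ₜ[K] (1 : Bᵐᵒᵖ)) • x) 0 : TriangularAlgebra K A B M) * mk 0 0 b.unop =
        mk 0 ((a ⊗ₜ[K] b) • x) 0 := by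
      ext <;> simp [smul_smul]
    rw [e1] at h1
    rw [e2] at h2
    have h1' := congrArg (fun g => g.toHom ((1 : A) ⊗ₜ[K] b)) h1
    have h2' := congrArg (fun g => g.toHom (1 : A ⊗[K] Bᵐᵒᵖ)) h2
    simp [Algebra.TensorProduct.one_def, sub_eq_zero, neg_add_eq_zero] at h1' h2'
    rw [h1', ← h2']
    rfl

end TriangularAlgebra

end

/-! ### Cohomology of the cochains with one argument in the bimodule as Ext -/

noncomputable section

section Homology

variable {K : Type w} [CommRing K]

/-- An equivalence in the middle of two short complexes of modules that matches the kernels and the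
ranges induces an equivalence of the homology modules. -/
theorem nonempty_shortComplex_homology_equiv (S S' : ShortComplex (ModuleCat.{u} K))
    (e : S.X₂ ≃ₗ[K] S'.X₂) (hg : ∀ x, S.g x = 0 ↔ S'.g (e x) = 0)
    (hf : ∀ x, (∃ y, S.f y = x) ↔ ∃ y, S'.f y = e x) :
    Nonempty (S.homology ≃ₗ[K] S'.homology) := by
  have hk : (LinearMap.ker S.g.hom).map e.toLinearMap = LinearMap.ker S'.g.hom := by
    ext x
    rw [Submodule.mem_map]
    constructor
    · rintro ⟨y, hy, rfl⟩
      exact (hg y).1 hy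
    · intro hx
      exact ⟨e.symm x, (hg _).2 (by simpa using hx), by simp⟩
  let e' : LinearMap.ker S.g.hom ≃ₗ[K] LinearMap.ker S'.g.hom := e.ofSubmodules _ _ hk
  refine ⟨S.moduleCatHomologyIso.toLinearEquiv ≪≫ₗ
    Submodule.Quotient.equiv _ _ e' ?_ ≪≫ₗ S'.moduleCatHomologyIso.toLinearEquiv.symm⟩
  ext ⟨x, hx⟩
  rw [Submodule.mem_map]
  constructor
  · rintro ⟨y, ⟨z, rfl⟩, hy⟩
    obtain ⟨z', hz'⟩ := (hf (S.f z)).1 ⟨z, rfl⟩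
    refine ⟨z', Subtype.ext (hz'.trans ?_)⟩
    exact congrArg Subtype.val hy
  · rintro ⟨z, hz⟩
    have hz' : S'.f z = x := congrArg Subtype.val hz
    obtain ⟨y, hy⟩ := (hf (e.symm x)).2 ⟨z, by rw [hz']; simp⟩
    refine ⟨S.moduleCatToCycles y, ⟨y, rfl⟩, Subtype.ext ?_⟩
    change e (S.f y) = x
    rw [hy]; simp

/-- Only one degree of each complex is compared, so the degrees may differ by a shift. Letting the
source k of the incoming differential vary also covers degree zero, where all differentials into it
are zero. -/
theorem nonempty_homology_equiv (C D : CochainComplex (ModuleCat.{u} K) ℕ) (i j : ℕ)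
    (e : C.X i ≃ₗ[K] D.X j) (hg : ∀ x, C.d i (i + 1) x = 0 ↔ D.d j (j + 1) (e x) = 0)
    (hf : ∀ x, (∃ k y, C.d k i y = x) ↔ ∃ k y, D.d k j y = e x) :
    Nonempty (C.homology i ≃ₗ[K] D.homology j) := by
  have next : ∀ (E : CochainComplex (ModuleCat.{u} K) ℕ) (k : ℕ) (x : E.X k),
      (E.sc k).g x = 0 ↔ E.d k (k + 1) x = 0 := by
    intro E k x
    have : ∀ l, l = (ComplexShape.up ℕ).next k →
        (E.d k ((ComplexShape.up ℕ).next k) x = 0 ↔ E.d k l x = 0) := by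
      rintro _ rfl; rfl
    exact this (k + 1) (by simp)
  have prev : ∀ (E : CochainComplex (ModuleCat.{u} K) ℕ) (k : ℕ) (x : E.X k),
      (∃ y, (E.sc k).f y = x) ↔ ∃ l y, E.d l k y = x := by
    intro E k x
    refine ⟨fun ⟨y, hy⟩ => ⟨_, y, hy⟩, ?_⟩
    rintro ⟨l, y, rfl⟩
    by_cases h : (ComplexShape.up ℕ).Rel l k
    · obtain rfl := (ComplexShape.up ℕ).prev_eq' h
      exact ⟨y, rfl⟩
    · refine ⟨0, ?_⟩
      rw [E.shape _ _ h]
      exact map_zero (E.sc k).f.hom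
  exact nonempty_shortComplex_homology_equiv (C.sc i) (D.sc j) e
    (fun x => (next C i x).trans ((hg x).trans (next D j (e x)).symm))
    (fun x => (prev C i x).trans ((hf x).trans (prev D j (e x)).symm))

end Homology

section Resolution

variable {R : Type u} [Ring R]

/-- A projective resolution of a module from an exact chain complex of projective modules. -/
def projectiveResolutionOfExact (C : ChainComplex (ModuleCat.{u} R) ℕ)
    (hC : ∀ n, Projective (C.X n)) {Z : ModuleCat.{u} R} (ε : C.X 0 ⟶ Z) (hε : C.d 1 0 ≫ ε = 0)
    (h : ∀ n x, C.d (n + 1) n x = 0 → ∃ y, C.d (n + 2) (n + 1) y = x)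
    (h0 : ∀ x, ε x = 0 → ∃ y, C.d 1 0 y = x) (hs : Function.Surjective ε) :
    ProjectiveResolution Z where
  complex := C
  projective := hC
  π := (ChainComplex.toSingle₀Equiv _ _).symm ⟨ε, hε⟩
  quasiIso := ⟨fun n => by
    cases n with
    | zero =>
      rw [ChainComplex.quasiIsoAt₀_iff, ShortComplex.quasiIso_iff_of_zeros' _
        (C.shape 0 0 (by simp)) rfl rfl]
      have : Epi ε := (ModuleCat.epi_iff_surjective _).2 hs
      refine (ShortComplex.exact_and_epi_g_iff_of_iso
        (S₁ := ShortComplex.mk (C.d 1 0) ε hε) ?_).1 ⟨?_, this⟩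
      · exact ShortComplex.isoMk (Iso.refl _) (Iso.refl _) (Iso.refl _)
          ((Category.id_comp _).trans (Category.comp_id _).symm)
          ((Category.id_comp _).trans (Category.comp_id _).symm)
      · rw [ShortComplex.moduleCat_exact_iff]
        exact h0
    | succ n =>
      rw [quasiIsoAt_iff_exactAt']
      · rw [HomologicalComplex.exactAt_iff' _ (n + 1 + 1) (n + 1) n (by simp) (by simp),
          ShortComplex.moduleCat_exact_iff]
        exact h n
      · apply ChainComplex.exactAt_succ_single_obj⟩

end Resolution

namespace TriangularAlgebra

open Cochain

variable {K : Type w} {A B M N : Type u} [CommRing K] [Ring A] [Algebra K A] [Ring B] [Algebra K B]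
  [AddCommGroup M] [Module K M] [Module (A ⊗[K] Bᵐᵒᵖ) M] [IsScalarTower K (A ⊗[K] Bᵐᵒᵖ) M]
  [AddCommGroup N] [Module K N] [Module (A ⊗[K] Bᵐᵒᵖ) N] [IsScalarTower K (A ⊗[K] Bᵐᵒᵖ) N]

variable (K A B M N) in
/-- The coboundary on cochains with exactly one argument in `M`. -/
def weightOneD (n : ℕ) : weightOne K A B M N n →ₗ[K] weightOne K A B M N (n + 1) :=
  (bimoduleD K A B M N n).restrict fun _ hf => bimoduleD_mem_weightOne hf

@[simp] theorem coe_weightOneD {n : ℕ} (f : weightOne K A B M N n) :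
    (weightOneD K A B M N n f : Cochain K _ N (n + 1)) = bimoduleD K A B M N n f := rfl

variable (K A B M N) in
theorem weightOneD_comp (n : ℕ) :
    weightOneD K A B M N (n + 1) ∘ₗ weightOneD K A B M N n = 0 :=
  LinearMap.ext fun f => Subtype.ext (by
    rw [LinearMap.comp_apply, coe_weightOneD, coe_weightOneD, bimoduleD_bimoduleD]
    rfl)

variable (K A B M N) in
/-- The complex of cochains with exactly one argument in `M`. -/
def weightOneComplex : CochainComplex (ModuleCat.{u} K) ℕ :=
  CochainComplex.of (fun n => ModuleCat.of K (weightOne K A B M N n))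
    (fun n => ModuleCat.ofHom (weightOneD K A B M N n))
    (fun n => by
      rw [← ModuleCat.ofHom_comp, weightOneD_comp]
      rfl)

theorem weightOneComplex_d (n : ℕ) :
    (weightOneComplex K A B M N).d n (n + 1) = ModuleCat.ofHom (weightOneD K A B M N n) := by
  simp [weightOneComplex]

/-- The cochain of degree one given by the upper right entry. -/
def topRightCochain : Cochain K (TriangularAlgebra K A B M) M 1 :=
  head.symm (point.toLinearMap ∘ₗ topRightₗ)

@[simp] theorem head_topRightCochain (t : TriangularAlgebra K A B M) :
    head topRightCochain t = point (K := K) (T := TriangularAlgebra K A B M) t.topRight := by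
  simp [topRightCochain]

theorem topRightCochain_mem : topRightCochain ∈ weightOne K A B M M 1 :=
  ext_head fun t => ext_point (by
    rw [head_single, LinearMap.id_apply, map_add, point_symm_pre, head_topRightCochain]
    simp)

theorem bimoduleD_topRightCochain : bimoduleD K A B M M 1 topRightCochain = 0 :=
  ext_head fun s => ext_head fun t => ext_point (by
    rw [head_coboundary, head_rightD, map_sub, map_sub, LinearMap.sub_apply, LinearMap.sub_apply,
      head_post, head_mulHead, head_rightD_zero]
    simp [point_symm_post])

section Rep

variable (P : ∀ n, WeightOneRep K A B M n)

/-- The map out of a representing module given by a cochain. -/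
def WeightOneRep.desc {n : ℕ} (Q : WeightOneRep K A B M n)
    {f : Cochain K (TriangularAlgebra K A B M) N (n + 1)} (hf : f ∈ weightOne K A B M N (n + 1)) :
    Q.carrier →ₗ[A ⊗[K] Bᵐᵒᵖ] N :=
  (Q.existsUnique N f hf).choose

theorem WeightOneRep.post_desc {n : ℕ} (Q : WeightOneRep K A B M n)
    {f : Cochain K (TriangularAlgebra K A B M) N (n + 1)} (hf : f ∈ weightOne K A B M N (n + 1)) :
    post ((Q.desc hf).restrictScalars K) Q.universal = f :=
  (Q.existsUnique N f hf).choose_spec.1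

theorem WeightOneRep.post_universal_mem {n : ℕ} (Q : WeightOneRep K A B M n)
    (φ : Q.carrier →ₗ[A ⊗[K] Bᵐᵒᵖ] N) :
    post (φ.restrictScalars K) Q.universal ∈ weightOne K A B M N (n + 1) :=
  post_mem_weightOne _ Q.universal_mem

theorem WeightOneRep.hom_ext {n : ℕ} (Q : WeightOneRep K A B M n)
    {φ ψ : Q.carrier →ₗ[A ⊗[K] Bᵐᵒᵖ] N}
    (h : post (φ.restrictScalars K) Q.universal = post (ψ.restrictScalars K) Q.universal) :
    φ = ψ :=
  (Q.existsUnique N _ (Q.post_universal_mem ψ)).unique h rfl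

/-- The differential between the representing modules. -/
def repD (n : ℕ) : (P (n + 1)).carrier →ₗ[A ⊗[K] Bᵐᵒᵖ] (P n).carrier :=
  (P (n + 1)).desc (bimoduleD_mem_weightOne (P n).universal_mem)

theorem post_repD (n : ℕ) : post ((repD P n).restrictScalars K) (P (n + 1)).universal =
    bimoduleD K A B M _ (n + 1) (P n).universal :=
  (P (n + 1)).post_desc _

theorem post_comp_repD (n : ℕ) (φ : (P n).carrier →ₗ[A ⊗[K] Bᵐᵒᵖ] N) :
    post ((φ ∘ₗ repD P n).restrictScalars K) (P (n + 1)).universal =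
      bimoduleD K A B M _ (n + 1) (post (φ.restrictScalars K) (P n).universal) := by
  rw [bimoduleD_post, ← post_repD]
  rfl

/-- The augmentation of the complex of representing modules. -/
def repAug : (P 0).carrier →ₗ[A ⊗[K] Bᵐᵒᵖ] M := (P 0).desc topRightCochain_mem

theorem post_repAug :
    post ((repAug P).restrictScalars K) (P 0).universal = topRightCochain :=
  (P 0).post_desc _

theorem repD_comp_repD (n : ℕ) : repD P n ∘ₗ repD P (n + 1) = 0 :=
  (P (n + 2)).hom_ext (by
    rw [post_comp_repD, post_repD, bimoduleD_bimoduleD]; rfl)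

theorem repAug_comp_repD : repAug P ∘ₗ repD P 0 = 0 :=
  (P 1).hom_ext (by rw [post_comp_repD, post_repAug, bimoduleD_topRightCochain]; rfl)

theorem repAug_surjective : Function.Surjective (repAug P) := by
  intro x
  have := congrArg (fun f => point.symm (head f (mk 0 x 0))) (post_repAug P)
  rw [head_topRightCochain, head_post, point_symm_post] at this
  exact ⟨_, this⟩

/-- Let J be the cokernel of `repD P (n + 1)` over K. The quotient map q corresponds to an R-linear
map q' into the module coinduced from J. As q' kills the incoming differential it is a cocycle, so
it factors through the outgoing one. Elements killed by the outgoing differential are thus killed by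
q' and by q, that is, they are boundaries. -/
theorem exists_repD_eq (n : ℕ) (x : (P (n + 1)).carrier) (hx : repD P n x = 0) :
    ∃ y, repD P (n + 1) y = x := by
  let J := (P (n + 1)).carrier ⧸ LinearMap.range ((repD P (n + 1)).restrictScalars K)
  let q : (P (n + 1)).carrier →ₗ[K] J := Submodule.mkQ _
  let q' : (P (n + 1)).carrier →ₗ[A ⊗[K] Bᵐᵒᵖ] Coinduced K (A ⊗[K] Bᵐᵒᵖ) J := Coinduced.ofHom q
  have hq : q' ∘ₗ repD P (n + 1) = 0 := by
    ext y
    refine Coinduced.ext fun r => ?_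
    change q (r • repD P (n + 1) y) = 0
    rw [← map_smul]
    exact (Submodule.Quotient.mk_eq_zero _).2 ⟨_, rfl⟩
  obtain ⟨g, hg, hgq⟩ := exists_bimoduleD_eq ((P (n + 1)).post_universal_mem q') (by
    rw [← post_comp_repD, hq]; rfl)
  have h : (P n).desc hg ∘ₗ repD P n = q' := (P (n + 1)).hom_ext (by
    rw [post_comp_repD, WeightOneRep.post_desc, hgq])
  have h0 : q' x = 0 := by rw [← h, LinearMap.comp_apply, hx, map_zero]
  have h1 : q x = 0 := by
    have : q ((1 : A ⊗[K] Bᵐᵒᵖ) • x) = 0 :=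
      LinearMap.congr_fun (congrArg Coinduced.toHom h0) (1 : A ⊗[K] Bᵐᵒᵖ)
    rwa [one_smul] at this
  exact (Submodule.Quotient.mk_eq_zero _).1 h1

/-- The argument of `exists_repD_eq` at the end of the complex: a cocycle of degree one is a
K-linear map φ from M to J, so q' factors through the augmentation. -/
theorem exists_repD_zero_eq (x : (P 0).carrier) (hx : repAug P x = 0) :
    ∃ y, repD P 0 y = x := by
  let J := (P 0).carrier ⧸ LinearMap.range ((repD P 0).restrictScalars K)
  let q : (P 0).carrier →ₗ[K] J := Submodule.mkQ _
  let q' : (P 0).carrier →ₗ[A ⊗[K] Bᵐᵒᵖ] Coinduced K (A ⊗[K] Bᵐᵒᵖ) J := Coinduced.ofHom q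
  have hq : q' ∘ₗ repD P 0 = 0 := by
    ext y
    refine Coinduced.ext fun r => ?_
    change q (r • repD P 0 y) = 0
    rw [← map_smul]
    exact (Submodule.Quotient.mk_eq_zero _).2 ⟨_, rfl⟩
  obtain ⟨φ, hφ⟩ := exists_linearMap_of_bimoduleD_eq_zero
    (f := post (q'.restrictScalars K) (P 0).universal) (by rw [← post_comp_repD, hq]; rfl)
  have h : Coinduced.ofHom φ ∘ₗ repAug P = q' := (P 0).hom_ext (by
    have e : ∀ ψ : M →ₗ[A ⊗[K] Bᵐᵒᵖ] Coinduced K (A ⊗[K] Bᵐᵒᵖ) J,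
      post ((ψ ∘ₗ repAug P).restrictScalars K) (P 0).universal =
        post (ψ.restrictScalars K) topRightCochain := fun ψ => by rw [← post_repAug P]; rfl
    rw [e]
    refine ext_head fun t => ext_point (Coinduced.ext fun r => ?_)
    have hm := (P 0).post_universal_mem q'
    -- With a single argument, having exactly one argument in M means depending only on the upper
    -- right entry.
    have h2 : point.symm (head (post (q'.restrictScalars K) (P 0).universal) t) =
        point.symm (head (post (q'.restrictScalars K) (P 0).universal) (mk 0 t.topRight 0)) := by
      conv_lhs => rw [← mem_weightOne.1 hm, head_single, single_zero, add_zero, point_symm_pre]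
      rfl
    rw [h2, hφ, head_post, head_topRightCochain, point_symm_post, LinearEquiv.symm_apply_apply]
    rfl)
  have h0 : q' x = 0 := by rw [← h, LinearMap.comp_apply, hx, map_zero]
  have h1 : q x = 0 := by
    have : q ((1 : A ⊗[K] Bᵐᵒᵖ) • x) = 0 :=
      LinearMap.congr_fun (congrArg Coinduced.toHom h0) (1 : A ⊗[K] Bᵐᵒᵖ)
    rwa [one_smul] at this
  exact (Submodule.Quotient.mk_eq_zero _).1 h1

/-- The chain complex of representing modules. -/
def repComplex : ChainComplex (ModuleCat.{u} (A ⊗[K] Bᵐᵒᵖ)) ℕ :=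
  ChainComplex.of (fun n => ModuleCat.of (A ⊗[K] Bᵐᵒᵖ) (P n).carrier)
    (fun n => ModuleCat.ofHom (repD P n))
    (fun n => by rw [← ModuleCat.ofHom_comp, repD_comp_repD]; rfl)

theorem repComplex_d (n : ℕ) : (repComplex P).d (n + 1) n = ModuleCat.ofHom (repD P n) := by
  simp [repComplex]

/-- The projective resolution of `M` by representing modules. -/
def repResolution : ProjectiveResolution (ModuleCat.of (A ⊗[K] Bᵐᵒᵖ) M) :=
  projectiveResolutionOfExact (repComplex P)
    (fun n => (IsProjective.iff_projective (P n).carrier).1 (P n).projective)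
    (ModuleCat.ofHom (repAug P))
    (by
      rw [repComplex_d]
      exact ModuleCat.hom_ext (repAug_comp_repD P))
    (fun n x hx => by
      rw [repComplex_d] at hx ⊢
      exact exists_repD_eq P n x hx)
    (fun x hx => by
      rw [repComplex_d]
      exact exists_repD_zero_eq P x hx)
    (repAug_surjective P)

/-- The linear map underlying a morphism. -/
def WeightOneRep.ofHom {X : Type u} [AddCommGroup X] [Module (A ⊗[K] Bᵐᵒᵖ) X]
    (φ : ModuleCat.of (A ⊗[K] Bᵐᵒᵖ) X ⟶ ModuleCat.of (A ⊗[K] Bᵐᵒᵖ) N) :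
    X →ₗ[A ⊗[K] Bᵐᵒᵖ] N := φ.hom

/-- Maps out of the representing module are cochains. -/
def WeightOneRep.homEquiv {n : ℕ} (Q : WeightOneRep K A B M n) :
    letI : Linear K (ModuleCat.{u} (A ⊗[K] Bᵐᵒᵖ)) := ModuleCat.Algebra.instLinear
    (((linearYoneda K (ModuleCat.{u} (A ⊗[K] Bᵐᵒᵖ))).obj (ModuleCat.of _ N)).obj
      (Opposite.op (ModuleCat.of _ Q.carrier))) ≃ₗ[K] weightOne K A B M N (n + 1) where
  toFun φ := ⟨post ((WeightOneRep.ofHom φ).restrictScalars K) Q.universal,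
    Q.post_universal_mem (WeightOneRep.ofHom φ)⟩
  map_add' _ _ := rfl
  map_smul' c φ := Subtype.ext (MultilinearMap.ext fun v =>
    algebraMap_smul (A ⊗[K] Bᵐᵒᵖ) c (WeightOneRep.ofHom φ (Q.universal v)))
  invFun f := ModuleCat.ofHom (Q.desc f.2)
  left_inv _ := ModuleCat.hom_ext (Q.hom_ext (Q.post_desc (Q.post_universal_mem _)))
  right_inv f := Subtype.ext (Q.post_desc f.2)

end Rep

/-- The cohomology of the complex of cochains with exactly one argument in `M` computes `Ext`. -/
theorem nonempty_extModule_equiv [Module.Projective K A] [Module.Projective K B]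
    [Module.Projective K M] (n : ℕ) :
    Nonempty (extModule K (A ⊗[K] Bᵐᵒᵖ) M N n ≃ₗ[K]
      (weightOneComplex K A B M N).homology (n + 1)) := by
  let : Linear K (ModuleCat.{u} (A ⊗[K] Bᵐᵒᵖ)) := ModuleCat.Algebra.instLinear
  let P : ∀ n, WeightOneRep K A B M n := fun n => (nonempty_weightOneRep K A B M n).some
  let D := (repComplex P).linearYonedaObj K (ModuleCat.of (A ⊗[K] Bᵐᵒᵖ) N)
  let W := weightOneComplex K A B M N
  let e : ∀ k, D.X k ≃ₗ[K] W.X (k + 1) := fun k => (P k).homEquiv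
  have hd : ∀ (k : ℕ) (φ : D.X k), e (k + 1) (D.d k (k + 1) φ) = W.d (k + 1) (k + 2) (e k φ) := by
    intro k φ
    have h1 : D.d k (k + 1) φ = ModuleCat.ofHom (repD P k) ≫ φ := by
      rw [← repComplex_d]; rfl
    have h2 : W.d (k + 1) (k + 2) = ModuleCat.ofHom (weightOneD K A B M N (k + 1)) :=
      weightOneComplex_d (k + 1)
    rw [h1, h2]
    exact Subtype.ext (post_comp_repD P k (WeightOneRep.ofHom φ))
  refine Nonempty.map (fun e => ((repResolution P).isoExt n _).toLinearEquiv ≪≫ₗ e)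
    (nonempty_homology_equiv D W n (n + 1) (e n) (fun x => ?_) (fun x => ?_))
  · exact (LinearEquiv.map_eq_zero_iff (e (n + 1))).symm.trans
      (Iff.of_eq (congrArg (· = 0) (hd n x)))
  · constructor
    · rintro ⟨k, y, rfl⟩
      by_cases h : k + 1 = n
      · subst h
        exact ⟨k + 1, e k y, (hd k y).symm⟩
      · refine ⟨0, 0, ?_⟩
        rw [D.shape k n h]
        exact (map_zero _).trans (map_zero (e n)).symm
    · rintro ⟨k, y, hy⟩
      by_cases h : k = n ∧ n ≠ 0
      · obtain ⟨rfl, h⟩ := h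
        obtain ⟨k, rfl⟩ := Nat.exists_eq_succ_of_ne_zero h
        obtain ⟨y, rfl⟩ := (e k).surjective y
        exact ⟨k, y, (e (k + 1)).injective ((hd k y).trans hy)⟩
      -- Here the boundary is zero: either the differential vanishes for reasons of shape, or n = 0
      -- and it starts from the zero module in degree zero.
      · refine ⟨n, 0, (map_zero _).trans (Eq.symm ((LinearEquiv.map_eq_zero_iff (e n)).1 ?_))⟩
        rw [← hy]
        by_cases hk : k = n
        · subst hk
          obtain rfl : k = 0 := by_contra fun h0 => h ⟨rfl, h0⟩
          obtain rfl : y = 0 := Subtype.ext (eq_zero_of_mem_weightOne_zero y.2)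
          exact map_zero _
        · rw [W.shape k (n + 1) (fun h => hk (Nat.succ_injective h))]
          rfl

theorem weightOneComplex_homology_zero (x : (weightOneComplex K A B M N).homology 0) : x = 0 := by
  have h0 : Limits.IsZero ((weightOneComplex K A B M N).X 0) :=
    @ModuleCat.isZero_of_subsingleton _ _ _
      ⟨fun a b => Subtype.ext ((eq_zero_of_mem_weightOne_zero a.2).trans
        (eq_zero_of_mem_weightOne_zero b.2).symm)⟩
  have h1 : Limits.IsZero ((weightOneComplex K A B M N).homology 0) :=
    ShortComplex.isZero_homology_of_isZero_X₂ _ h0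
  have := ModuleCat.subsingleton_of_isZero h1
  exact Subsingleton.elim _ _

end TriangularAlgebra

end

/-! ### Cochains of the triangular algebra of a power -/

noncomputable section

namespace TriangularAlgebra

open Cochain

variable {K : Type w} {A B M N L : Type u} [CommRing K] [Ring A] [Algebra K A] [Ring B] [Algebra K B]
  [AddCommGroup M] [Module K M] [Module (A ⊗[K] Bᵐᵒᵖ) M] [IsScalarTower K (A ⊗[K] Bᵐᵒᵖ) M]
  [AddCommGroup N] [Module K N] [Module (A ⊗[K] Bᵐᵒᵖ) N] [IsScalarTower K (A ⊗[K] Bᵐᵒᵖ) N]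
  [AddCommGroup L] [Module K L] [Module (A ⊗[K] Bᵐᵒᵖ) L] [IsScalarTower K (A ⊗[K] Bᵐᵒᵖ) L]
  {n : ℕ}

/-- The map of cochains with values in the bimodule induced by module maps in both directions. -/
def transport (φ : M →ₗ[A ⊗[K] Bᵐᵒᵖ] N) (ψ : N →ₗ[A ⊗[K] Bᵐᵒᵖ] M) (n : ℕ) :
    Cochain K (TriangularAlgebra K A B M) M n →ₗ[K] Cochain K (TriangularAlgebra K A B N) N n :=
  post (φ.restrictScalars K) ∘ₗ pre (mapRight ψ)

/-- The map of cochains with values in the algebra induced by module maps in both directions. -/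
def transportAlg (φ : M →ₗ[A ⊗[K] Bᵐᵒᵖ] N) (ψ : N →ₗ[A ⊗[K] Bᵐᵒᵖ] M) (n : ℕ) :
    Cochain K (TriangularAlgebra K A B M) (TriangularAlgebra K A B M) n →ₗ[K]
      Cochain K (TriangularAlgebra K A B N) (TriangularAlgebra K A B N) n :=
  post (mapRight φ) ∘ₗ pre (mapRight ψ)

variable (K A B M) in
/-- The upper right entry of the part of a cochain with exactly one argument in `M`. -/
def topRightPart (n : ℕ) :
    Cochain K (TriangularAlgebra K A B M) (TriangularAlgebra K A B M) n →ₗ[K]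
      Cochain K (TriangularAlgebra K A B M) M n :=
  post topRightₗ ∘ₗ single diag off n

theorem topRightPart_mem
    (f : Cochain K (TriangularAlgebra K A B M) (TriangularAlgebra K A B M) n) :
    topRightPart K A B M n f ∈ weightOne K A B M M n := by
  change single diag off n (post topRightₗ (single diag off n f)) = _
  rw [single_post, single_single diag_comp_diag diag_comp_off off_comp_diag off_comp_off]
  rfl

theorem topRightPart_post_inTopRight {f : Cochain K (TriangularAlgebra K A B M) M n}
    (hf : f ∈ weightOne K A B M M n) : topRightPart K A B M n (post inTopRight f) = f := by
  have h : topRightPart K A B M n (post inTopRight f) =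
    post topRightₗ (single diag off n (post inTopRight f)) := rfl
  rw [h, single_post, mem_weightOne.1 hf]
  rfl

theorem project_eq (f : Cochain K (TriangularAlgebra K A B M) (TriangularAlgebra K A B M) n) :
    project diag off n f =
      transportAlg 0 0 n f + post inTopRight (topRightPart K A B M n f) := rfl

theorem single_pre_mapRight {X : Type*} [AddCommGroup X] [Module K X]
    (ψ : N →ₗ[A ⊗[K] Bᵐᵒᵖ] M) (f : Cochain K (TriangularAlgebra K A B M) X n) :
    single diag off n (pre (mapRight ψ) f) = pre (mapRight ψ) (single diag off n f) :=
  single_pre _ _ _ (LinearMap.ext fun t => by ext <;> simp) (LinearMap.ext fun t => by ext <;> simp) f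

theorem transport_mem (φ : M →ₗ[A ⊗[K] Bᵐᵒᵖ] N) (ψ : N →ₗ[A ⊗[K] Bᵐᵒᵖ] M)
    {f : Cochain K (TriangularAlgebra K A B M) M n} (hf : f ∈ weightOne K A B M M n) :
    transport φ ψ n f ∈ weightOne K A B N N n := by
  refine post_mem_weightOne (φ.restrictScalars K) ?_
  rw [mem_weightOne, single_pre_mapRight, mem_weightOne.1 hf]

theorem topRightPart_transportAlg (φ : M →ₗ[A ⊗[K] Bᵐᵒᵖ] N) (ψ : N →ₗ[A ⊗[K] Bᵐᵒᵖ] M)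
    (f : Cochain K (TriangularAlgebra K A B M) (TriangularAlgebra K A B M) n) :
    topRightPart K A B N n (transportAlg φ ψ n f) =
      transport φ ψ n (topRightPart K A B M n f) := by
  have h : topRightPart K A B N n (transportAlg φ ψ n f) =
    post topRightₗ (single diag off n (post (mapRight φ) (pre (mapRight ψ) f))) := rfl
  rw [h, single_post, single_pre_mapRight]
  rfl

/-- No relation between φ and ψ is needed: the algebra acts on the coefficients through the diagonal
entries, and `mapRight ψ` does not change these. -/
theorem bimoduleD_transport (φ : M →ₗ[A ⊗[K] Bᵐᵒᵖ] N) (ψ : N →ₗ[A ⊗[K] Bᵐᵒᵖ] M)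
    (f : Cochain K (TriangularAlgebra K A B M) M n) :
    bimoduleD K A B N N n (transport φ ψ n f) =
      transport φ ψ (n + 1) (bimoduleD K A B M M n f) := by
  have h : bimoduleD K A B N M n (pre (mapRight ψ) f) =
      pre (mapRight ψ) (bimoduleD K A B M M n f) :=
    coboundary_pre _ (mapRight_mul ψ) (fun _ _ => rfl) (fun _ _ => rfl) f
  change bimoduleD K A B N N n (post (φ.restrictScalars K) (pre (mapRight ψ) f)) = _
  rw [bimoduleD_post, h]
  rfl

/-- Here the coefficients are the algebra itself, and `mapRight φ` is a bimodule map over the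
algebra of N because φ(ψ(t)x) = φ(ψ(t))φ(x) = tφ(x). -/
theorem hochschildD_transportAlg (φ : M →ₗ[A ⊗[K] Bᵐᵒᵖ] N) (ψ : N →ₗ[A ⊗[K] Bᵐᵒᵖ] M)
    (h : φ ∘ₗ ψ = LinearMap.id)
    (f : Cochain K (TriangularAlgebra K A B M) (TriangularAlgebra K A B M) n) :
    hochschildD K (TriangularAlgebra K A B N) n (transportAlg φ ψ n f) =
      transportAlg φ ψ (n + 1) (hochschildD K (TriangularAlgebra K A B M) n f) := by
  have hφ : ∀ t : TriangularAlgebra K A B N, mapRight φ (mapRight ψ t) = t := fun t => by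
    ext
    · rfl
    · exact LinearMap.congr_fun h t.topRight
    · rfl
  rw [hochschildD_eq_coboundary, hochschildD_eq_coboundary]
  let μ := LinearMap.mul K (TriangularAlgebra K A B M)
  have h1 : coboundary (μ ∘ₗ mapRight ψ) (μ.compl₂ (mapRight ψ)) n (pre (mapRight ψ) f) =
      pre (mapRight ψ) (coboundary μ μ n f) :=
    coboundary_pre _ (mapRight_mul ψ) (fun _ _ => rfl) (fun _ _ => rfl) f
  refine (coboundary_post (mapRight φ) (fun t x => ?_) (fun x t => ?_) _).trans
    (congrArg (post (mapRight φ)) h1)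
  · change mapRight φ (mapRight ψ t * x) = t * mapRight φ x
    rw [mapRight_mul, hφ]
  · change mapRight φ (x * mapRight ψ t) = mapRight φ x * t
    rw [mapRight_mul, hφ]

/-- Both sides are coboundaries, over the algebra of N, of the same cochain with values in the
algebra of M, on which the algebra of N acts through `mapRight φ`. -/
theorem post_hochschildD_eq (φ : N →ₗ[A ⊗[K] Bᵐᵒᵖ] M)
    {f : Cochain K (TriangularAlgebra K A B M) (TriangularAlgebra K A B M) n}
    {g : Cochain K (TriangularAlgebra K A B N) (TriangularAlgebra K A B N) n}
    (h : post (mapRight φ) g = pre (mapRight φ) f) :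
    post (mapRight φ) (hochschildD K (TriangularAlgebra K A B N) n g) =
      pre (mapRight φ) (hochschildD K (TriangularAlgebra K A B M) n f) := by
  let μ := LinearMap.mul K (TriangularAlgebra K A B M)
  have h1 := coboundary_post (l := LinearMap.mul K (TriangularAlgebra K A B N))
    (ρ := LinearMap.mul K (TriangularAlgebra K A B N)) (l' := μ ∘ₗ mapRight φ)
    (ρ' := μ.compl₂ (mapRight φ)) (mapRight φ)
    (fun t x => mapRight_mul φ t x) (fun x t => mapRight_mul φ x t) g
  have h2 : coboundary (μ ∘ₗ mapRight φ) (μ.compl₂ (mapRight φ)) n (pre (mapRight φ) f) =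
      pre (mapRight φ) (coboundary μ μ n f) :=
    coboundary_pre _ (mapRight_mul φ) (fun _ _ => rfl) (fun _ _ => rfl) _
  rw [hochschildD_eq_coboundary, hochschildD_eq_coboundary, ← h1, h, h2]

theorem hochschildD_post_inTopRight (f : Cochain K (TriangularAlgebra K A B M) M n) :
    hochschildD K (TriangularAlgebra K A B M) n (post inTopRight f) =
      post inTopRight (bimoduleD K A B M M n f) := by
  rw [hochschildD_eq_coboundary]
  exact coboundary_post inTopRight (fun t x => by ext <;> simp) (fun t x => by ext <;> simp) f

theorem post_inTopRight_injective {f g : Cochain K (TriangularAlgebra K A B M) M n}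
    (h : post (inTopRight : M →ₗ[K] TriangularAlgebra K A B M) f = post inTopRight g) : f = g :=
  congrArg (post topRightₗ) h

/-- Exactly one argument passes through ψ, hence the dependence on ψ is linear. -/
theorem pre_mapRight_sum {X : Type*} [AddCommGroup X] [Module K X] {ι : Type*} (s : Finset ι)
    (ψ : ι → N →ₗ[A ⊗[K] Bᵐᵒᵖ] M) {n : ℕ} (f : Cochain K (TriangularAlgebra K A B M) X n) :
    pre (mapRight (∑ j ∈ s, ψ j)) (single diag off n f) =
      ∑ j ∈ s, pre (mapRight (ψ j)) (single diag off n f) := by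
  induction n with
  | zero => simp
  | succ n ih =>
    refine ext_head fun t => ?_
    have e : ∀ ψ : N →ₗ[A ⊗[K] Bᵐᵒᵖ] M, head (pre (mapRight ψ) (single diag off (n + 1) f)) t =
        pre (mapRight 0) (head f (mk 0 (ψ t.topRight) 0)) +
          pre (mapRight ψ) (single diag off n (head f (mk t.topLeft 0 t.botRight))) := fun ψ => by
      rw [head_pre, head_single, map_add, pre_pre]
      rfl
    have e2 : ∀ x : M, (mk 0 x 0 : TriangularAlgebra K A B M) = inTopRight x := fun _ => rfl
    rw [e, ih, map_sum, LinearMap.sum_apply, e2, LinearMap.sum_apply, map_sum, map_sum, map_sum,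
      ← Finset.sum_add_distrib]
    exact Finset.sum_congr rfl fun j _ => (e (ψ j)).symm

theorem transport_sum_right (φ : M →ₗ[A ⊗[K] Bᵐᵒᵖ] N) {ι : Type*} (s : Finset ι)
    (ψ : ι → N →ₗ[A ⊗[K] Bᵐᵒᵖ] M) {f : Cochain K (TriangularAlgebra K A B M) M n}
    (hf : f ∈ weightOne K A B M M n) :
    transport φ (∑ j ∈ s, ψ j) n f = ∑ j ∈ s, transport φ (ψ j) n f := by
  change post _ (pre _ f) = _
  rw [← mem_weightOne.1 hf, pre_mapRight_sum, map_sum]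
  rfl

theorem transport_sum_left {ι : Type*} (s : Finset ι) (φ : ι → M →ₗ[A ⊗[K] Bᵐᵒᵖ] N)
    (ψ : N →ₗ[A ⊗[K] Bᵐᵒᵖ] M) (f : Cochain K (TriangularAlgebra K A B M) M n) :
    transport (∑ j ∈ s, φ j) ψ n f = ∑ j ∈ s, transport (φ j) ψ n f := by
  refine MultilinearMap.ext fun v => ?_
  change (∑ j ∈ s, φ j) _ = _
  rw [LinearMap.sum_apply, sum_apply]
  rfl

theorem transport_zero_right (φ : M →ₗ[A ⊗[K] Bᵐᵒᵖ] N)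
    {f : Cochain K (TriangularAlgebra K A B M) M n} (hf : f ∈ weightOne K A B M M n) :
    transport φ 0 n f = 0 := by
  simpa using transport_sum_right φ (∅ : Finset ℕ) (fun _ => 0) hf

theorem transport_zero_left (ψ : N →ₗ[A ⊗[K] Bᵐᵒᵖ] M)
    (f : Cochain K (TriangularAlgebra K A B M) M n) : transport 0 ψ n f = 0 := rfl

theorem transport_id (f : Cochain K (TriangularAlgebra K A B M) M n) :
    transport LinearMap.id LinearMap.id n f = f := rfl

theorem transport_transport (φ : M →ₗ[A ⊗[K] Bᵐᵒᵖ] N) (ψ : N →ₗ[A ⊗[K] Bᵐᵒᵖ] M)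
    (φ' : N →ₗ[A ⊗[K] Bᵐᵒᵖ] L) (ψ' : L →ₗ[A ⊗[K] Bᵐᵒᵖ] N)
    (f : Cochain K (TriangularAlgebra K A B M) M n) :
    transport φ' ψ' n (transport φ ψ n f) = transport (φ' ∘ₗ φ) (ψ ∘ₗ ψ') n f := rfl

section Power

variable {I : Type} [Fintype I] [DecidableEq I]

variable (K A B M I) in
/-- The cochain of the triangular algebra of the power `Mᴵ` obtained from a cochain of the
triangular algebra of `M` by acting diagonally. -/
def powerLift (n : ℕ) :
    Cochain K (TriangularAlgebra K A B M) (TriangularAlgebra K A B M) n →ₗ[K]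
      Cochain K (TriangularAlgebra K A B (I → M)) (TriangularAlgebra K A B (I → M)) n :=
  transportAlg 0 0 n + ∑ i, post inTopRight ∘ₗ
    transport (LinearMap.single _ (fun _ : I => M) i) (LinearMap.proj i) n ∘ₗ
      topRightPart K A B M n

theorem powerLift_apply
    (f : Cochain K (TriangularAlgebra K A B M) (TriangularAlgebra K A B M) n) :
    powerLift K A B M I n f = transportAlg 0 0 n f + post inTopRight
      (∑ i, transport (LinearMap.single _ (fun _ : I => M) i) (LinearMap.proj i) n
        (topRightPart K A B M n f)) := by
  simp [powerLift]

/-- The lift is characterized by being related to `project f` under every coordinate projection, all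
of which are algebra maps. Its two summands are not chain maps separately. -/
theorem post_proj_powerLift (i : I)
    (f : Cochain K (TriangularAlgebra K A B M) (TriangularAlgebra K A B M) n) :
    post (mapRight (LinearMap.proj i)) (powerLift K A B M I n f) =
      pre (mapRight (LinearMap.proj i)) (project diag off n f) := by
  rw [powerLift_apply, project_eq, map_add, map_add]
  congr 1
  refine MultilinearMap.ext fun v => TriangularAlgebra.ext rfl ?_ rfl
  change (∑ j, transport (LinearMap.single _ (fun _ : I => M) j) (LinearMap.proj j) n
        (topRightPart K A B M n f)) v i = _
  rw [sum_apply, Finset.sum_apply, Finset.sum_eq_single i]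
  · exact Pi.single_eq_same i _
  · intro j _ hj
    exact Pi.single_eq_of_ne hj.symm _
  · simp

theorem ext_post_proj [Nonempty I] {X : Type*} [AddCommGroup X] [Module K X]
    {f g : Cochain K X (TriangularAlgebra K A B (I → M)) n}
    (h : ∀ i, post (mapRight (LinearMap.proj i : (I → M) →ₗ[A ⊗[K] Bᵐᵒᵖ] M)) f =
      post (mapRight (LinearMap.proj i)) g) : f = g := by
  obtain ⟨o⟩ := ‹Nonempty I›
  have h' : ∀ i v, mapRight (LinearMap.proj i : (I → M) →ₗ[A ⊗[K] Bᵐᵒᵖ] M) (f v) =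
      mapRight (LinearMap.proj i) (g v) := fun i v => congrArg (fun f => f v) (h i)
  exact MultilinearMap.ext fun v => TriangularAlgebra.ext
    (by have := congrArg topLeft (h' o v); exact this)
    (funext fun i => congrArg topRight (h' i v))
    (by have := congrArg botRight (h' o v); exact this)

/-- Coordinate projections carry the lift to `project f`, relatedness under algebra maps passes to
coboundaries, and `project` is a chain map. The projections are jointly injective; a coordinate must
exist for them to see the diagonal entries. -/
theorem hochschildD_powerLift [Nonempty I]
    (f : Cochain K (TriangularAlgebra K A B M) (TriangularAlgebra K A B M) n) :
    hochschildD K (TriangularAlgebra K A B (I → M)) n (powerLift K A B M I n f) =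
      powerLift K A B M I (n + 1) (hochschildD K (TriangularAlgebra K A B M) n f) := by
  refine ext_post_proj fun i => ?_
  rw [post_hochschildD_eq _ (post_proj_powerLift i f), post_proj_powerLift,
    hochschildD_eq_coboundary, project_coboundary f isTriangular]

variable (o : I)

variable (K A B M) in
/-- Restriction of cochains to a summand of the power. -/
abbrev powerRestrict (n : ℕ) :
    Cochain K (TriangularAlgebra K A B (I → M)) (TriangularAlgebra K A B (I → M)) n →ₗ[K]
      Cochain K (TriangularAlgebra K A B M) (TriangularAlgebra K A B M) n :=
  transportAlg (LinearMap.proj o) (LinearMap.single _ (fun _ : I => M) o) n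

theorem powerRestrict_powerLift
    (f : Cochain K (TriangularAlgebra K A B M) (TriangularAlgebra K A B M) n) :
    powerRestrict K A B M o n (powerLift K A B M I n f) = project diag off n f := by
  change post _ (pre _ _) = _
  rw [← pre_post, post_proj_powerLift, pre_pre]
  have h : (mapRight (LinearMap.proj o) ∘ₗ mapRight (LinearMap.single _ (fun _ : I => M) o) :
      TriangularAlgebra K A B M →ₗ[K] TriangularAlgebra K A B M) = LinearMap.id :=
    LinearMap.ext fun t => TriangularAlgebra.ext rfl (Pi.single_eq_same o _) rfl
  rw [h]
  rfl

variable (K A B M) in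
/-- The part of a cochain of the triangular algebra of a power that is killed by restriction to a
summand. -/
def powerRest (n : ℕ) :
    Cochain K (TriangularAlgebra K A B (I → M)) (TriangularAlgebra K A B (I → M)) n →ₗ[K]
      Cochain K (TriangularAlgebra K A B (I → M)) (I → M) n :=
  topRightPart K A B (I → M) n - ∑ i, transport (LinearMap.single _ (fun _ : I => M) i)
    (LinearMap.proj i) n ∘ₗ topRightPart K A B M n ∘ₗ powerRestrict K A B M o n

theorem powerRest_apply
    (f : Cochain K (TriangularAlgebra K A B (I → M)) (TriangularAlgebra K A B (I → M)) n) :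
    powerRest K A B M o n f = topRightPart K A B (I → M) n f -
      ∑ i, transport (LinearMap.single _ (fun _ : I => M) i) (LinearMap.proj i) n
        (topRightPart K A B M n (powerRestrict K A B M o n f)) := by
  simp [powerRest]

theorem powerRest_mem
    (f : Cochain K (TriangularAlgebra K A B (I → M)) (TriangularAlgebra K A B (I → M)) n) :
    powerRest K A B M o n f ∈ weightOne K A B (I → M) (I → M) n := by
  rw [powerRest_apply]
  exact sub_mem (topRightPart_mem f)
    (sum_mem fun i _ => transport_mem _ _ (topRightPart_mem _))

theorem powerLift_add_powerRest
    (f : Cochain K (TriangularAlgebra K A B (I → M)) (TriangularAlgebra K A B (I → M)) n) :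
    powerLift K A B M I n (powerRestrict K A B M o n f) +
      post inTopRight (powerRest K A B M o n f) = project diag off n f := by
  have h : transportAlg (0 : M →ₗ[A ⊗[K] Bᵐᵒᵖ] (I → M)) 0 n (powerRestrict K A B M o n f) =
      transportAlg 0 0 n f := by
    have e : (mapRight (LinearMap.single _ (fun _ : I => M) o) ∘ₗ mapRight 0 :
        TriangularAlgebra K A B (I → M) →ₗ[K] TriangularAlgebra K A B (I → M)) = mapRight 0 :=
      LinearMap.ext fun t => TriangularAlgebra.ext rfl (Pi.single_zero o) rfl
    exact congrArg (fun φ => post (mapRight 0) (pre φ f)) e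
  rw [powerLift_apply, project_eq, powerRest_apply, h, map_sub]
  abel

/-- In `powerLift_add_powerRest` the other two terms are chain maps, so this one is too. -/
theorem bimoduleD_powerRest [Nonempty I]
    (f : Cochain K (TriangularAlgebra K A B (I → M)) (TriangularAlgebra K A B (I → M)) n) :
    bimoduleD K A B (I → M) (I → M) n (powerRest K A B M o n f) =
      powerRest K A B M o (n + 1) (hochschildD K (TriangularAlgebra K A B (I → M)) n f) := by
  refine post_inTopRight_injective ?_
  rw [← hochschildD_post_inTopRight]
  have h1 := powerLift_add_powerRest o f
  have h2 := powerLift_add_powerRest o (hochschildD K (TriangularAlgebra K A B (I → M)) n f)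
  rw [hochschildD_eq_coboundary, project_coboundary f isTriangular, ← hochschildD_eq_coboundary,
    ← h1, map_add, ← hochschildD_transportAlg _ _ (LinearMap.proj_comp_single_same _ _ _),
    hochschildD_powerLift] at h2
  exact (add_left_cancel h2).symm

theorem powerRestrict_post_inTopRight
    (f : Cochain K (TriangularAlgebra K A B (I → M)) (I → M) n) :
    powerRestrict K A B M o n (post inTopRight f) = post inTopRight
      (transport (LinearMap.proj o) (LinearMap.single _ (fun _ : I => M) o) n f) := rfl

theorem powerRest_post_inTopRight
    {f : Cochain K (TriangularAlgebra K A B (I → M)) (I → M) n}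
    (hf : f ∈ weightOne K A B (I → M) (I → M) n)
    (h : transport (LinearMap.proj o) (LinearMap.single _ (fun _ : I => M) o) n f = 0) :
    powerRest K A B M o n (post inTopRight f) = f := by
  rw [powerRest_apply, powerRestrict_post_inTopRight, h, topRightPart_post_inTopRight hf]
  simp

/-- Restrict `powerLift_add_powerRest` to the summand o. Restriction commutes with `project`, and
restricting the lift already gives `project` of the restriction, so nothing is left for the entry
(o, o). -/
theorem transport_powerRest
    (f : Cochain K (TriangularAlgebra K A B (I → M)) (TriangularAlgebra K A B (I → M)) n) :
    transport (LinearMap.proj o) (LinearMap.single _ (fun _ : I => M) o) n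
      (powerRest K A B M o n f) = 0 := by
  have h := congrArg (powerRestrict K A B M o n) (powerLift_add_powerRest o f)
  rw [map_add, powerRestrict_powerLift, powerRestrict_post_inTopRight] at h
  have e : powerRestrict K A B M o n (project diag off n f) =
      project diag off n (powerRestrict K A B M o n f) := by
    rw [project_eq, project_eq, map_add, powerRestrict_post_inTopRight, topRightPart_transportAlg]
    congr 1
    have e1 : (mapRight (0 : (I → M) →ₗ[A ⊗[K] Bᵐᵒᵖ] (I → M)) ∘ₗ
        mapRight (LinearMap.single _ (fun _ : I => M) o) :
        TriangularAlgebra K A B M →ₗ[K] TriangularAlgebra K A B (I → M)) =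
          mapRight (LinearMap.single _ (fun _ : I => M) o) ∘ₗ mapRight 0 :=
      LinearMap.ext fun t => TriangularAlgebra.ext rfl (Pi.single_zero o).symm rfl
    exact congrArg (fun φ => post (mapRight 0) (pre φ f)) e1
  rw [e] at h
  exact post_inTopRight_injective ((add_eq_left.1 h).trans (map_zero _).symm)

/-- Expand the identity of Mᴵ into coordinate idempotents both on the value and on the argument. On
the argument this needs that exactly one of them is in Mᴵ. -/
theorem sum_transport_eq {f : Cochain K (TriangularAlgebra K A B (I → M)) (I → M) n}
    (hf : f ∈ weightOne K A B (I → M) (I → M) n) :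
    ∑ i : I × I, transport (LinearMap.single _ (fun _ : I => M) i.1) (LinearMap.proj i.2) n
      (transport (LinearMap.proj i.1) (LinearMap.single _ (fun _ : I => M) i.2) n f) = f := by
  have e : ∑ i : I, (LinearMap.single _ (fun _ : I => M) i : M →ₗ[A ⊗[K] Bᵐᵒᵖ] I → M) ∘ₗ
      LinearMap.proj i = LinearMap.id := by
    ext x i
    simp [Finset.sum_apply]
  conv_rhs => rw [← transport_id f, ← e, transport_sum_left]
  rw [Fintype.sum_prod_type]
  refine Finset.sum_congr rfl fun i _ => ?_
  rw [transport_sum_right _ _ _ hf]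
  rfl

theorem transport_single_proj (i j k l : I) {f : Cochain K (TriangularAlgebra K A B M) M n}
    (hf : f ∈ weightOne K A B M M n) :
    transport (LinearMap.proj i) (LinearMap.single _ (fun _ : I => M) j) n
      (transport (LinearMap.single _ (fun _ : I => M) k) (LinearMap.proj l) n f) =
        if i = k ∧ j = l then f else 0 := by
  rw [transport_transport]
  by_cases hi : i = k
  · by_cases hj : j = l
    · subst hi hj
      rw [LinearMap.proj_comp_single_same, LinearMap.proj_comp_single_same, if_pos ⟨rfl, rfl⟩]
      rfl
    · rw [LinearMap.proj_comp_single_ne _ _ _ _ (Ne.symm hj), transport_zero_right _ hf,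
        if_neg fun h => hj h.2]
  · rw [LinearMap.proj_comp_single_ne _ _ _ _ hi, transport_zero_left,
      if_neg fun h => hi h.1]

end Power

end TriangularAlgebra

end

/-! ### The split exact sequence in cohomology -/

noncomputable section

section Splitting

variable {K : Type w} [CommRing K]

/-- A map of cochain complexes of modules from commuting linear maps. -/
def cochainMapOfLinear {C D : CochainComplex (ModuleCat.{u} K) ℕ} (F : ∀ n, C.X n →ₗ[K] D.X n)
    (h : ∀ n x, D.d n (n + 1) (F n x) = F (n + 1) (C.d n (n + 1) x)) : C ⟶ D where
  f n := ModuleCat.ofHom (F n)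
  comm' i j hij := by
    obtain rfl : i + 1 = j := hij
    exact ModuleCat.hom_ext (LinearMap.ext fun x => h i x)

theorem cochainMap_ext {C D : CochainComplex (ModuleCat.{u} K) ℕ} {F G : C ⟶ D}
    (h : ∀ n x, F.f n x = G.f n x) : F = G :=
  HomologicalComplex.hom_ext _ _ fun n => ModuleCat.hom_ext (LinearMap.ext (h n))

theorem cochainMap_sum_f_apply {C D : CochainComplex (ModuleCat.{u} K) ℕ} {ι : Type*}
    (s : Finset ι) (F : ι → (C ⟶ D)) (n : ℕ) (x : C.X n) :
    (∑ i ∈ s, F i).f n x = ∑ i ∈ s, (F i).f n x := by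
  have h := (HomologicalComplex.eval (ModuleCat.{u} K) (ComplexShape.up ℕ) n).map_sum F s
  have h' : (∑ i ∈ s, F i).f n = ∑ i ∈ s, (F i).f n := h
  rw [h']
  exact (LinearMap.congr_fun (ModuleCat.hom_sum _ _) x).trans (LinearMap.sum_apply _ _ _)

theorem cochainMap_add_f_apply {C D : CochainComplex (ModuleCat.{u} K) ℕ} (F G : C ⟶ D) (n : ℕ)
    (x : C.X n) : (F + G).f n x = F.f n x + G.f n x := rfl

/-- Homotopy retraction data on cochain complexes give a split exact sequence in cohomology. -/
theorem exists_split_exact {C D W : CochainComplex (ModuleCat.{u} K) ℕ} {ι : Type} [Fintype ι]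
    [DecidableEq ι] (r : C ⟶ D) (s : D ⟶ C) (E : ι → (W ⟶ C)) (G : ι → (C ⟶ W)) (n : ℕ)
    (hs : HomologicalComplex.homologyMap (s ≫ r) n = 𝟙 _)
    (hC : HomologicalComplex.homologyMap (r ≫ s + ∑ i, G i ≫ E i) n = 𝟙 _)
    (hr : ∀ i, E i ≫ r = 0) (hE : ∀ i j, E i ≫ G j = if i = j then 𝟙 _ else 0)
    {X : Type*} [AddCommGroup X] [Module K X] (e : X ≃ₗ[K] W.homology n) :
    ∃ (l : (ι → X) →ₗ[K] C.homology n) (t : D.homology n →ₗ[K] C.homology n),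
      Function.Injective l ∧
      Function.Exact l (HomologicalComplex.homologyMap r n).hom ∧
      Function.Surjective (HomologicalComplex.homologyMap r n).hom ∧
      (HomologicalComplex.homologyMap r n).hom ∘ₗ t = LinearMap.id := by
  let ρ := (HomologicalComplex.homologyMap r n).hom
  let σ := (HomologicalComplex.homologyMap s n).hom
  let ε := fun i => (HomologicalComplex.homologyMap (E i) n).hom
  let γ := fun i => (HomologicalComplex.homologyMap (G i) n).hom
  have hρσ : ∀ x, ρ (σ x) = x := fun x => by
    rw [HomologicalComplex.homologyMap_comp] at hs
    exact LinearMap.congr_fun (congrArg ModuleCat.Hom.hom hs) x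
  have hρε : ∀ i x, ρ (ε i x) = 0 := fun i x => by
    have := HomologicalComplex.homologyMap_comp (E i) r n
    rw [hr, HomologicalComplex.homologyMap_zero] at this
    exact (LinearMap.congr_fun (congrArg ModuleCat.Hom.hom this) x).symm
  have hγε : ∀ i j x, γ j (ε i x) = if i = j then x else 0 := fun i j x => by
    have := HomologicalComplex.homologyMap_comp (E i) (G j) n
    rw [hE] at this
    refine (LinearMap.congr_fun (congrArg ModuleCat.Hom.hom this) x).symm.trans ?_
    split_ifs
    · rw [HomologicalComplex.homologyMap_id]; rfl
    · rw [HomologicalComplex.homologyMap_zero]; rfl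
  have hsum : ∀ x, σ (ρ x) + ∑ i, ε i (γ i x) = x := fun x => by
    have h1 := (HomologicalComplex.homologyFunctor (ModuleCat.{u} K) (ComplexShape.up ℕ) n).map_sum
      (fun i => G i ≫ E i) Finset.univ
    have h2 : HomologicalComplex.homologyMap (∑ i, G i ≫ E i) n =
      ∑ i, HomologicalComplex.homologyMap (G i ≫ E i) n := h1
    rw [HomologicalComplex.homologyMap_add, h2] at hC
    simp only [HomologicalComplex.homologyMap_comp] at hC
    have h3 := LinearMap.congr_fun (congrArg ModuleCat.Hom.hom hC) x
    rw [ModuleCat.hom_add, LinearMap.add_apply, ModuleCat.hom_sum, LinearMap.sum_apply] at h3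
    exact h3
  let l : (ι → X) →ₗ[K] C.homology n := ∑ i, ε i ∘ₗ e.toLinearMap ∘ₗ LinearMap.proj i
  have hl : ∀ x, l x = ∑ i, ε i (e (x i)) := fun x => by simp [l]
  have hρl : ∀ x, ρ (l x) = 0 := fun x => by
    rw [hl, map_sum]
    exact Finset.sum_eq_zero fun i _ => hρε i _
  refine ⟨l, σ, ?_, ?_, fun x => ⟨σ x, hρσ x⟩, LinearMap.ext hρσ⟩
  · rw [injective_iff_map_eq_zero]
    intro x hx
    funext j
    have h := congrArg (γ j) hx
    rw [hl, map_sum, map_zero] at h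
    simp only [hγε] at h
    rw [Finset.sum_ite_eq' Finset.univ j, if_pos (Finset.mem_univ j)] at h
    exact (LinearEquiv.map_eq_zero_iff e).1 h
  · intro x
    refine ⟨fun hx => ⟨fun i => e.symm (γ i x), ?_⟩, ?_⟩
    · rw [hl]
      have h := hsum x
      have hx' : ρ x = 0 := hx
      rw [hx', map_zero, zero_add] at h
      simpa using h
    · rintro ⟨y, rfl⟩
      exact hρl y

end Splitting

namespace TriangularAlgebra

open Cochain

variable {K : Type w} {A B M N : Type u} [CommRing K] [Ring A] [Algebra K A] [Ring B] [Algebra K B]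
  [AddCommGroup M] [Module K M] [Module (A ⊗[K] Bᵐᵒᵖ) M] [IsScalarTower K (A ⊗[K] Bᵐᵒᵖ) M]
  [AddCommGroup N] [Module K N] [Module (A ⊗[K] Bᵐᵒᵖ) N] [IsScalarTower K (A ⊗[K] Bᵐᵒᵖ) N]

theorem hochschildComplex_d_apply {T : Type u} [Ring T] [Algebra K T] (n : ℕ)
    (x : (hochschildComplex K T).X n) :
    (hochschildComplex K T).d n (n + 1) x = hochschildD K T n x := by
  rw [hochschildComplex_d]; rfl

theorem weightOneComplex_d_apply (n : ℕ) (x : (weightOneComplex K A B M N).X n) :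
    (weightOneComplex K A B M N).d n (n + 1) x = weightOneD K A B M N n x := by
  rw [weightOneComplex_d]; rfl

variable (K A B M) in
/-- The projection of the Hochschild complex to the cochains of the diagonal and those with exactly
one argument above it. -/
def projectMap : hochschildComplex K (TriangularAlgebra K A B M) ⟶
    hochschildComplex K (TriangularAlgebra K A B M) :=
  cochainMapOfLinear (fun n => project diag off n) fun n x => by
    rw [hochschildComplex_d_apply, hochschildComplex_d_apply, hochschildD_eq_coboundary]
    exact (project_coboundary (x : Cochain K _ _ n) isTriangular).symm

theorem project_add_projectHomotopy_zero
    (f : Cochain K (TriangularAlgebra K A B M) (TriangularAlgebra K A B M) 0) :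
    project diag off 0 f + projectHomotopy diag off (mk 1 0 0) (mk 0 0 1) 0
      (hochschildD K (TriangularAlgebra K A B M) 0 f) = f := by
  rw [hochschildD_eq_coboundary, coboundary_projectHomotopy_zero f isTriangular,
    add_sub_cancel]

theorem project_add_projectHomotopy_succ {n : ℕ}
    (f : Cochain K (TriangularAlgebra K A B M) (TriangularAlgebra K A B M) (n + 1)) :
    project diag off (n + 1) f +
      (projectHomotopy diag off (mk 1 0 0) (mk 0 0 1) (n + 1)
        (hochschildD K (TriangularAlgebra K A B M) (n + 1) f) +
      hochschildD K (TriangularAlgebra K A B M) n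
        (projectHomotopy diag off (mk 1 0 0) (mk 0 0 1) n f)) = f := by
  have h := (add_comm _ _).trans (coboundary_projectHomotopy f isTriangular)
  rw [hochschildD_eq_coboundary, hochschildD_eq_coboundary, h, add_sub_cancel]

/-- The identity is `projectMap` plus the null-homotopic map built from `projectHomotopy`. -/
theorem homologyMap_projectMap (n : ℕ) :
    HomologicalComplex.homologyMap (projectMap K A B M) n = 𝟙 _ := by
  let C := hochschildComplex K (TriangularAlgebra K A B M)
  let hom : ∀ i j, (ComplexShape.up ℕ).Rel j i → (C.X i ⟶ C.X j) := fun i j h =>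
    eqToHom (congrArg C.X (show i = j + 1 from h.symm)) ≫
      ModuleCat.ofHom (projectHomotopy diag off (mk 1 0 0) (mk 0 0 1) j)
  have key : 𝟙 C = projectMap K A B M + Homotopy.nullHomotopicMap' hom := by
    refine HomologicalComplex.hom_ext _ _ fun k => ?_
    rw [HomologicalComplex.add_f_apply]
    cases k with
    | zero =>
      rw [Homotopy.nullHomotopicMap'_f_of_not_rel_right (show (ComplexShape.up ℕ).Rel 0 1 from rfl)
        (fun l h => Nat.succ_ne_zero l h)]
      refine ModuleCat.hom_ext (LinearMap.ext fun x => ?_)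
      refine (project_add_projectHomotopy_zero x).symm.trans
        (congrArg (project diag off 0 x + ·) ?_)
      rw [← hochschildComplex_d_apply]
      rfl
    | succ k =>
      rw [Homotopy.nullHomotopicMap'_f (show (ComplexShape.up ℕ).Rel k (k + 1) from rfl)
        (show (ComplexShape.up ℕ).Rel (k + 1) (k + 2) from rfl)]
      refine ModuleCat.hom_ext (LinearMap.ext fun x => ?_)
      refine (project_add_projectHomotopy_succ x).symm.trans
        (congrArg (project diag off (k + 1) x + ·) ?_)
      rw [← hochschildComplex_d_apply]
      refine congrArg₂ (· + ·) rfl ?_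
      exact (hochschildComplex_d_apply k _).symm
  have h := congrArg (fun F => HomologicalComplex.homologyMap F n) key
  simp only [HomologicalComplex.homologyMap_add, HomologicalComplex.homologyMap_id,
    (Homotopy.nullHomotopy' hom).homologyMap_eq, HomologicalComplex.homologyMap_zero,
    add_zero] at h
  exact h.symm

/-- Maps between the complexes of cochains with exactly one argument in the bimodule. -/
def transportMap (φ : M →ₗ[A ⊗[K] Bᵐᵒᵖ] N) (ψ : N →ₗ[A ⊗[K] Bᵐᵒᵖ] M) :
    weightOneComplex K A B M M ⟶ weightOneComplex K A B N N :=
  cochainMapOfLinear (fun n => (transport φ ψ n).restrict fun _ hf => transport_mem φ ψ hf)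
    fun n x => by
      rw [weightOneComplex_d_apply, weightOneComplex_d_apply]
      exact Subtype.ext (bimoduleD_transport φ ψ _)

variable (K A B M) in
/-- The inclusion of the cochains with values above the diagonal. -/
def inTopRightMap :
    weightOneComplex K A B M M ⟶ hochschildComplex K (TriangularAlgebra K A B M) :=
  cochainMapOfLinear (fun n => post inTopRight ∘ₗ (weightOne K A B M M n).subtype) fun n x => by
    rw [weightOneComplex_d_apply, hochschildComplex_d_apply]
    exact hochschildD_post_inTopRight _

section Power

variable {I : Type} [Fintype I] [DecidableEq I] (o : I)

variable (K A B M I) in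
/-- The diagonal lift as a map of complexes. -/
def powerLiftMap [Nonempty I] : hochschildComplex K (TriangularAlgebra K A B M) ⟶
    hochschildComplex K (TriangularAlgebra K A B (I → M)) :=
  cochainMapOfLinear (fun n => powerLift K A B M I n) fun n x => by
    rw [hochschildComplex_d_apply, hochschildComplex_d_apply]
    exact hochschildD_powerLift _

variable (K A B M) in
/-- The part killed by restriction as a map of complexes. -/
def powerRestMap : hochschildComplex K (TriangularAlgebra K A B (I → M)) ⟶
    weightOneComplex K A B (I → M) (I → M) :=
  cochainMapOfLinear (fun n => (powerRest K A B M o n).codRestrict _ (powerRest_mem o))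
    fun n x => by
      have : Nonempty I := ⟨o⟩
      rw [weightOneComplex_d_apply, hochschildComplex_d_apply]
      exact Subtype.ext (bimoduleD_powerRest o _)

variable (K A B M) in
/-- Restriction to a summand as a map of complexes. -/
abbrev powerRestrictMap : hochschildComplex K (TriangularAlgebra K A B (I → M)) ⟶
    hochschildComplex K (TriangularAlgebra K A B M) :=
  cochainRestrict (LinearMap.single _ (fun _ : I => M) o) (LinearMap.proj o)
    (LinearMap.proj_comp_single_same _ _ _)

variable (K A B M) in
/-- The inclusion of the matrix entry `(i, j)`. -/
abbrev entryInMap (i : I × I) :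
    weightOneComplex K A B M M ⟶ hochschildComplex K (TriangularAlgebra K A B (I → M)) :=
  transportMap (LinearMap.single _ (fun _ : I => M) i.1) (LinearMap.proj i.2) ≫
    inTopRightMap K A B (I → M)

variable (K A B M) in
/-- The projection onto the matrix entry `(i, j)`. -/
abbrev entryOutMap (i : I × I) :
    hochschildComplex K (TriangularAlgebra K A B (I → M)) ⟶ weightOneComplex K A B M M :=
  powerRestMap K A B M o ≫
    transportMap (LinearMap.proj i.1) (LinearMap.single _ (fun _ : I => M) i.2)

theorem powerLiftMap_comp_powerRestrictMap [Nonempty I] :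
    powerLiftMap K A B M I ≫ powerRestrictMap K A B M o = projectMap K A B M :=
  cochainMap_ext fun _ x => powerRestrict_powerLift o x

theorem entryInMap_comp_powerRestrictMap {i : I × I} (hi : i ≠ (o, o)) :
    entryInMap K A B M i ≫ powerRestrictMap K A B M o = 0 :=
  cochainMap_ext fun n x => by
    refine (congrArg (post inTopRight) ((transport_single_proj o o i.1 i.2 x.2).trans
      (if_neg fun h => hi (Prod.ext h.1.symm h.2.symm)))).trans (map_zero _)

theorem entryInMap_comp_entryOutMap {i : I × I} (hi : i ≠ (o, o)) (j : I × I) :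
    entryInMap K A B M i ≫ entryOutMap K A B M o j = if i = j then 𝟙 _ else 0 :=
  cochainMap_ext fun n x => by
    have h0 := (transport_single_proj o o i.1 i.2 x.2).trans
      (if_neg fun h => hi (Prod.ext h.1.symm h.2.symm))
    have h1 := powerRest_post_inTopRight o (transport_mem _ _ x.2) h0
    have h2 := (congrArg (transport (LinearMap.proj j.1)
      (LinearMap.single _ (fun _ : I => M) j.2) n) h1).trans
        (transport_single_proj j.1 j.2 i.1 i.2 x.2)
    by_cases h : i = j
    · subst h
      rw [if_pos rfl]
      exact Subtype.ext (h2.trans (if_pos ⟨rfl, rfl⟩))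
    · rw [if_neg h]
      exact Subtype.ext (h2.trans (if_neg fun h' => h (Prod.ext h'.1.symm h'.2.symm)))

theorem powerRestrictMap_comp_powerLiftMap_add_sum [Nonempty I] :
    powerRestrictMap K A B M o ≫ powerLiftMap K A B M I +
      ∑ i : {i : I × I // i ≠ (o, o)}, entryOutMap K A B M o i ≫ entryInMap K A B M i =
        projectMap K A B (I → M) :=
  cochainMap_ext fun n x => by
    have h1 := powerLift_add_powerRest o
      (x : Cochain K (TriangularAlgebra K A B (I → M)) (TriangularAlgebra K A B (I → M)) n)
    rw [cochainMap_add_f_apply, cochainMap_sum_f_apply]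
    refine Eq.trans (congrArg (powerLift K A B M I n (powerRestrict K A B M o n x) + ·) ?_) h1
    let F : I × I → Cochain K (TriangularAlgebra K A B (I → M)) (I → M) n := fun i =>
      transport (LinearMap.single _ (fun _ : I => M) i.1) (LinearMap.proj i.2) n
        (transport (LinearMap.proj i.1) (LinearMap.single _ (fun _ : I => M) i.2) n
          (powerRest K A B M o n x))
    have h2 : ∑ i, F i = powerRest K A B M o n x := sum_transport_eq (powerRest_mem o _)
    have h3 : F (o, o) = 0 :=
      (congrArg (transport _ _ n) (transport_powerRest o _)).trans (map_zero _)
    -- The entry (o, o) vanishes, so the sum over all matrix entries is the sum over the other ones.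
    rw [← h2, ← Finset.sum_erase Finset.univ h3, map_sum]
    exact (Finset.sum_subtype (Finset.univ.erase (o, o)) (p := fun i => i ≠ (o, o)) (by simp)
      (fun i => post inTopRight (F i))).symm

/-- The split exact sequence in Hochschild cohomology for the triangular algebra of a power. -/
theorem exists_split_exact_power (n : ℕ) {X : Type*} [AddCommGroup X] [Module K X]
    (e : X ≃ₗ[K] (weightOneComplex K A B M M).homology n) :
    ∃ (l : ({i : I × I // i ≠ (o, o)} → X) →ₗ[K]
          HochschildCohomology K (TriangularAlgebra K A B (I → M)) n)
      (t : HochschildCohomology K (TriangularAlgebra K A B M) n →ₗ[K]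
          HochschildCohomology K (TriangularAlgebra K A B (I → M)) n),
      Function.Injective l ∧
      Function.Exact l (HomologicalComplex.homologyMap (powerRestrictMap K A B M o) n).hom ∧
      Function.Surjective (HomologicalComplex.homologyMap (powerRestrictMap K A B M o) n).hom ∧
      (HomologicalComplex.homologyMap (powerRestrictMap K A B M o) n).hom ∘ₗ t = LinearMap.id :=
  have : Nonempty I := ⟨o⟩
  exists_split_exact (powerRestrictMap K A B M o) (powerLiftMap K A B M I)
    (fun i : {i : I × I // i ≠ (o, o)} => entryInMap K A B M i)
    (fun i => entryOutMap K A B M o i) n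
    (by rw [powerLiftMap_comp_powerRestrictMap, homologyMap_projectMap])
    (by rw [powerRestrictMap_comp_powerLiftMap_add_sum, homologyMap_projectMap])
    (fun i => entryInMap_comp_powerRestrictMap o i.2)
    (fun i j => by rw [entryInMap_comp_entryOutMap o i.2]; simp only [Subtype.ext_iff])
    e

end Power

end TriangularAlgebra

end

/-! ### Finiteness, dimensions and series -/

noncomputable section

section Finiteness

variable {K : Type w} [CommRing K]

theorem finite_homology [IsNoetherianRing K] (C : CochainComplex (ModuleCat.{u} K) ℕ) (n : ℕ)
    [Module.Finite K (C.X n)] : Module.Finite K (C.homology n) := by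
  have h : Module.Finite K (C.sc n).X₂ := ‹Module.Finite K (C.X n)›
  have h' : Module.Finite K (C.sc n).moduleCatLeftHomologyData.H :=
    inferInstanceAs (Module.Finite K (_ ⧸ LinearMap.range (C.sc n).moduleCatToCycles))
  exact Module.Finite.equiv (C.sc n).moduleCatHomologyIso.toLinearEquiv.symm

theorem finrank_eq_of_split_exact (hK : IsField K) {V W U : Type*} [AddCommGroup V] [Module K V]
    [AddCommGroup W] [Module K W] [AddCommGroup U] [Module K U] [Module.Finite K V]
    [Module.Finite K W] [Module.Finite K U] {k : ℕ} (l : (Fin k → V) →ₗ[K] U) (r : U →ₗ[K] W)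
    (hl : Function.Injective l) (he : Function.Exact l r) (hr : Function.Surjective r) :
    Module.finrank K U = Module.finrank K W + k * Module.finrank K V := by
  -- The field is chosen to have the given ring structure, so the module structures at hand become
  -- vector spaces without any transport.
  obtain ⟨F, rfl⟩ : ∃ F : Field K, F.toCommRing = ‹CommRing K› := ⟨hK.toField, rfl⟩
  rw [← LinearMap.finrank_range_add_finrank_ker r, LinearMap.range_eq_top.2 hr, finrank_top,
    LinearMap.exact_iff.1 he, LinearMap.finrank_range_of_inj hl, Module.finrank_pi_fintype]
  simp

theorem finite_hochschildCohomology (hK : IsField K) {T : Type u} [Ring T] [Algebra K T]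
    [Module.Finite K T] (n : ℕ) : Module.Finite K (HochschildCohomology K T n) := by
  obtain ⟨F, rfl⟩ : ∃ F : Field K, F.toCommRing = ‹CommRing K› := ⟨hK.toField, rfl⟩
  have h : Module.Finite K ((hochschildComplex K T).X n) :=
    inferInstanceAs (Module.Finite K (HochschildCochain K T n))
  exact finite_homology _ n

end Finiteness

namespace TriangularAlgebra

variable {K : Type w} {A B M N : Type u} [CommRing K] [Ring A] [Algebra K A] [Ring B] [Algebra K B]
  [AddCommGroup M] [Module K M] [Module (A ⊗[K] Bᵐᵒᵖ) M] [IsScalarTower K (A ⊗[K] Bᵐᵒᵖ) M]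
  [AddCommGroup N] [Module K N] [Module (A ⊗[K] Bᵐᵒᵖ) N] [IsScalarTower K (A ⊗[K] Bᵐᵒᵖ) N]

instance [Module.Finite K A] [Module.Finite K B] [Module.Finite K M] :
    Module.Finite K (TriangularAlgebra K A B M) :=
  inferInstanceAs (Module.Finite K (A × M × B))

theorem finite_extModule (hK : IsField K) [Module.Finite K A] [Module.Finite K B]
    [Module.Finite K M] [Module.Finite K N] (n : ℕ) :
    Module.Finite K (extModule K (A ⊗[K] Bᵐᵒᵖ) M N n) := by
  obtain ⟨F, rfl⟩ : ∃ F : Field K, F.toCommRing = ‹CommRing K› := ⟨hK.toField, rfl⟩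
  have h : Module.Finite K ((weightOneComplex K A B M N).X (n + 1)) :=
    inferInstanceAs (Module.Finite K (weightOne K A B M N (n + 1)))
  have := finite_homology (weightOneComplex K A B M N) (n + 1)
  obtain ⟨e⟩ := nonempty_extModule_equiv (K := K) (A := A) (B := B) (M := M) (N := N) n
  exact Module.Finite.equiv e.symm

theorem nonempty_extModulePred_equiv [Module.Projective K A] [Module.Projective K B]
    [Module.Projective K M] (n : ℕ) :
    Nonempty (extModulePred K (A ⊗[K] Bᵐᵒᵖ) M N n ≃ₗ[K]
      (weightOneComplex K A B M N).homology n) := by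
  cases n with
  | zero =>
    have h : Subsingleton ((weightOneComplex K A B M N).homology 0) :=
      ⟨fun a b => (weightOneComplex_homology_zero a).trans (weightOneComplex_homology_zero b).symm⟩
    have h' : Subsingleton (extModulePred K (A ⊗[K] Bᵐᵒᵖ) M N 0) :=
      inferInstanceAs (Subsingleton PUnit.{u + 1})
    exact ⟨LinearEquiv.ofSubsingleton _ _⟩
  | succ n => exact nonempty_extModule_equiv n

theorem exists_split_exact_kronecker [Module.Projective K A] [Module.Projective K B]
    [Module.Projective K M] (m : ℕ) (hm : 1 ≤ m) (n : ℕ) :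
    ∃ (l : (Fin (m ^ 2 - 1) → extModulePred K (A ⊗[K] Bᵐᵒᵖ) M M n) →ₗ[K]
          HochschildCohomology K (KroneckerAlgebra K A B M m) n)
      (s : HochschildCohomology K (TriangularAlgebra K A B M) n →ₗ[K]
          HochschildCohomology K (KroneckerAlgebra K A B M m) n),
      Function.Injective l ∧
      Function.Exact l (kroneckerRestrict K A B M m hm n) ∧
      Function.Surjective (kroneckerRestrict K A B M m hm n) ∧
      kroneckerRestrict K A B M m hm n ∘ₗ s = LinearMap.id := by
  obtain ⟨e⟩ := nonempty_extModulePred_equiv (K := K) (A := A) (B := B) (M := M) (N := M) n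
  let o : Fin m := ⟨0, hm⟩
  obtain ⟨l, s, hl, he, hr, hs⟩ := exists_split_exact_power o n e
  have hcard : Fintype.card {i : Fin m × Fin m // i ≠ (o, o)} = m ^ 2 - 1 := by
    rw [Fintype.card_subtype_compl, Fintype.card_prod, Fintype.card_fin, sq]
    simp
  let c := LinearEquiv.funCongrLeft K (extModulePred K (A ⊗[K] Bᵐᵒᵖ) M M n)
    (Fintype.equivFinOfCardEq hcard)
  refine ⟨l ∘ₗ c.toLinearMap, s, hl.comp c.injective, fun x => ?_, hr, hs⟩
  refine (he x).trans ⟨?_, ?_⟩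
  · rintro ⟨y, rfl⟩
    exact ⟨c.symm y, by simp⟩
  · rintro ⟨y, rfl⟩
    exact ⟨c y, rfl⟩

theorem hilbertPoincareSeries_kronecker (hK : IsField K) [Module.Projective K A]
    [Module.Projective K B] [Module.Projective K M] [Module.Finite K A] [Module.Finite K B]
    [Module.Finite K M] (m : ℕ) (hm : 1 ≤ m) :
    hilbertPoincareSeries K (KroneckerAlgebra K A B M m) =
      hilbertPoincareSeries K (TriangularAlgebra K A B M)
        + PowerSeries.X * (((m : ℤ) ^ 2 - 1) • extSeries K (A ⊗[K] Bᵐᵒᵖ) M M) := by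
  -- The truncated subtraction is harmless because m ≥ 1.
  have hm' : ((m ^ 2 - 1 : ℕ) : ℤ) = (m : ℤ) ^ 2 - 1 := by
    rw [Nat.cast_sub (Nat.one_le_pow _ _ hm)]
    simp
  have : Nontrivial K := hK.nontrivial
  have : Module.Finite K (KroneckerAlgebra K A B M m) :=
    inferInstanceAs (Module.Finite K (A × (Fin m → M) × B))
  ext n
  have h1 := finite_hochschildCohomology (T := TriangularAlgebra K A B M) hK n
  have h2 := finite_hochschildCohomology (T := KroneckerAlgebra K A B M m) hK n
  have h3 : Module.Finite K (extModulePred K (A ⊗[K] Bᵐᵒᵖ) M M n) := by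
    cases n with
    | zero => exact inferInstanceAs (Module.Finite K PUnit.{u + 1})
    | succ n => exact finite_extModule hK n
  obtain ⟨l, s, hl, he, hr, -⟩ := exists_split_exact_kronecker (K := K) (A := A) (B := B) (M := M)
    m hm n
  have h := finrank_eq_of_split_exact hK l _ hl he hr
  rw [map_add]
  simp only [hilbertPoincareSeries, extSeries, PowerSeries.coeff_mk]
  rw [h, Nat.cast_add, Nat.cast_mul, hm']
  congr 1
  cases n with
  | zero =>
    have h0 : Module.finrank K (extModulePred K (A ⊗[K] Bᵐᵒᵖ) M M 0) = 0 :=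
      have : Subsingleton (extModulePred K (A ⊗[K] Bᵐᵒᵖ) M M 0) :=
        inferInstanceAs (Subsingleton PUnit.{u + 1})
      Module.finrank_zero_of_subsingleton
    rw [h0, PowerSeries.coeff_zero_X_mul]
    simp
  | succ n =>
    rw [PowerSeries.coeff_succ_X_mul, map_zsmul, PowerSeries.coeff_mk, smul_eq_mul]
    rfl

end TriangularAlgebra

end

/-! ### Assembly of the main theorem -/

theorem mainTheorem2 {K : Type w} [CommRing K]
    {A B M : Type u} [Ring A] [Algebra K A] [Ring B] [Algebra K B]
    [AddCommGroup M] [Module K M] [Module (A ⊗[K] Bᵐᵒᵖ) M] [IsScalarTower K (A ⊗[K] Bᵐᵒᵖ) M]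
    (hA : Module.Projective K A) (hB : Module.Projective K B) (hM : Module.Projective K M) :
    (∀ (m : ℕ) (hm : 1 ≤ m) (n : ℕ),
      ∃ (l : (Fin (m ^ 2 - 1) → extModulePred K (A ⊗[K] Bᵐᵒᵖ) M M n) →ₗ[K]
            HochschildCohomology K (KroneckerAlgebra K A B M m) n)
        (s : HochschildCohomology K (TriangularAlgebra K A B M) n →ₗ[K]
            HochschildCohomology K (KroneckerAlgebra K A B M m) n),
        Function.Injective l ∧
        Function.Exact l (kroneckerRestrict K A B M m hm n) ∧
        Function.Surjective (kroneckerRestrict K A B M m hm n) ∧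
        kroneckerRestrict K A B M m hm n ∘ₗ s = LinearMap.id) ∧
    (IsField K → Module.Finite K A → Module.Finite K B → Module.Finite K M →
      (∀ n : ℕ, Module.Finite K (extModule K (A ⊗[K] Bᵐᵒᵖ) M M n)) ∧
      (∀ n : ℕ, Module.Finite K (HochschildCohomology K (TriangularAlgebra K A B M) n)) ∧
      (∀ m : ℕ, 1 ≤ m → ∀ n : ℕ,
        Module.Finite K (HochschildCohomology K (KroneckerAlgebra K A B M m) n)) ∧
      (∀ m : ℕ, 1 ≤ m →
        hilbertPoincareSeries K (KroneckerAlgebra K A B M m) =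
          hilbertPoincareSeries K (TriangularAlgebra K A B M)
            + PowerSeries.X * (((m : ℤ) ^ 2 - 1) • extSeries K (A ⊗[K] Bᵐᵒᵖ) M M)) ∧
      (∀ p : ℕ, 0 < p → CharP K p →
        ∀ χ' : ℕ → PowerSeries (ZMod p),
          (∀ m : ℕ, χ' m = PowerSeries.map (Int.castRingHom (ZMod p))
            (hilbertPoincareSeries K (KroneckerAlgebra K A B M m))) →
          (∀ m m' : ℕ, 1 ≤ m → 1 ≤ m' → m ^ 2 ≡ m' ^ 2 [MOD p] → χ' m = χ' m') ∧
          (∀ m : ℕ, 1 ≤ m → χ' (m + p) = χ' m) ∧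
          χ' (p - 1) = χ' 1 ∧ χ' 1 = χ' (p + 1))) := by
  refine ⟨TriangularAlgebra.exists_split_exact_kronecker, fun hK hfA hfB hfM => ?_⟩
  have key := TriangularAlgebra.hilbertPoincareSeries_kronecker (A := A) (B := B) (M := M) hK
  refine ⟨TriangularAlgebra.finite_extModule hK, finite_hochschildCohomology hK, fun m _ =>
    have : Module.Finite K (KroneckerAlgebra K A B M m) :=
      inferInstanceAs (Module.Finite K (A × (Fin m → M) × B))
    finite_hochschildCohomology hK, key, fun p hp hchar χ' hχ => ?_⟩
  have hmod : ∀ m m' : ℕ, 1 ≤ m → 1 ≤ m' → m ^ 2 ≡ m' ^ 2 [MOD p] → χ' m = χ' m' := by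
    intro m m' hm hm' h
    have hc : (((m : ℤ) ^ 2 - 1 : ℤ) : ZMod p) = (((m' : ℤ) ^ 2 - 1 : ℤ) : ZMod p) := by
      have := (ZMod.natCast_eq_natCast_iff _ _ p).2 h
      push_cast at this ⊢
      rw [this]
    rw [hχ, hχ, key m hm, key m' hm', map_add, map_add, map_mul, map_mul, map_zsmul, map_zsmul,
      ← Int.cast_smul_eq_zsmul (ZMod p), ← Int.cast_smul_eq_zsmul (ZMod p), hc]
  -- Needed so that p - 1 ≥ 1: characteristic one would make the field K trivial.
  have hp2 : 2 ≤ p := by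
    rcases Nat.lt_or_ge p 2 with h | h
    · obtain rfl : p = 1 := by omega
      obtain ⟨x, y, hxy⟩ := hK.exists_pair_ne
      refine absurd ?_ hxy
      have h1 : (1 : K) = 0 := Nat.cast_one.symm.trans (CharP.cast_eq_zero K 1)
      rw [← one_mul x, ← one_mul y, h1, zero_mul, zero_mul]
    · exact h
  have hadd : ∀ m : ℕ, (m + p) ^ 2 ≡ m ^ 2 [MOD p] := fun m => by
    have : (m + p) ^ 2 = m ^ 2 + p * (2 * m + p) := by ring
    rw [Nat.ModEq, this, Nat.add_mul_mod_self_left]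
  refine ⟨hmod, fun m hm => hmod _ _ (by omega) hm (hadd m), ?_, ?_⟩
  · refine hmod _ _ (by omega) le_rfl ?_
    obtain ⟨q, rfl⟩ := Nat.exists_eq_add_of_le hp2
    -- With p = 2 + q this is (p - 1)² = 1 + p(p - 2), free of truncated subtraction on the right.
    have : (2 + q - 1) ^ 2 = 1 ^ 2 + (2 + q) * q := by
      rw [show 2 + q - 1 = q + 1 by omega]; ring
    rw [Nat.ModEq, this, Nat.add_mul_mod_self_left]
  · refine (hmod _ _ (by omega) le_rfl ?_).symm
    rw [add_comm p 1]
    exact hadd 1
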